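/- Let $F_n$ be the free group of rank $n$, and let $\rho:\operatorname{Aut}(F_n)\to\operatorname{Aut}(F_n/F_n')\cong \mathrm{GL}_n(\mathbb Z)$ be the natural homomorphism, where $F_n'$ is the commutator subgroup of $F_n$. Put $\operatorname{Aut}^+(F_n)=\rho^{-1}(\mathrm{SL}_n(\mathbb Z))$. For a finite group $G$ and an epimorphism $\pi:F_n\to G$ put $\Gamma^+(G,\pi)=\{\varphi\in\operatorname{Aut}^+(F_n)\mid \pi\varphi=\pi\}$. Write $H^{\mathrm{ab}}$ for the abelianization of a group $H$. Theorem. Let $m,n$ be positive integers such that $m\ge 3$, $n\mid m$ and $(m,n)\neq(3,1)$. Let $G=\mathbb Z/m\mathbb Z\times\mathbb Z/n\mathbb Z$ and let $\pi:F_2\to G$ be an epimorphism. Then $$\Gamma^+(G,\pi)^{\mathrm{ab}}\cong G\times\mathbb Z^{r},\qquad r=1+\frac{nm^2}{12}\prod_{p\mid m}\bigl(1-p^{-2}\bigr),$$ where the product runs over all primes $p$ dividing $m$ (in particular, $r$ is a non-negative integer). Furthermore, for every epimorphism $\pi$ from $F_2$ onto the group in question, $$\Gamma^+(\mathbb Z/2\mathbb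 Z,\pi)^{\mathrm{ab}}\cong \mathbb Z/2\mathbb Z\times\mathbb Z/4\mathbb Z\times\mathbb Z,$$ $$\Gamma^+(\mathbb Z/3\mathbb Z,\pi)^{\mathrm{ab}}\cong \mathbb Z/3\mathbb Z\times\mathbb Z/3\mathbb Z\times\mathbb Z,$$ $$\Gamma^+(\mathbb Z/2\mathbb Z\times\mathbb Z/2\mathbb Z,\pi)^{\mathrm{ab}}\cong (\mathbb Z/2\mathbb Z)^3\times\mathbb Z^2.$$ -/

import Mathlib

/-- `Fₙ / Fₙ'`, written additively. -/
abbrev FreeGroupAb (n : ℕ) : Type := Additive (Abelianization (FreeGroup (Fin n)))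

/-- The class of `w` in `Fₙ / Fₙ'`. -/
def toFreeGroupAb {n : ℕ} (w : FreeGroup (Fin n)) : FreeGroupAb n :=
  Additive.ofMul (Abelianization.of w)

/-- The standard basis of `Fₙ / Fₙ'` over `ℤ`, given by the classes of the free generators. -/
noncomputable def freeGroupAbBasis (n : ℕ) : Module.Basis (Fin n) ℤ (FreeGroupAb n) :=
  (FreeAbelianGroup.basis (Fin n)).map
    (AddEquiv.toIntLinearEquiv (AddEquiv.refl (FreeAbelianGroup (Fin n)) :
      FreeAbelianGroup (Fin n) ≃+ FreeGroupAb n))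

theorem freeGroupAbBasis_apply (n : ℕ) (i : Fin n) :
    freeGroupAbBasis n i = toFreeGroupAb (FreeGroup.of i) := by
  have h : FreeAbelianGroup.basis (Fin n) i = FreeAbelianGroup.of i := by
    simp [FreeAbelianGroup.basis, FreeAbelianGroup.equivFinsupp]
  rw [freeGroupAbBasis, Module.Basis.map_apply, h]
  rfl

/-- The natural action of `Aut(Fₙ)` on `Fₙ / Fₙ'` by `ℤ`-linear maps. -/
def autFreeGroupAbAction (n : ℕ) :
    MulAut (FreeGroup (Fin n)) →* Module.End ℤ (FreeGroupAb n) where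
  toFun φ := (MonoidHom.toAdditive (Abelianization.map φ.toMonoidHom)).toIntLinearMap
  map_one' := by
    ext x
    exact congrArg Additive.ofMul
      (DFunLike.congr_fun (Abelianization.map_id (G := FreeGroup (Fin n))) x.toMul)
  map_mul' φ ψ := by
    ext x
    exact congrArg Additive.ofMul
      (DFunLike.congr_fun
        (Abelianization.map_comp ψ.toMonoidHom φ.toMonoidHom) x.toMul).symm

/-- `ρ : Aut(Fₙ) → Aut(Fₙ / Fₙ') ≅ GLₙ(ℤ)`; the `j`-th column of `ρ φ` is the coordinate vector
of the class of `φ xⱼ`. -/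
noncomputable def rhoGL (n : ℕ) : MulAut (FreeGroup (Fin n)) →* GL (Fin n) ℤ :=
  MonoidHom.toHomUnits
    (((LinearMap.toMatrixAlgEquiv (freeGroupAbBasis n) :
        Module.End ℤ (FreeGroupAb n) ≃ₐ[ℤ] Matrix (Fin n) (Fin n) ℤ) :
        Module.End ℤ (FreeGroupAb n) →* Matrix (Fin n) (Fin n) ℤ).comp (autFreeGroupAbAction n))

theorem rhoGL_apply (n : ℕ) (φ : MulAut (FreeGroup (Fin n))) (i j : Fin n) :
    (rhoGL n φ : Matrix (Fin n) (Fin n) ℤ) i j =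
      (freeGroupAbBasis n).repr (toFreeGroupAb (φ (FreeGroup.of j))) i := by
  change LinearMap.toMatrixAlgEquiv (freeGroupAbBasis n) (autFreeGroupAbAction n φ) i j = _
  rw [LinearMap.toMatrixAlgEquiv_apply, freeGroupAbBasis_apply]
  rfl

/-- The special automorphism group `Aut⁺(Fₙ) = ρ⁻¹(SLₙ(ℤ))`. -/
noncomputable def specialAut (n : ℕ) : Subgroup (MulAut (FreeGroup (Fin n))) :=
  (Matrix.SpecialLinearGroup.toGL : Matrix.SpecialLinearGroup (Fin n) ℤ →* GL (Fin n) ℤ).range.comap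
    (rhoGL n)

/-- The standard congruence subgroup `Γ(G, π) = {φ ∈ Aut(Fₙ) | π φ = π}`. -/
def stdCongruence {n : ℕ} {G : Type*} [Group G] (π : FreeGroup (Fin n) →* G) :
    Subgroup (MulAut (FreeGroup (Fin n))) where
  carrier := {φ | π.comp φ.toMonoidHom = π}
  one_mem' := by
    ext
    rfl
  mul_mem' {φ ψ} hφ hψ := by
    refine MonoidHom.ext fun w => ?_
    exact (DFunLike.congr_fun hφ (ψ w)).trans (DFunLike.congr_fun hψ w)
  inv_mem' {φ} hφ := by
    refine MonoidHom.ext fun w => ?_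
    have h := DFunLike.congr_fun hφ (φ⁻¹ w)
    have h2 : φ (φ⁻¹ w) = w := MulAut.apply_inv_self _ φ w
    change π (φ (φ⁻¹ w)) = π (φ⁻¹ w) at h
    rw [h2] at h
    exact h.symm

/-- `Γ⁺(G, π) = Γ(G, π) ∩ Aut⁺(Fₙ)`. -/
noncomputable def stdCongruencePlus {n : ℕ} {G : Type*} [Group G] (π : FreeGroup (Fin n) →* G) :
    Subgroup (MulAut (FreeGroup (Fin n))) :=
  stdCongruence π ⊓ specialAut n

/-! Since G is abelian, every inner automorphism fixes π, and an automorphism of F₂ acting trivially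
on ℤ² is inner (`exists_conj_of_rhoGL_eq_one`). After a special change of basis that makes ker π
standard (`exists_normalizing_aut`), Γ⁺(G, π) is therefore an extension of the congruence group
`gammaPair m n` by Inn(F₂).

The abelianization of this extension is G × `gammaPair m n`ᵃᵇ (`abelianization_equiv_prod`), for two
reasons. First, π, viewed on inner automorphisms, extends to a homomorphism `retraction` from all of
Γ⁺(G, π) to G. It comes from mapping F₂ to a Heisenberg group: a special automorphism changes the
central coordinate by an even homomorphism F₂ → ℤ, and half of that change is a crossed homomorphism
on Aut⁺(F₂). Second, an inner automorphism given by an element of ker π is a product of commutators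
(`conjPlus_mem_commutator`), as transvections in Γ⁺(G, π) show.

That the kernel of ρ is Inn(F₂) rests on Nielsen's theorem, proved by folding labelled graphs of
rank two, and on the presentation S⁴ = 1, U³ = S² of SL₂(ℤ), proved by a positivity argument for
matrices: lifts of S and U satisfy these relations modulo Inn(F₂).

It remains to find the abelianization of Γ = `gammaPair m n`. A finitely generated abelian group
with cyclic torsion is recognised by its numbers of homomorphisms to ℤ/k (`addEquiv_of_card_hom`).
Homomorphisms on ±Γ are, up to gauge, cocycles of SL₂(ℤ) acting on Y = SL₂(ℤ)/±Γ, and by the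
presentation such a cocycle is a pair of functions on Y with prescribed sums along the orbits of S
and of U. When neither acts with a fixed point and -1 ∉ Γ, the count is k to the power |Y|/2 +
2|Y|/3 - (|Y| - 1) = 1 + |Y|/6, and 2|Y| is the index of Γ, which equals n times the number of
unimodular pairs modulo m. The small cases differ by one fixed point of S or U, by -1 ∈ Γ, or by
both, and this produces the extra torsion. -/

open Matrix MatrixGroups in
/-- An element of order six of `SL₂(ℤ)`. -/
def modU : SL(2, ℤ) := ModularGroup.S * ModularGroup.T

open Matrix MatrixGroups in
theorem modS_sq : ModularGroup.S ^ 2 = (-1 : SL(2, ℤ)) := by decide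

open Matrix MatrixGroups in
theorem modU_cube : modU ^ 3 = (-1 : SL(2, ℤ)) := by decide

open Matrix MatrixGroups in
theorem closure_modS_modU : Subgroup.closure {ModularGroup.S, modU} = (⊤ : Subgroup SL(2, ℤ)) := by
  rw [eq_top_iff, ← SpecialLinearGroup.SL2Z_generators, Subgroup.closure_le]
  have hS : ModularGroup.S ∈ Subgroup.closure {ModularGroup.S, modU} :=
    Subgroup.subset_closure (by simp)
  have hU : modU ∈ Subgroup.closure {ModularGroup.S, modU} :=
    Subgroup.subset_closure (by simp)
  have hT : ModularGroup.T = ModularGroup.S⁻¹ * modU := by simp [modU]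
  rintro x (rfl | rfl)
  · exact hS
  · rw [hT]; exact mul_mem (inv_mem hS) hU

/-! ### The presentation of SL₂(ℤ) by S and U. -/

section Presentation

variable {Q : Type*} [Group Q] {s u : Q}

/-- The product of letters `s⁻¹ u` and `s u⁻¹` prescribed by a word. -/
def modWord (s u : Q) : FreeMonoid Bool →* Q :=
  FreeMonoid.lift (fun b => cond b (s⁻¹ * u) (s * u⁻¹))

theorem modWord_true (s u : Q) : modWord s u (FreeMonoid.of true) = s⁻¹ * u := by simp [modWord]

theorem modWord_false (s u : Q) : modWord s u (FreeMonoid.of false) = s * u⁻¹ := by simp [modWord]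

theorem map_modWord {R : Type*} [Group R] (q : Q →* R) (s u : Q) (w : FreeMonoid Bool) :
    q (modWord s u w) = modWord (q s) (q u) w := by
  change (q.comp (modWord s u)) w = _
  congr 1
  ext b
  cases b <;> simp [modWord]

/-- Normal forms for the elements of a group generated by `s`, `u` with `s⁴ = 1` and `u³ = s²`. -/
theorem exists_modular_normal_form (h4 : s ^ 4 = 1) (h : u ^ 3 = s ^ 2) {g : Q}
    (hg : g ∈ Subgroup.closure {s, u}) :
    ∃ i : ℕ, ∃ w : FreeMonoid Bool, ∃ j : ℕ,
      g = s ^ i * modWord s u w * u ^ j := by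
  set W : FreeMonoid Bool →* Q := modWord s u with hW
  have hWt : W (FreeMonoid.of true) = s⁻¹ * u := modWord_true s u
  have hWf : W (FreeMonoid.of false) = s * u⁻¹ := modWord_false s u
  have cs : ∀ x : Q, x ∈ Subgroup.closure {s, u} → s ^ 2 * x = x * s ^ 2 := by
    intro x hx
    have : Subgroup.closure {s, u} ≤ Subgroup.centralizer {s ^ 2} := by
      rw [Subgroup.closure_le]
      rintro y (rfl | rfl)
      · simp [Subgroup.mem_centralizer_iff, ← pow_succ, ← pow_succ']
      · simp [Subgroup.mem_centralizer_iff, ← h, ← pow_succ, ← pow_succ']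
    exact (Subgroup.mem_centralizer_iff.1 (this hx)) _ rfl
  have hu6 : u ^ 6 = 1 := by
    rw [show 6 = 3 * 2 from rfl, pow_mul, h, ← pow_mul, h4]
  have hs : s⁻¹ = s ^ 3 := inv_eq_of_mul_eq_one_left (by rw [← pow_succ, h4])
  have hu : u⁻¹ = u ^ 5 := inv_eq_of_mul_eq_one_left (by rw [← pow_succ, hu6])
  let P : Q → Prop := fun g => ∃ i : ℕ, ∃ w : FreeMonoid Bool, ∃ j : ℕ, g = s ^ i * W w * u ^ j
  have Ps : ∀ g, P g → P (s * g) := by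
    rintro g ⟨i, w, j, rfl⟩
    exact ⟨i + 1, w, j, by simp only [pow_succ', mul_assoc]⟩
  have Pw : ∀ w j, P (W w * u ^ j) := fun w j => ⟨0, w, j, by simp⟩
  have Ps' : ∀ i g, P g → P (s ^ i * g) := by
    intro i g hg
    induction i with
    | zero => simpa using hg
    | succ i ih => rw [pow_succ', mul_assoc]; exact Ps _ ih
  have us : u * s ^ 2 = s ^ 2 * u := by rw [← h, ← pow_succ, ← pow_succ']
  -- Left multiplication by `u` is the only real work. As `s ^ 2` is central, the exponent of `s`
  -- can be lowered to 0 or 1 first.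
  have Pu : ∀ g, P g → P (u * g) := by
    have key0 : ∀ w j, P (u * (W w * u ^ j)) := by
      intro w j
      have : u * (W w * u ^ j) = s * (W (FreeMonoid.of true * w) * u ^ j) := by
        rw [map_mul, hWt]; group
      rw [this]; exact Ps _ (Pw _ _)
    have key1 : ∀ w j, P (u * (s * (W w * u ^ j))) := by
      intro w j
      induction w using FreeMonoid.casesOn with
      | one =>
        have : u * (s * (W 1 * u ^ j)) =
            s * (W (FreeMonoid.of true * FreeMonoid.of false) * u ^ (j + 1)) := by
          rw [map_mul, hWt, hWf, map_one, pow_succ']; group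
        rw [this]; exact Ps _ (Pw _ _)
      -- In front of `u s`, a letter `s u⁻¹` cancels to `s²`, while a letter `s⁻¹ u` gives `u² = s²
      -- u⁻¹`, that is, the other letter up to powers of `s`.
      | of_mul b w =>
        cases b
        · have : u * (s * (W (FreeMonoid.of false * w) * u ^ j)) = s ^ 2 * (W w * u ^ j) := by
            rw [map_mul, hWf]
            calc _ = (u * s ^ 2) * u⁻¹ * (W w * u ^ j) := by simp only [pow_two, mul_assoc]
              _ = _ := by rw [us]; group
          rw [this]; exact Ps' _ _ (Pw _ _)
        · have : u * (s * (W (FreeMonoid.of true * w) * u ^ j)) =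
              s ^ 2 * (s⁻¹ * (W (FreeMonoid.of false * w) * u ^ j)) := by
            rw [map_mul, hWt, map_mul, hWf]
            calc _ = u ^ 3 * u⁻¹ * (W w * u ^ j) := by simp [pow_succ, mul_assoc]
              _ = _ := by rw [h]; group
          rw [this, hs]; exact Ps' _ _ (Ps' _ _ (Pw _ _))
    have key2 : ∀ i w j, P (u * (s ^ i * (W w * u ^ j))) := by
      intro i
      induction i using Nat.strong_induction_on with
      | _ i ih =>
        intro w j
        rcases i with _ | _ | i
        · simpa using key0 w j
        · simpa using key1 w j
        · have : u * (s ^ (i + 2) * (W w * u ^ j)) = s ^ 2 * (u * (s ^ i * (W w * u ^ j))) := by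
            rw [add_comm, pow_add]
            calc _ = (u * s ^ 2) * (s ^ i * (W w * u ^ j)) := by group
              _ = _ := by rw [us]; group
          rw [this]; exact Ps' _ _ (ih i (by omega) w j)
    rintro g ⟨i, w, j, rfl⟩
    simpa only [mul_assoc] using key2 i w j
  have Pu' : ∀ i g, P g → P (u ^ i * g) := by
    intro i g hg
    induction i with
    | zero => simpa using hg
    | succ i ih => rw [pow_succ', mul_assoc]; exact Pu _ ih
  change P g
  induction hg using Subgroup.closure_induction_left with
  | one => exact ⟨0, 1, 0, by simp⟩
  | mul_left x hx y hy ih =>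
    rcases hx with rfl | rfl
    · exact Ps _ ih
    · exact Pu _ ih
  | inv_mul_cancel x hx y hy ih =>
    rcases hx with rfl | rfl
    · rw [hs]; exact Ps' _ _ ih
    · rw [hu]; exact Pu' _ _ ih

open Matrix MatrixGroups in
theorem sl2_mul_apply (A B : SL(2, ℤ)) (i j : Fin 2) :
    (A * B) i j = A i 0 * B 0 j + A i 1 * B 1 j := by
  rw [Matrix.SpecialLinearGroup.coe_mul, Matrix.mul_apply, Fin.sum_univ_two]

-- The two letters become the elementary matrices with a single off-diagonal 1, so products stay
-- non-negative and every letter raises the sum of the off-diagonal entries by at least one. This is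
-- what prevents long words from being torsion.
open Matrix MatrixGroups in
theorem positive_modWord (w : FreeMonoid Bool) :
    1 ≤ modWord ModularGroup.S modU w 0 0 ∧ 0 ≤ modWord ModularGroup.S modU w 0 1 ∧
    0 ≤ modWord ModularGroup.S modU w 1 0 ∧ 1 ≤ modWord ModularGroup.S modU w 1 1 ∧
    (w.length : ℤ) ≤ modWord ModularGroup.S modU w 0 1 + modWord ModularGroup.S modU w 1 0 := by
  have h1 : (ModularGroup.S⁻¹ * modU : SL(2, ℤ)) 0 0 = 1 ∧
      (ModularGroup.S⁻¹ * modU : SL(2, ℤ)) 0 1 = 1 ∧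
      (ModularGroup.S⁻¹ * modU : SL(2, ℤ)) 1 0 = 0 ∧
      (ModularGroup.S⁻¹ * modU : SL(2, ℤ)) 1 1 = 1 := by decide
  have h2 : (ModularGroup.S * modU⁻¹ : SL(2, ℤ)) 0 0 = 1 ∧
      (ModularGroup.S * modU⁻¹ : SL(2, ℤ)) 0 1 = 0 ∧
      (ModularGroup.S * modU⁻¹ : SL(2, ℤ)) 1 0 = 1 ∧
      (ModularGroup.S * modU⁻¹ : SL(2, ℤ)) 1 1 = 1 := by decide
  induction w using FreeMonoid.inductionOn' with
  | one => simp
  | of_mul b w ih =>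
    generalize hM : modWord ModularGroup.S modU w = M at ih
    obtain ⟨i1, i2, i3, i4, i5⟩ := ih
    cases b
    · obtain ⟨e1, e2, e3, e4⟩ := h2
      simp only [map_mul, modWord_false, hM, sl2_mul_apply _ M, e1, e2, e3, e4,
        FreeMonoid.length_mul, FreeMonoid.length_of, Nat.cast_add, Nat.cast_one]
      refine ⟨?_, ?_, ?_, ?_, ?_⟩ <;> linarith
    · obtain ⟨e1, e2, e3, e4⟩ := h1
      simp only [map_mul, modWord_true, hM, sl2_mul_apply _ M, e1, e2, e3, e4,
        FreeMonoid.length_mul, FreeMonoid.length_of, Nat.cast_add, Nat.cast_one]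
      refine ⟨?_, ?_, ?_, ?_, ?_⟩ <;> linarith

-- Together with `positive_modWord`, this finite check leaves only words of length at most one to be
-- examined in a relation.
open Matrix MatrixGroups in
theorem modular_torsion_bound : ∀ i : Fin 4, ∀ j : Fin 6,
    let N : SL(2, ℤ) := (ModularGroup.S ^ (i : ℕ))⁻¹ * (modU ^ (j : ℕ))⁻¹
    1 ≤ N 0 0 → 0 ≤ N 0 1 → 0 ≤ N 1 0 → 1 ≤ N 1 1 → N 0 1 + N 1 0 ≤ 1 := by
  decide

open Matrix MatrixGroups in
theorem modular_relation_cases : ∀ i : Fin 4, ∀ j : Fin 6,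
    ((ModularGroup.S ^ (i : ℕ) * modU ^ (j : ℕ) : SL(2, ℤ)) = 1 →
      (i, j) = (0, 0) ∨ (i, j) = (2, 3)) ∧
    ((ModularGroup.S ^ (i : ℕ) * (ModularGroup.S⁻¹ * modU) * modU ^ (j : ℕ) : SL(2, ℤ)) = 1 →
      (i, j) = (1, 5) ∨ (i, j) = (3, 2)) ∧
    ((ModularGroup.S ^ (i : ℕ) * (ModularGroup.S * modU⁻¹) * modU ^ (j : ℕ) : SL(2, ℤ)) = 1 →
      (i, j) = (3, 1) ∨ (i, j) = (1, 4)) := by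
  decide

open Matrix MatrixGroups in
/-- A homomorphism to `SL₂(ℤ)` is injective on a subgroup generated by lifts of the standard
generators which satisfy the standard relations. -/
theorem eq_one_of_modular_relations (q : Q →* SL(2, ℤ)) (h4 : s ^ 4 = 1) (h : u ^ 3 = s ^ 2)
    (hs : q s = ModularGroup.S) (hu : q u = modU) {g : Q} (hg : g ∈ Subgroup.closure {s, u})
    (hq : q g = 1) : g = 1 := by
  have hu6 : u ^ 6 = 1 := by
    rw [show 6 = 3 * 2 from rfl, pow_mul, h, ← pow_mul, h4]
  obtain ⟨i, w, j, rfl⟩ := exists_modular_normal_form h4 h hg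
  have hmod : s ^ i = s ^ (i % 4) := by
    conv_lhs => rw [← Nat.div_add_mod i 4, pow_add, pow_mul, h4, one_pow, one_mul]
  have hmod' : u ^ j = u ^ (j % 6) := by
    conv_lhs => rw [← Nat.div_add_mod j 6, pow_add, pow_mul, hu6, one_pow, one_mul]
  rw [hmod, hmod'] at hq ⊢
  obtain ⟨i, hi⟩ : ∃ a : Fin 4, (a : ℕ) = i % 4 := ⟨⟨i % 4, Nat.mod_lt _ (by norm_num)⟩, rfl⟩
  obtain ⟨j, hj⟩ : ∃ a : Fin 6, (a : ℕ) = j % 6 := ⟨⟨j % 6, Nat.mod_lt _ (by norm_num)⟩, rfl⟩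
  rw [← hi, ← hj] at hq ⊢
  rw [map_mul, map_mul, map_pow, map_pow, map_modWord, hs, hu] at hq
  have hM : modWord ModularGroup.S modU w =
      (ModularGroup.S ^ (i : ℕ))⁻¹ * (modU ^ (j : ℕ))⁻¹ := by
    rw [eq_inv_mul_iff_mul_eq, eq_inv_iff_mul_eq_one, hq]
  obtain ⟨b1, b2, b3, b4, b5⟩ := positive_modWord w
  -- The off-diagonal sum of the word is at least its length, and at most 1 because the word equals
  -- one of finitely many products of powers of S and U.
  have hlen : w.length ≤ 1 := by
    have := modular_torsion_bound i j
    simp only [← hM] at this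
    exact_mod_cast b5.trans (this b1 b2 b3 b4)
  obtain ⟨c1, c2, c3⟩ := modular_relation_cases i j
  rcases Nat.le_one_iff_eq_zero_or_eq_one.1 hlen with h0 | h0
  · obtain rfl := FreeMonoid.length_eq_zero.1 h0
    rw [map_one, mul_one] at hq ⊢
    rcases c1 hq with e | e <;> (obtain ⟨rfl, rfl⟩ := Prod.mk.inj e)
    · simp
    · change s ^ 2 * u ^ 3 = 1
      rw [h, ← pow_add, h4]
  · obtain ⟨b, rfl⟩ := FreeMonoid.length_eq_one.1 h0
    cases b
    · rw [modWord_false] at hq ⊢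
      rcases c3 hq with e | e <;> (obtain ⟨rfl, rfl⟩ := Prod.mk.inj e)
      · change s ^ 3 * (s * u⁻¹) * u ^ 1 = 1
        rw [← mul_assoc, ← pow_succ, h4]; simp
      · change s ^ 1 * (s * u⁻¹) * u ^ 4 = 1
        calc s ^ 1 * (s * u⁻¹) * u ^ 4 = s ^ 2 * u ^ 3 := by simp [pow_succ, mul_assoc]
          _ = 1 := by rw [h, ← pow_add, h4]
    · rw [modWord_true] at hq ⊢
      rcases c2 hq with e | e <;> (obtain ⟨rfl, rfl⟩ := Prod.mk.inj e)
      · change s ^ 1 * (s⁻¹ * u) * u ^ 5 = 1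
        calc s ^ 1 * (s⁻¹ * u) * u ^ 5 = u ^ 6 := by simp [pow_succ, mul_assoc]
          _ = 1 := hu6
      · change s ^ 3 * (s⁻¹ * u) * u ^ 2 = 1
        calc s ^ 3 * (s⁻¹ * u) * u ^ 2 = s ^ 2 * u ^ 3 := by simp [pow_succ, mul_assoc]
          _ = 1 := by rw [h, ← pow_add, h4]

open Matrix MatrixGroups in
/-- `SL₂(ℤ)` is presented by the generators `S`, `U` and the relations `S⁴ = 1`, `U³ = S²`. -/
theorem exists_modular_lift (h4 : s ^ 4 = 1) (h : u ^ 3 = s ^ 2) :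
    ∃ f : SL(2, ℤ) →* Q, f ModularGroup.S = s ∧ f modU = u := by
  -- `K` is to be the graph of the homomorphism. Its first projection is onto because S and U
  -- generate, and injective by the normal form argument applied inside the product.
  let K : Subgroup (SL(2, ℤ) × Q) := Subgroup.closure {(ModularGroup.S, s), (modU, u)}
  let pr : K →* SL(2, ℤ) := (MonoidHom.fst _ _).comp K.subtype
  have h4' : ((ModularGroup.S, s) : SL(2, ℤ) × Q) ^ 4 = 1 := by
    refine Prod.ext ?_ h4
    change ModularGroup.S ^ 4 = (1 : SL(2, ℤ))
    decide
  have h' : ((modU, u) : SL(2, ℤ) × Q) ^ 3 = (ModularGroup.S, s) ^ 2 := by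
    refine Prod.ext ?_ h
    exact modU_cube.trans modS_sq.symm
  have inj : Function.Injective pr := by
    rw [injective_iff_map_eq_one]
    rintro ⟨g, hg⟩ h1
    exact Subtype.ext (eq_one_of_modular_relations (MonoidHom.fst _ _) h4' h' rfl rfl hg h1)
  have mS : (ModularGroup.S, s) ∈ K := Subgroup.subset_closure (by simp)
  have mU : (modU, u) ∈ K := Subgroup.subset_closure (by simp)
  have surj : Function.Surjective pr := by
    rw [← MonoidHom.range_eq_top, eq_top_iff, ← closure_modS_modU, Subgroup.closure_le]
    rintro x (rfl | rfl)
    · exact ⟨⟨_, mS⟩, rfl⟩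
    · exact ⟨⟨_, mU⟩, rfl⟩
  let e : K ≃* SL(2, ℤ) := MulEquiv.ofBijective pr ⟨inj, surj⟩
  refine ⟨((MonoidHom.snd _ _).comp K.subtype).comp e.symm.toMonoidHom, ?_, ?_⟩
  · have : e.symm ModularGroup.S = ⟨_, mS⟩ := e.symm_apply_eq.2 rfl
    change (e.symm ModularGroup.S : SL(2, ℤ) × Q).2 = s
    rw [this]
  · have : e.symm modU = ⟨_, mU⟩ := e.symm_apply_eq.2 rfl
    change (e.symm modU : SL(2, ℤ) × Q).2 = u
    rw [this]

end Presentation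

/-! ### Graphs labelled by free group elements, and immersions to the rose. -/

section LabelledGraph

variable {A : Type*}

namespace FreeGroup

variable [DecidableEq A]

/-- The first letter of the reduced word of `g`. -/
def firstLetter (g : FreeGroup A) : Option (A × Bool) := g.toWord.head?

theorem norm_inv_letter_mul {g : FreeGroup A} {l : A × Bool} (h : g.firstLetter = some l) :
    ((mk [l])⁻¹ * g).norm + 1 = g.norm := by
  obtain ⟨m, hm⟩ : ∃ m, g.toWord = l :: m := by
    unfold firstLetter at h
    cases hg : g.toWord with
    | nil => simp [hg] at h
    | cons a m => simp [hg] at h; exact ⟨m, by rw [h]⟩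
  have hred : IsReduced m := by
    have := isReduced_toWord (x := g)
    rw [hm] at this
    exact this.infix ⟨[l], [], by simp⟩
  have hg : g = mk [l] * mk m := by
    rw [mul_mk, List.singleton_append, ← hm, mk_toWord]
  have : (mk [l])⁻¹ * g = mk m := by rw [hg, inv_mul_cancel_left]
  rw [this, norm, norm, toWord_mk, hred.reduce_eq, hm, List.length_cons]

theorem toWord_inv_letter_mul {g : FreeGroup A} {l : A × Bool} {m : List (A × Bool)}
    (h : g.toWord = l :: m) : ((mk [l])⁻¹ * g).toWord = m := by
  have hred : IsReduced m := by
    have := isReduced_toWord (x := g)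
    rw [h] at this
    exact this.infix ⟨[l], [], by simp⟩
  have hg : g = mk [l] * mk m := by
    rw [mul_mk, List.singleton_append, ← h, mk_toWord]
  have : (mk [l])⁻¹ * g = mk m := by rw [hg, inv_mul_cancel_left]
  rw [this, toWord_mk, hred.reduce_eq]

theorem norm_letter (l : A × Bool) : (mk [l]).norm = 1 := by
  rw [norm, toWord_mk, reduce_singleton, List.length_singleton]

theorem firstLetter_inv (g : FreeGroup A) :
    g⁻¹.firstLetter = g.toWord.getLast?.map fun l => (l.1, !l.2) := by
  rw [firstLetter, toWord_inv, invRev, List.head?_reverse, List.getLast?_map]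

theorem firstLetter_ne_none {g : FreeGroup A} (h : g ≠ 1) : g.firstLetter ≠ none := by
  rw [firstLetter, Ne, List.head?_eq_none_iff, toWord_eq_nil_iff]
  exact h

/-- The word starts with `l` and ends with its inverse. These are different positions, since a
single letter is not its own inverse, so conjugation removes two letters. -/
theorem norm_conj_letter {g : FreeGroup A} {l : A × Bool} (h : g.firstLetter = some l)
    (h' : g⁻¹.firstLetter = some l) : ((mk [l])⁻¹ * g * mk [l]).norm + 2 = g.norm := by
  obtain ⟨m, hm⟩ : ∃ m, g.toWord = l :: m := by
    unfold firstLetter at h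
    cases hg : g.toWord with
    | nil => simp [hg] at h
    | cons a m => simp [hg] at h; exact ⟨m, by rw [h]⟩
  have h1 := norm_inv_letter_mul h
  have h2 : (((mk [l])⁻¹ * g)⁻¹).firstLetter = some l := by
    rw [firstLetter_inv] at h' ⊢
    rw [toWord_inv_letter_mul hm]
    rw [hm] at h'
    cases m with
    | nil => simp [Prod.ext_iff] at h'
    | cons a m => rwa [List.getLast?_cons_cons] at h'
  have h3 := norm_inv_letter_mul h2
  have : (mk [l])⁻¹ * ((mk [l])⁻¹ * g)⁻¹ = ((mk [l])⁻¹ * g * mk [l])⁻¹ := by group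
  rw [this, norm_inv_eq, norm_inv_eq] at h3
  omega

end FreeGroup

open FreeGroup

variable {V I : Type*} (s t : I → V) (w : I → FreeGroup A)

/-- The source of an oriented edge. -/
def edgeSrc (e : I × Bool) : V := cond e.2 (s e.1) (t e.1)

/-- The label of an oriented edge. -/
def edgeLabel (e : I × Bool) : FreeGroup A := cond e.2 (w e.1) (w e.1)⁻¹

/-- The inverse of an oriented edge. -/
def edgeInv (e : I × Bool) : I × Bool := (e.1, !e.2)


theorem edgeInv_edgeInv (e : I × Bool) : edgeInv (edgeInv e) = e := by simp [edgeInv]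

theorem edgeLabel_edgeInv (e : I × Bool) : edgeLabel w (edgeInv e) = (edgeLabel w e)⁻¹ := by
  rcases e with ⟨i, _ | _⟩ <;> simp [edgeLabel, edgeInv]

/-- `l` is an edge path from `a` to `b`. -/
def IsEdgePath : V → List (I × Bool) → V → Prop
  | a, [], b => a = b
  | a, e :: l, b => edgeSrc s t e = a ∧ IsEdgePath (edgeSrc s t (edgeInv e)) l b

theorem IsEdgePath.append {a b c : V} {l l' : List (I × Bool)} (h : IsEdgePath s t a l b)
    (h' : IsEdgePath s t b l' c) : IsEdgePath s t a (l ++ l') c := by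
  induction l generalizing a with
  | nil => cases h; exact h'
  | cons e l ih => exact ⟨h.1, ih h.2⟩

theorem IsEdgePath.reverse {a b : V} {l : List (I × Bool)} (h : IsEdgePath s t a l b) :
    IsEdgePath s t b (l.map edgeInv).reverse a := by
  induction l generalizing a with
  | nil => cases h; rfl
  | cons e l ih =>
    rw [List.map_cons, List.reverse_cons]
    exact (ih h.2).append s t ⟨rfl, by rw [edgeInv_edgeInv]; exact h.1⟩

/-- The product of the labels along an edge path. -/
def pathLabel (l : List (I × Bool)) : FreeGroup A := (l.map (edgeLabel w)).prod

theorem pathLabel_cons (e : I × Bool) (l : List (I × Bool)) :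
    pathLabel w (e :: l) = edgeLabel w e * pathLabel w l := by simp [pathLabel]

theorem pathLabel_reverse (l : List (I × Bool)) :
    pathLabel w (l.map edgeInv).reverse = (pathLabel w l)⁻¹ := by
  induction l with
  | nil => simp [pathLabel]
  | cons e l ih =>
    rw [pathLabel_cons, mul_inv_rev, ← ih, ← edgeLabel_edgeInv]
    simp [pathLabel]

/-- An edge path without backtracking. -/
def IsReducedPath (l : List (I × Bool)) : Prop := l.IsChain fun e f => f ≠ edgeInv e

/-- An edge followed by its inverse contributes trivially to the label and can be deleted. -/
theorem exists_reducedPath {a b : V} {l : List (I × Bool)} (h : IsEdgePath s t a l b) :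
    ∃ l', IsEdgePath s t a l' b ∧ IsReducedPath l' ∧ pathLabel w l' = pathLabel w l := by
  induction l generalizing a with
  | nil => exact ⟨[], h, List.isChain_nil, rfl⟩
  | cons e l ih =>
    obtain ⟨l', h1, h2, h3⟩ := ih h.2
    rw [pathLabel_cons, ← h3]
    cases l' with
    | nil => exact ⟨[e], ⟨h.1, h1⟩, List.isChain_singleton _, by simp [pathLabel]⟩
    | cons f l' =>
      by_cases hf : f = edgeInv e
      · subst hf
        refine ⟨l', ?_, h2.tail, ?_⟩
        · have := h1.2
          rwa [edgeInv_edgeInv, h.1] at this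
        · rw [pathLabel_cons, edgeLabel_edgeInv, mul_inv_cancel_left]
      · exact ⟨e :: f :: l', ⟨h.1, h1⟩, List.isChain_cons_cons.2 ⟨hf, h2⟩, pathLabel_cons w _ _⟩

variable [DecidableEq A]

/-- The map from a labelled graph to the rose is locally injective. -/
structure IsImmersed : Prop where
  ne_one : ∀ i, w i ≠ 1
  turn : ∀ e f : I × Bool, e ≠ f → edgeSrc s t e = edgeSrc s t f →
    (edgeLabel w e).firstLetter ≠ (edgeLabel w f).firstLetter

variable {s t w}

theorem IsImmersed.edgeLabel_ne_one (h : IsImmersed s t w) (e : I × Bool) :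
    edgeLabel w e ≠ 1 := by
  rcases e with ⟨i, _ | _⟩
  · simpa [edgeLabel] using h.ne_one i
  · simpa [edgeLabel] using h.ne_one i

/-- No letters cancel where an edge `e` is followed by `f`: both `f` and the inverse of `e` leave
the same vertex and are distinct, so by immersion their first letters differ. -/
theorem IsImmersed.toWord_pathLabel (h : IsImmersed s t w) {a b : V} {l : List (I × Bool)}
    (hp : IsEdgePath s t a l b) (hr : IsReducedPath l) :
    (pathLabel w l).toWord = (l.map fun e => (edgeLabel w e).toWord).flatten := by
  induction l generalizing a with
  | nil => simp [pathLabel]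
  | cons e l ih =>
    have ih' := ih hp.2 hr.tail
    rw [pathLabel_cons, toWord_mul, ih', List.map_cons, List.flatten_cons]
    refine IsReduced.reduce_eq ?_
    refine List.isChain_append.2 ⟨isReduced_toWord, ih' ▸ isReduced_toWord, ?_⟩
    intro x hx y hy hxy
    cases l with
    | nil => simp at hy
    | cons f l =>
      have hne := (List.isChain_cons_cons.1 hr).1
      have hturn := h.turn f (edgeInv e) hne hp.2.1
      have hf : (edgeLabel w f).toWord ≠ [] := by
        rw [Ne, toWord_eq_nil_iff]; exact h.edgeLabel_ne_one f
      have hfy : (edgeLabel w f).firstLetter = some y := by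
        rw [List.map_cons, List.flatten_cons, List.head?_append_of_ne_nil _ hf] at hy
        exact hy
      rw [edgeLabel_edgeInv, firstLetter_inv, hfy, Option.mem_def.1 hx] at hturn
      by_contra hcon
      refine hturn (congrArg some (Prod.ext hxy.symm ?_))
      change y.2 = !x.2
      cases h1 : x.2 <;> cases h2 : y.2 <;> simp_all

theorem IsImmersed.length_le_norm (h : IsImmersed s t w) {a b : V} {l : List (I × Bool)}
    (hp : IsEdgePath s t a l b) (hr : IsReducedPath l) : l.length ≤ (pathLabel w l).norm := by
  rw [FreeGroup.norm, h.toWord_pathLabel hp hr]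
  clear hp hr
  induction l with
  | nil => simp
  | cons e l ih =>
    have hf : (edgeLabel w e).toWord ≠ [] := by
      rw [Ne, toWord_eq_nil_iff]; exact h.edgeLabel_ne_one e
    have := List.length_pos_iff.2 hf
    rw [List.map_cons, List.flatten_cons, List.length_append, List.length_cons]
    omega

/-- A letter in the subgroup carried by an immersed graph is the label of a loop. -/
theorem IsImmersed.exists_loop (h : IsImmersed s t w) (a : V) {K : Set (FreeGroup A)}
    (hK : ∀ g ∈ K, ∃ l, IsEdgePath s t a l a ∧ pathLabel w l = g) {g : FreeGroup A}
    (hg : g ∈ Subgroup.closure K) (h1 : g.norm = 1) :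
    ∃ e, edgeSrc s t e = a ∧ edgeSrc s t (edgeInv e) = a ∧ edgeLabel w e = g := by
  have key : ∃ l, IsEdgePath s t a l a ∧ pathLabel w l = g := by
    clear h1
    induction hg using Subgroup.closure_induction with
    | mem x hx => exact hK x hx
    | one => exact ⟨[], rfl, rfl⟩
    | mul x y _ _ hx hy =>
      obtain ⟨l, hl, rfl⟩ := hx
      obtain ⟨l', hl', rfl⟩ := hy
      exact ⟨l ++ l', hl.append s t hl', by simp [pathLabel]⟩
    | inv x _ hx =>
      obtain ⟨l, hl, rfl⟩ := hx
      exact ⟨_, hl.reverse s t, pathLabel_reverse w l⟩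
  obtain ⟨l, hl, rfl⟩ := key
  obtain ⟨l', hl', hr, e⟩ := exists_reducedPath s t w hl
  rw [← e] at h1 ⊢
  -- Each edge of a reduced path contributes at least one letter, so a label of length one comes
  -- from a single edge.
  have hlen := h.length_le_norm hl' hr
  rw [h1] at hlen
  rcases l' with _ | ⟨f, _ | ⟨f', l'⟩⟩
  · simp [pathLabel] at h1
  · exact ⟨f, hl'.1, hl'.2, by simp [pathLabel]⟩
  · simp at hlen

end LabelledGraph

/-! ### Nielsen's theorem in rank two, by folding roses, theta graphs and barbells. -/

section Nielsen

open FreeGroup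

local notation "F₂" => FreeGroup (Fin 2)

/-- The pairs obtained from the standard basis of `F₂` by elementary Nielsen transformations and
conjugations. -/
inductive NielsenPair : F₂ → F₂ → Prop
  | base : NielsenPair (of 0) (of 1)
  | swap {u v : F₂} : NielsenPair u v → NielsenPair v u
  | inv {u v : F₂} : NielsenPair u v → NielsenPair u⁻¹ v
  | mul {u v : F₂} : NielsenPair u v → NielsenPair (u * v) v
  | conj (g : F₂) {u v : F₂} : NielsenPair u v → NielsenPair (g * u * g⁻¹) (g * v * g⁻¹)

/-- If `u` and `v` generate `F₂`, then they form a Nielsen pair. -/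
def ReducesToBasis (u v : F₂) : Prop := Subgroup.closure {u, v} = ⊤ → NielsenPair u v

theorem closure_pair_eq_top {u v u' v' : F₂} (h : Subgroup.closure {u, v} = ⊤)
    (hu : u ∈ Subgroup.closure {u', v'}) (hv : v ∈ Subgroup.closure {u', v'}) :
    Subgroup.closure {u', v'} = ⊤ := by
  rw [eq_top_iff, ← h, Subgroup.closure_le]
  rintro x (rfl | rfl)
  · exact hu
  · exact hv

theorem left_mem_closure_pair (u v : F₂) : u ∈ Subgroup.closure {u, v} :=
  Subgroup.subset_closure (by simp)

theorem right_mem_closure_pair (u v : F₂) : v ∈ Subgroup.closure {u, v} :=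
  Subgroup.subset_closure (by simp)

theorem ReducesToBasis.swap {u v : F₂} (h : ReducesToBasis v u) : ReducesToBasis u v :=
  fun hc => (h (by rwa [Set.pair_comm])).swap

theorem ReducesToBasis.inv {u v : F₂} (h : ReducesToBasis u⁻¹ v) : ReducesToBasis u v := by
  intro hc
  have := (h (closure_pair_eq_top hc (inv_mem_iff.1 (left_mem_closure_pair _ _))
    (right_mem_closure_pair _ _))).inv
  rwa [inv_inv] at this

theorem ReducesToBasis.mul {u v : F₂} (h : ReducesToBasis (u * v) v) : ReducesToBasis u v := by
  intro hc
  have hc' : Subgroup.closure {u * v, v} = ⊤ := by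
    refine closure_pair_eq_top hc ?_ (right_mem_closure_pair _ _)
    simpa using mul_mem (left_mem_closure_pair (u * v) v)
      (inv_mem (right_mem_closure_pair (u * v) v))
  have := (h hc').swap.inv.swap.mul
  rw [mul_inv_cancel_right] at this
  simpa using this.swap.inv.swap

theorem ReducesToBasis.conj (g : F₂) {u v : F₂}
    (h : ReducesToBasis (g * u * g⁻¹) (g * v * g⁻¹)) : ReducesToBasis u v := by
  intro hc
  have hc' : Subgroup.closure {g * u * g⁻¹, g * v * g⁻¹} = ⊤ := by
    have h1 := MonoidHom.map_closure (MulAut.conj g).toMonoidHom {u, v}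
    rw [hc, Subgroup.map_top_of_surjective _ (MulAut.conj g).surjective, Set.image_pair] at h1
    exact h1.symm
  have := (h hc').conj g⁻¹
  simpa [mul_assoc] using this

theorem ReducesToBasis.inv_right {u v : F₂} (h : ReducesToBasis u v⁻¹) : ReducesToBasis u v :=
  h.swap.inv.swap

theorem of_zero_ne_of_one_inv : (of 0 : F₂) ≠ (of 1)⁻¹ := by
  intro h
  have := congrArg toWord h
  simp [toWord_inv, invRev] at this

theorem of_zero_ne_of_one : (of 0 : F₂) ≠ of 1 := by
  intro h
  simpa using of_injective h

/-- F₂ is not abelian, hence not cyclic. -/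
theorem closure_one_pair_ne_top (v : F₂) : Subgroup.closure {1, v} ≠ ⊤ := by
  intro h
  have h' : Subgroup.zpowers v = ⊤ := by
    rw [eq_top_iff, ← h, Subgroup.closure_le]
    rintro x (rfl | rfl)
    · exact one_mem _
    · exact Subgroup.mem_zpowers _
  obtain ⟨i, hi⟩ := Subgroup.mem_zpowers_iff.1 (h' ▸ Subgroup.mem_top (of 0 : F₂))
  obtain ⟨j, hj⟩ := Subgroup.mem_zpowers_iff.1 (h' ▸ Subgroup.mem_top (of 1 : F₂))
  have : (of 0 * of 1 : F₂) = of 1 * of 0 := by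
    rw [← hi, ← hj, ← zpow_add, ← zpow_add, add_comm]
  have := congrArg toWord this
  simp [toWord_mul, reduce.cons] at this

theorem norm_letter_inv_mul_le (l : Fin 2 × Bool) (g : F₂) :
    ((mk [l])⁻¹ * g).norm ≤ g.norm + 1 := by
  have := norm_mul_le (mk [l])⁻¹ g
  rw [norm_inv_eq, norm_letter] at this
  omega

/-- The reduction hypotheses below total length `N`, for pairs carried by theta graphs and
barbells. -/
structure ReducesBelow (N : ℕ) : Prop where
  theta : ∀ α β γ : F₂, α.norm + β.norm + γ.norm < N → ReducesToBasis (α * γ⁻¹) (β * γ⁻¹)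
  barbell : ∀ α g β : F₂, α.norm + g.norm + β.norm < N → ReducesToBasis α (g * β * g⁻¹)

section Rose

variable {N : ℕ} (H : ReducesBelow N)
include H

/-- Folding the common initial letter of two petals yields a theta graph whose third edge is that
letter; two letters are lost and one is gained. -/
theorem reduces_of_common_letter {α β : F₂} (hN : α.norm + β.norm ≤ N) {l : Fin 2 × Bool}
    (hα : α.firstLetter = some l) (hβ : β.firstLetter = some l) : ReducesToBasis α β := by
  have h1 := norm_inv_letter_mul hα
  have h2 := norm_inv_letter_mul hβ
  have h3 : ((mk [l])⁻¹).norm = 1 := by rw [norm_inv_eq, norm_letter]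
  have := H.theta ((mk [l])⁻¹ * α) ((mk [l])⁻¹ * β) ((mk [l])⁻¹) (by omega)
  exact ReducesToBasis.conj (mk [l])⁻¹ this

/-- Folding the two ends of one petal yields a barbell with the folded letter as its bridge; again
the total length drops by one. -/
theorem reduces_of_conj_letter {α β : F₂} (hN : α.norm + β.norm ≤ N) {l : Fin 2 × Bool}
    (hα : α.firstLetter = some l) (hα' : α⁻¹.firstLetter = some l) : ReducesToBasis α β := by
  have h1 := norm_conj_letter hα hα'
  have h2 := norm_letter l
  have := H.barbell β (mk [l]) ((mk [l])⁻¹ * α * mk [l]) (by omega)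
  refine ReducesToBasis.swap ?_
  have e : mk [l] * ((mk [l])⁻¹ * α * mk [l]) * (mk [l])⁻¹ = α := by group
  rwa [e] at this

/-- In an immersed rose carrying all of F₂, both free generators are petal labels up to inversion,
so the pair is the standard basis up to order and signs. Otherwise two of the four directions at the
vertex share a letter and can be folded. -/
theorem reduces_rose (α β : F₂) (hN : α.norm + β.norm ≤ N) : ReducesToBasis α β := by
  intro hc
  have hα : α ≠ 1 := by rintro rfl; exact closure_one_pair_ne_top _ hc
  have hβ : β ≠ 1 := by
    rintro rfl; rw [Set.pair_comm] at hc; exact closure_one_pair_ne_top _ hc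
  let w : Bool → F₂ := fun b => cond b α β
  by_cases him : IsImmersed (fun _ : Bool => ()) (fun _ => ()) w
  · have hK : ∀ g ∈ ({α, β} : Set F₂), ∃ l,
        IsEdgePath (fun _ : Bool => ()) (fun _ => ()) () l () ∧ pathLabel w l = g := by
      rintro g (rfl | rfl)
      · exact ⟨[(true, true)], ⟨rfl, rfl⟩, by simp [pathLabel, edgeLabel, w]⟩
      · exact ⟨[(false, true)], ⟨rfl, rfl⟩, by simp [pathLabel, edgeLabel, w]⟩
    have h0 := him.exists_loop () hK (hc ▸ Subgroup.mem_top (of 0)) (norm_of 0)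
    have h1 := him.exists_loop () hK (hc ▸ Subgroup.mem_top (of 1)) (norm_of 1)
    obtain ⟨⟨i, b⟩, -, -, h0⟩ := h0
    obtain ⟨⟨j, c⟩, -, -, h1⟩ := h1
    have hne := of_zero_ne_of_one
    have hne' := of_zero_ne_of_one_inv
    have B := NielsenPair.base
    have B1 := B.inv
    have B2 := B.swap.inv.swap
    have B3 := B2.inv
    cases i <;> cases j <;> cases b <;> cases c <;>
      simp only [edgeLabel, w, cond_true, cond_false] at h0 h1 <;>
      rw [← h0, ← h1] at hne hne' B B1 B2 B3 <;> try simp only [inv_inv] at hne hne' B B1 B2 B3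
    all_goals
      first
      | exact absurd rfl hne
      | exact absurd rfl hne'
      | assumption
      | exact B.swap
      | exact B1.swap
      | exact B2.swap
      | exact B3.swap
  · have : ∃ e f : Bool × Bool, e ≠ f ∧
        (edgeLabel w e).firstLetter = (edgeLabel w f).firstLetter := by
      by_contra! hcon
      exact him ⟨by rintro (_ | _) <;> assumption, fun e f hef _ => hcon e f hef⟩
    obtain ⟨⟨i, b⟩, ⟨j, c⟩, hef, hl⟩ := this
    have hα' : α⁻¹ ≠ 1 := inv_ne_one.2 hα
    have hβ' : β⁻¹ ≠ 1 := inv_ne_one.2 hβ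
    obtain ⟨a, ha⟩ := Option.ne_none_iff_exists'.1 (firstLetter_ne_none hα)
    obtain ⟨a', ha'⟩ := Option.ne_none_iff_exists'.1 (firstLetter_ne_none hα')
    obtain ⟨d, hb⟩ := Option.ne_none_iff_exists'.1 (firstLetter_ne_none hβ)
    obtain ⟨d', hb'⟩ := Option.ne_none_iff_exists'.1 (firstLetter_ne_none hβ')
    have nα : α⁻¹.norm = α.norm := norm_inv_eq
    have nβ : β⁻¹.norm = β.norm := norm_inv_eq
    have c1 : a = d → ReducesToBasis α β := by
      rintro rfl; exact reduces_of_common_letter H hN ha hb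
    have c2 : a = d' → ReducesToBasis α β := by
      rintro rfl; exact (reduces_of_common_letter H (by omega) ha hb').inv_right
    have c3 : a' = d → ReducesToBasis α β := by
      rintro rfl; exact (reduces_of_common_letter H (by omega) ha' hb).inv
    have c4 : a' = d' → ReducesToBasis α β := by
      rintro rfl; exact (reduces_of_common_letter H (by omega) ha' hb').inv_right.inv
    have c5 : a = a' → ReducesToBasis α β := by
      rintro rfl; exact reduces_of_conj_letter H hN ha ha'
    have c6 : d = d' → ReducesToBasis α β := by
      rintro rfl; exact (reduces_of_conj_letter H (by omega) hb hb').swap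
    refine (?_ : ReducesToBasis α β) hc
    clear hc
    cases i <;> cases j <;> cases b <;> cases c <;>
      simp only [edgeLabel, w, cond_true, cond_false, ha, ha', hb, hb', Option.some.injEq] at hl <;>
      first
      | exact absurd rfl hef
      | exact c1 hl
      | exact c1 hl.symm
      | exact c2 hl
      | exact c2 hl.symm
      | exact c3 hl
      | exact c3 hl.symm
      | exact c4 hl
      | exact c4 hl.symm
      | exact c5 hl
      | exact c5 hl.symm
      | exact c6 hl
      | exact c6 hl.symm

end Rose

theorem ReducesToBasis.theta_swap {α β γ : F₂} (h : ReducesToBasis (β * γ⁻¹) (α * γ⁻¹)) :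
    ReducesToBasis (α * γ⁻¹) (β * γ⁻¹) := h.swap

/-- This exchanges the edge of the theta graph chosen as maximal tree, making all three edges
interchangeable. -/
theorem ReducesToBasis.theta_rotate {α β γ : F₂} (h : ReducesToBasis (α * β⁻¹) (γ * β⁻¹)) :
    ReducesToBasis (α * γ⁻¹) (β * γ⁻¹) := by
  refine ReducesToBasis.inv_right (ReducesToBasis.mul ?_)
  simpa [mul_assoc] using h

/-- Conjugation by `γ⁻¹` moves the base point to the other vertex of the theta graph. -/
theorem ReducesToBasis.theta_inv {α β γ : F₂}
    (h : ReducesToBasis (α⁻¹ * γ⁻¹⁻¹) (β⁻¹ * γ⁻¹⁻¹)) :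
    ReducesToBasis (α * γ⁻¹) (β * γ⁻¹) := by
  refine ReducesToBasis.inv (ReducesToBasis.inv_right (ReducesToBasis.conj γ⁻¹ ?_))
  simpa [mul_assoc] using h

section Theta

variable {N : ℕ} (H : ReducesBelow N)
include H

/-- The base vertex is slid along the common letter: two edges get shorter, and the third grows by
at most one letter. -/
theorem reduces_theta_of_common_letter {α β γ : F₂} (hN : α.norm + β.norm + γ.norm ≤ N)
    {l : Fin 2 × Bool} (hα : α.firstLetter = some l) (hβ : β.firstLetter = some l) :
    ReducesToBasis (α * γ⁻¹) (β * γ⁻¹) := by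
  have h1 := norm_inv_letter_mul hα
  have h2 := norm_inv_letter_mul hβ
  have h3 := norm_letter_inv_mul_le l γ
  have := H.theta ((mk [l])⁻¹ * α) ((mk [l])⁻¹ * β) ((mk [l])⁻¹ * γ) (by omega)
  refine ReducesToBasis.conj (mk [l])⁻¹ ?_
  simpa only [mul_inv_rev, mul_assoc] using this

theorem reduces_theta_of_firstLetter_eq {α β γ : F₂} (hN : α.norm + β.norm + γ.norm ≤ N)
    (hα : α ≠ 1) (h : α.firstLetter = β.firstLetter) :
    ReducesToBasis (α * γ⁻¹) (β * γ⁻¹) := by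
  obtain ⟨l, hl⟩ := Option.ne_none_iff_exists'.1 (firstLetter_ne_none hα)
  exact reduces_theta_of_common_letter H hN hl (h ▸ hl)

/-- A trivial edge collapses the theta graph to a rose. An immersed theta graph has no loop edge, so
it cannot carry a free generator; hence some fold is possible. -/
theorem reduces_theta (α β γ : F₂) (hN : α.norm + β.norm + γ.norm ≤ N) :
    ReducesToBasis (α * γ⁻¹) (β * γ⁻¹) := by
  by_cases hγ : γ = 1
  · subst hγ
    rw [inv_one, mul_one, mul_one]
    exact reduces_rose H _ _ (by simpa using hN)
  by_cases hβ : β = 1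
  · subst hβ
    refine ReducesToBasis.theta_rotate ?_
    rw [inv_one, mul_one, mul_one]
    exact reduces_rose H _ _ (by simpa using hN)
  by_cases hα : α = 1
  · subst hα
    refine (ReducesToBasis.theta_rotate ?_).theta_swap
    rw [inv_one, mul_one, mul_one]
    exact reduces_rose H _ _ (by simpa using hN)
  intro hc
  let w : Fin 3 → F₂ := ![α, β, γ]
  by_cases him : IsImmersed (fun _ : Fin 3 => true) (fun _ => false) w
  · have hK : ∀ g ∈ ({α * γ⁻¹, β * γ⁻¹} : Set F₂), ∃ l,
        IsEdgePath (fun _ : Fin 3 => true) (fun _ => false) true l true ∧ pathLabel w l = g := by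
      rintro g (rfl | rfl)
      · exact ⟨[(0, true), (2, false)], ⟨rfl, rfl, rfl⟩, by simp [pathLabel, edgeLabel, w]⟩
      · exact ⟨[(1, true), (2, false)], ⟨rfl, rfl, rfl⟩, by simp [pathLabel, edgeLabel, w]⟩
    obtain ⟨⟨i, b⟩, h1, h2, -⟩ :=
      him.exists_loop true hK (hc ▸ Subgroup.mem_top (of 0)) (norm_of 0)
    cases b <;> simp [edgeSrc, edgeInv] at h1 h2
  · have : ∃ i j : Fin 3, ∃ b : Bool, i ≠ j ∧
        (edgeLabel w (i, b)).firstLetter = (edgeLabel w (j, b)).firstLetter := by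
      by_contra! hcon
      refine him ⟨fun i => by fin_cases i <;> assumption, ?_⟩
      rintro ⟨i, b⟩ ⟨j, c⟩ hef hs
      have hbc : b = c := by cases b <;> cases c <;> simp [edgeSrc] at hs ⊢
      subst hbc
      exact hcon i j b fun hij => hef (by rw [hij])
    obtain ⟨i, j, b, hij, hl⟩ := this
    refine (?_ : ReducesToBasis _ _) hc
    clear hc him
    wlog hb : b = true generalizing α β γ b
    · refine ReducesToBasis.theta_inv ?_
      refine this α⁻¹ β⁻¹ γ⁻¹ (by simpa only [norm_inv_eq] using hN) (inv_ne_one.2 hγ)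
        (inv_ne_one.2 hβ) (inv_ne_one.2 hα) true ?_ rfl
      obtain rfl : b = false := by simpa using hb
      revert hl
      fin_cases i <;> fin_cases j <;> simp [edgeLabel, w]
    subst hb
    have c1 : α.firstLetter = β.firstLetter → ReducesToBasis (α * γ⁻¹) (β * γ⁻¹) :=
      reduces_theta_of_firstLetter_eq H hN hα
    have c2 : α.firstLetter = γ.firstLetter → ReducesToBasis (α * γ⁻¹) (β * γ⁻¹) := fun h =>
      (reduces_theta_of_firstLetter_eq H (by omega) hα h).theta_rotate
    have c3 : β.firstLetter = γ.firstLetter → ReducesToBasis (α * γ⁻¹) (β * γ⁻¹) := fun h =>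
      (reduces_theta_of_firstLetter_eq H (by omega) hβ h).theta_rotate.theta_swap
    fin_cases i <;> fin_cases j <;> simp [edgeLabel, w] at hl hij <;>
      first
      | exact c1 hl
      | exact c1 hl.symm
      | exact c2 hl
      | exact c2 hl.symm
      | exact c3 hl
      | exact c3 hl.symm

end Theta

section Barbell

variable {N : ℕ} (H : ReducesBelow N)
include H

theorem reduces_barbell_of_conj_letter {α g β : F₂} (hN : α.norm + g.norm + β.norm ≤ N)
    {l : Fin 2 × Bool} (hα : α.firstLetter = some l) (hα' : α⁻¹.firstLetter = some l) :
    ReducesToBasis α (g * β * g⁻¹) := by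
  have h1 := norm_conj_letter hα hα'
  have h2 := norm_letter_inv_mul_le l g
  have := H.barbell ((mk [l])⁻¹ * α * mk [l]) ((mk [l])⁻¹ * g) β (by omega)
  refine ReducesToBasis.conj (mk [l])⁻¹ ?_
  simpa only [mul_inv_rev, mul_assoc, inv_inv] using this

/-- Sliding the base along the letter shortens the bridge by one, while the loop loses a letter in
front and gains at most one at the end. -/
theorem reduces_barbell_of_common_letter {α g β : F₂} (hN : α.norm + g.norm + β.norm ≤ N)
    {l : Fin 2 × Bool} (hα : α.firstLetter = some l) (hg : g.firstLetter = some l) :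
    ReducesToBasis α (g * β * g⁻¹) := by
  have h1 := norm_inv_letter_mul hα
  have h2 := norm_inv_letter_mul hg
  have h3 := norm_mul_le ((mk [l])⁻¹ * α) (mk [l])
  rw [norm_letter] at h3
  have := H.barbell ((mk [l])⁻¹ * α * mk [l]) ((mk [l])⁻¹ * g) β (by omega)
  refine ReducesToBasis.conj (mk [l])⁻¹ ?_
  simpa only [mul_inv_rev, mul_assoc, inv_inv] using this

theorem reduces_barbell_of_turn {α g β : F₂} (hN : α.norm + g.norm + β.norm ≤ N) (hα : α ≠ 1)
    (h : α.firstLetter = α⁻¹.firstLetter ∨ α.firstLetter = g.firstLetter ∨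
      α⁻¹.firstLetter = g.firstLetter) : ReducesToBasis α (g * β * g⁻¹) := by
  obtain ⟨l, hl⟩ := Option.ne_none_iff_exists'.1 (firstLetter_ne_none hα)
  obtain ⟨l', hl'⟩ := Option.ne_none_iff_exists'.1 (firstLetter_ne_none (inv_ne_one.2 hα))
  rcases h with h | h | h
  · exact reduces_barbell_of_conj_letter H hN hl (h ▸ hl)
  · exact reduces_barbell_of_common_letter H hN hl (h ▸ hl)
  · exact (reduces_barbell_of_common_letter H (by rwa [norm_inv_eq]) hl' (h ▸ hl')).inv

/-- An immersed barbell has only one loop at its base vertex, so it can carry at most one of the two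
free generators; hence it folds at one of its ends. -/
theorem reduces_barbell (α g β : F₂) (hN : α.norm + g.norm + β.norm ≤ N) :
    ReducesToBasis α (g * β * g⁻¹) := by
  by_cases hg : g = 1
  · subst hg
    rw [inv_one, mul_one, one_mul]
    exact reduces_rose H _ _ (by simpa using hN)
  intro hc
  have hα : α ≠ 1 := by rintro rfl; exact closure_one_pair_ne_top _ hc
  have hβ : β ≠ 1 := by
    rintro rfl
    rw [Set.pair_comm, mul_one, mul_inv_cancel] at hc
    exact closure_one_pair_ne_top _ hc
  let w : Fin 3 → F₂ := ![α, g, β]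
  by_cases him : IsImmersed ![true, true, false] ![true, false, false] w
  · have hK : ∀ x ∈ ({α, g * β * g⁻¹} : Set F₂), ∃ l,
        IsEdgePath ![true, true, false] ![true, false, false] true l true ∧
          pathLabel w l = x := by
      rintro x (rfl | rfl)
      · exact ⟨[(0, true)], ⟨rfl, rfl⟩, by simp [pathLabel, edgeLabel, w]⟩
      · exact ⟨[(1, true), (2, true), (1, false)], ⟨rfl, rfl, rfl, rfl⟩,
          by simp [pathLabel, edgeLabel, w, mul_assoc]⟩
    have key : ∀ x : F₂, x.norm = 1 → x = α ∨ x = α⁻¹ := by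
      intro x hx
      obtain ⟨⟨i, b⟩, h1, h2, h3⟩ := him.exists_loop true hK (hc ▸ Subgroup.mem_top x) hx
      fin_cases i <;> cases b <;> simp [edgeSrc, edgeInv, edgeLabel, w] at h1 h2 h3 <;>
        simp [h3]
    have hne := of_zero_ne_of_one
    have hne' := of_zero_ne_of_one_inv
    rcases key _ (norm_of 0) with h0 | h0 <;> rcases key _ (norm_of 1) with h1 | h1 <;>
      rw [h0, h1] at hne hne' <;> simp at hne hne'
  · have : ∃ e f : Fin 3 × Bool, e ≠ f ∧ edgeSrc ![true, true, false] ![true, false, false] e =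
        edgeSrc ![true, true, false] ![true, false, false] f ∧
        (edgeLabel w e).firstLetter = (edgeLabel w f).firstLetter := by
      by_contra! hcon
      exact him ⟨fun i => by fin_cases i <;> assumption, hcon⟩
    obtain ⟨⟨i, b⟩, ⟨j, c⟩, hef, hs, hl⟩ := this
    -- Folds at the far vertex are treated by reading the barbell from the other end.
    have hN' : β.norm + g⁻¹.norm + α.norm ≤ N := by rw [norm_inv_eq]; omega
    have c1 : (α.firstLetter = α⁻¹.firstLetter ∨ α.firstLetter = g.firstLetter ∨
        α⁻¹.firstLetter = g.firstLetter) → ReducesToBasis α (g * β * g⁻¹) :=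
      reduces_barbell_of_turn H hN hα
    have c2 : (β.firstLetter = β⁻¹.firstLetter ∨ β.firstLetter = g⁻¹.firstLetter ∨
        β⁻¹.firstLetter = g⁻¹.firstLetter) → ReducesToBasis α (g * β * g⁻¹) := by
      intro h
      have := reduces_barbell_of_turn H hN' hβ h
      refine (ReducesToBasis.conj g⁻¹ ?_).swap
      simpa [mul_assoc] using this
    refine (?_ : ReducesToBasis _ _) hc
    clear hc him
    fin_cases i <;> fin_cases j <;> cases b <;> cases c <;>
      simp [edgeLabel, edgeSrc, w] at hl hef hs <;> simp [hl] at c1 c2 <;> assumption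

end Barbell

theorem reducesBelow (N : ℕ) : ReducesBelow N := by
  induction N with
  | zero => exact ⟨fun _ _ _ h => absurd h (by omega), fun _ _ _ h => absurd h (by omega)⟩
  | succ N ih =>
    exact ⟨fun α β γ h => reduces_theta ih α β γ (by omega),
      fun α g β h => reduces_barbell ih α g β (by omega)⟩

/-- **Nielsen's theorem** for the free group of rank two. -/
theorem nielsenPair_of_closure_eq_top {u v : F₂} (h : Subgroup.closure {u, v} = ⊤) :
    NielsenPair u v :=
  reduces_rose (reducesBelow _) u v le_rfl h

end Nielsen

/-! ### The kernel of Aut(F₂) → GL₂(ℤ). -/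

section InnerKernel

open FreeGroup (of lift)
open MatrixGroups

local notation "F₂" => FreeGroup (Fin 2)

/-- The exponent sum of the `i`-th generator. -/
noncomputable def expSum (i : Fin 2) (g : F₂) : ℤ := (freeGroupAbBasis 2).repr (toFreeGroupAb g) i

theorem expSum_mul (i : Fin 2) (g h : F₂) : expSum i (g * h) = expSum i g + expSum i h := by
  have : toFreeGroupAb (g * h) = toFreeGroupAb g + toFreeGroupAb h := by
    simp [toFreeGroupAb]
  simp [expSum, this]

theorem expSum_one (i : Fin 2) : expSum i 1 = 0 := by
  have := expSum_mul i 1 1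
  rw [mul_one] at this
  omega

theorem expSum_inv (i : Fin 2) (g : F₂) : expSum i g⁻¹ = -expSum i g := by
  have := expSum_mul i g g⁻¹
  rw [mul_inv_cancel, expSum_one] at this
  omega

theorem expSum_of (i j : Fin 2) : expSum i (of j) = if i = j then 1 else 0 := by
  rw [expSum, ← freeGroupAbBasis_apply, Module.Basis.repr_self, Finsupp.single_apply]
  simp only [eq_comm]

theorem expSum_map (φ : MulAut F₂) (i : Fin 2) (g : F₂) :
    expSum i (φ g) = (rhoGL 2 φ : Matrix (Fin 2) (Fin 2) ℤ) i 0 * expSum 0 g +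
      (rhoGL 2 φ : Matrix (Fin 2) (Fin 2) ℤ) i 1 * expSum 1 g := by
  rw [rhoGL_apply, rhoGL_apply]
  change _ = expSum i (φ (of 0)) * _ + expSum i (φ (of 1)) * _
  induction g using FreeGroup.induction_on with
  | C1 => simp [expSum_one]
  | of j => fin_cases j <;> simp [expSum_of]
  | inv_of j ih => rw [map_inv, expSum_inv, ih, expSum_inv, expSum_inv]; ring
  | mul g h hg hh => rw [map_mul, expSum_mul, hg, hh, expSum_mul, expSum_mul]; ring

theorem rhoGL_eq_of_expSum {φ : MulAut F₂} {M : Matrix (Fin 2) (Fin 2) ℤ}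
    (h0 : ∀ i, expSum i (φ (of 0)) = M i 0) (h1 : ∀ i, expSum i (φ (of 1)) = M i 1) :
    (rhoGL 2 φ : Matrix (Fin 2) (Fin 2) ℤ) = M := by
  ext i j
  rw [rhoGL_apply]
  fin_cases j
  · exact h0 i
  · exact h1 i

theorem rhoGL_conj (g : F₂) : (rhoGL 2 (MulAut.conj g) : Matrix (Fin 2) (Fin 2) ℤ) = 1 := by
  refine rhoGL_eq_of_expSum ?_ ?_ <;> intro i <;>
    rw [MulAut.conj_apply, expSum_mul, expSum_mul, expSum_inv, expSum_of, Matrix.one_apply] <;> ring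

theorem mulAut_freeGroup_ext {φ ψ : MulAut F₂} (h0 : φ (of 0) = ψ (of 0))
    (h1 : φ (of 1) = ψ (of 1)) : φ = ψ := by
  have : φ.toMonoidHom = ψ.toMonoidHom := by
    ext i
    fin_cases i
    · exact h0
    · exact h1
  ext g
  exact DFunLike.congr_fun this g

/-- The automorphism of `F₂` with the given images of the generators and the given images of the
generators under the inverse. -/
def autOfPair (u v u' v' : F₂) (h : ∀ i, lift ![u', v'] (![u, v] i) = of i)
    (h' : ∀ i, lift ![u, v] (![u', v'] i) = of i) : MulAut F₂ :=
  MonoidHom.toMulEquiv (lift ![u, v]) (lift ![u', v'])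
    (by ext i; simpa using h i) (by ext i; simpa using h' i)

theorem autOfPair_apply (u v u' v' : F₂) (h : ∀ i, lift ![u', v'] (![u, v] i) = of i)
    (h' : ∀ i, lift ![u, v] (![u', v'] i) = of i) (i : Fin 2) :
    autOfPair u v u' v' h h' (of i) = ![u, v] i := FreeGroup.lift_apply_of

theorem autOfPair_symm_apply (u v u' v' : F₂) (h : ∀ i, lift ![u', v'] (![u, v] i) = of i)
    (h' : ∀ i, lift ![u, v] (![u', v'] i) = of i) (i : Fin 2) :
    (autOfPair u v u' v' h h')⁻¹ (of i) = ![u', v'] i := FreeGroup.lift_apply_of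

/-- A lift of `S` to `F₂`. -/
def autS : MulAut F₂ := autOfPair (of 1) (of 0)⁻¹ (of 1)⁻¹ (of 0)
  (by intro i; fin_cases i <;> simp) (by intro i; fin_cases i <;> simp)

/-- A lift of `T` to `F₂`. -/
def autT : MulAut F₂ := autOfPair (of 0) (of 0 * of 1) (of 0) ((of 0)⁻¹ * of 1)
  (by intro i; fin_cases i <;> simp) (by intro i; fin_cases i <;> simp)

/-- The automorphism inverting the first generator. -/
def autInv : MulAut F₂ := autOfPair (of 0)⁻¹ (of 1) (of 0)⁻¹ (of 1)
  (by intro i; fin_cases i <;> simp) (by intro i; fin_cases i <;> simp)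

theorem autS_zero : autS (of 0) = of 1 := autOfPair_apply _ _ _ _ _ _ 0
theorem autS_one : autS (of 1) = (of 0)⁻¹ := autOfPair_apply _ _ _ _ _ _ 1
theorem autS_symm_zero : autS⁻¹ (of 0) = (of 1)⁻¹ := autOfPair_symm_apply _ _ _ _ _ _ 0
theorem autS_symm_one : autS⁻¹ (of 1) = of 0 := autOfPair_symm_apply _ _ _ _ _ _ 1
theorem autT_zero : autT (of 0) = of 0 := autOfPair_apply _ _ _ _ _ _ 0
theorem autT_one : autT (of 1) = of 0 * of 1 := autOfPair_apply _ _ _ _ _ _ 1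
theorem autT_symm_zero : autT⁻¹ (of 0) = of 0 := autOfPair_symm_apply _ _ _ _ _ _ 0
theorem autT_symm_one : autT⁻¹ (of 1) = (of 0)⁻¹ * of 1 := autOfPair_symm_apply _ _ _ _ _ _ 1
theorem autInv_zero : autInv (of 0) = (of 0)⁻¹ := autOfPair_apply _ _ _ _ _ _ 0
theorem autInv_one : autInv (of 1) = of 1 := autOfPair_apply _ _ _ _ _ _ 1

theorem autInv_mul_self : autInv * autInv = 1 := by
  apply mulAut_freeGroup_ext <;> simp [autInv_zero, autInv_one]

theorem rhoGL_autS : (rhoGL 2 autS : Matrix (Fin 2) (Fin 2) ℤ) = ModularGroup.S := by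
  apply rhoGL_eq_of_expSum <;> intro i <;> fin_cases i <;>
    simp [autS_zero, autS_one, expSum_inv, expSum_of, ModularGroup.S]

theorem rhoGL_autT : (rhoGL 2 autT : Matrix (Fin 2) (Fin 2) ℤ) = ModularGroup.T := by
  apply rhoGL_eq_of_expSum <;> intro i <;> fin_cases i <;>
    simp [autT_zero, autT_one, expSum_mul, expSum_of, ModularGroup.T]

theorem det_rhoGL_autInv : (rhoGL 2 autInv : Matrix (Fin 2) (Fin 2) ℤ).det = -1 := by
  have : (rhoGL 2 autInv : Matrix (Fin 2) (Fin 2) ℤ) = !![-1, 0; 0, 1] := by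
    apply rhoGL_eq_of_expSum <;> intro i <;> fin_cases i <;>
      simp [autInv_zero, autInv_one, expSum_inv, expSum_of]
  rw [this]
  simp

/-- The subgroup of inner automorphisms of `F₂`. -/
abbrev innerAut : Subgroup (MulAut F₂) := (MulAut.conj : F₂ →* MulAut F₂).range

theorem mul_conj_mul_inv (φ : MulAut F₂) (g : F₂) :
    φ * MulAut.conj g * φ⁻¹ = MulAut.conj (φ g) := by
  ext x
  simp [MulAut.conj_apply]

instance innerAut_normal : innerAut.Normal := by
  constructor
  rintro _ ⟨g, rfl⟩ φ
  exact ⟨φ g, (mul_conj_mul_inv φ g).symm⟩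

theorem mk_conj_eq_one (g : F₂) :
    (QuotientGroup.mk (MulAut.conj g) : MulAut F₂ ⧸ innerAut) = 1 :=
  (QuotientGroup.eq_one_iff _).2 (MonoidHom.mem_range.2 ⟨g, rfl⟩)

theorem autS_pow_four : autS ^ 4 = 1 := by
  apply mulAut_freeGroup_ext <;> simp [pow_succ, autS_zero, autS_one]

/-- The relation U³ = S² lifts to Aut(F₂) only up to an inner automorphism, so the presentation is
used modulo `innerAut`. -/
theorem autS_mul_autT_cube :
    (autS * autT) ^ 3 = MulAut.conj (of 1 * (of 0)⁻¹) * autS ^ 2 := by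
  apply mulAut_freeGroup_ext <;>
    simp [pow_succ, autS_zero, autS_one, autT_zero, autT_one, mul_assoc]

/-- The subgroup generated by the lifts of `S` and `T` and the inner automorphisms. -/
def elementarySpecialAut : Subgroup (MulAut F₂) :=
  Subgroup.closure ({autS, autT} ∪ Set.range (MulAut.conj : F₂ →* MulAut F₂))

theorem autS_mem : autS ∈ elementarySpecialAut := Subgroup.subset_closure (by simp)

theorem autT_mem : autT ∈ elementarySpecialAut := Subgroup.subset_closure (by simp)

theorem conj_mem (g : F₂) : MulAut.conj g ∈ elementarySpecialAut :=
  Subgroup.subset_closure (Or.inr ⟨g, rfl⟩)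

theorem autInv_conj_mem {d : MulAut F₂} (hd : d ∈ elementarySpecialAut) :
    autInv * d * autInv ∈ elementarySpecialAut := by
  have hinv : autInv⁻¹ = autInv := inv_eq_of_mul_eq_one_left autInv_mul_self
  induction hd using Subgroup.closure_induction with
  | mem x hx =>
    rcases hx with (rfl | rfl) | ⟨g, rfl⟩
    · have : autInv * autS * autInv = autS⁻¹ := by
        apply mulAut_freeGroup_ext <;>
          simp only [MulAut.mul_apply, map_inv, autInv_zero, autInv_one, autS_zero, autS_one,
            autS_symm_zero, autS_symm_one, inv_inv]
      rw [this]; exact inv_mem autS_mem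
    · have : autInv * autT * autInv = autT⁻¹ := by
        apply mulAut_freeGroup_ext <;>
          simp only [MulAut.mul_apply, map_inv, map_mul, autInv_zero, autInv_one, autT_zero,
            autT_one, autT_symm_zero, autT_symm_one, inv_inv]
      rw [this]; exact inv_mem autT_mem
    · have := mul_conj_mul_inv autInv g
      rw [hinv] at this
      rw [this]; exact conj_mem _
  | one => rw [mul_one, autInv_mul_self]; exact one_mem _
  | mul x y _ _ hx hy =>
    have : autInv * (x * y) * autInv = (autInv * x * autInv) * (autInv * y * autInv) := by
      calc _ = autInv * x * 1 * y * autInv := by group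
        _ = _ := by rw [← autInv_mul_self]; group
    rw [this]; exact mul_mem hx hy
  | inv x _ hx =>
    have : autInv * x⁻¹ * autInv = (autInv * x * autInv)⁻¹ := by
      rw [mul_inv_rev, mul_inv_rev, hinv, mul_assoc]
    rw [this]; exact inv_mem hx

/-- An elementary Nielsen move is precomposition by an explicit automorphism, and a conjugation is
postcomposition by an inner one. Membership in one of the two cosets persists because `autInv` is an
involution normalizing `elementarySpecialAut`. -/
theorem NielsenPair.exists_aut {u v : F₂} (h : NielsenPair u v) :
    ∃ φ : MulAut F₂, φ (of 0) = u ∧ φ (of 1) = v ∧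
      (φ ∈ elementarySpecialAut ∨ φ * autInv ∈ elementarySpecialAut) := by
  have mulR : ∀ φ d, d ∈ elementarySpecialAut →
      (φ ∈ elementarySpecialAut ∨ φ * autInv ∈ elementarySpecialAut) →
      (φ * d ∈ elementarySpecialAut ∨ φ * d * autInv ∈ elementarySpecialAut) := by
    rintro φ d hd (h | h)
    · exact Or.inl (mul_mem h hd)
    · right
      have : φ * d * autInv = (φ * autInv) * (autInv * d * autInv) := by
        calc _ = φ * 1 * d * autInv := by group
          _ = _ := by rw [← autInv_mul_self]; group
      rw [this]; exact mul_mem h (autInv_conj_mem hd)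
  have mulI : ∀ φ, (φ ∈ elementarySpecialAut ∨ φ * autInv ∈ elementarySpecialAut) →
      (φ * autInv ∈ elementarySpecialAut ∨ φ * autInv * autInv ∈ elementarySpecialAut) := by
    rintro φ (h | h)
    · right; rwa [mul_assoc, autInv_mul_self, mul_one]
    · exact Or.inl h
  induction h with
  | base => exact ⟨1, rfl, rfl, Or.inl (one_mem _)⟩
  | swap _ ih =>
    obtain ⟨φ, rfl, rfl, h⟩ := ih
    refine ⟨φ * autInv * autS, ?_, ?_, mulR _ _ autS_mem (mulI _ h)⟩
    · simp only [MulAut.mul_apply, autS_zero, autInv_one]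
    · simp only [MulAut.mul_apply, autS_one, map_inv, autInv_zero, inv_inv]
  | inv _ ih =>
    obtain ⟨φ, rfl, rfl, h⟩ := ih
    refine ⟨φ * autInv, ?_, ?_, mulI _ h⟩
    · simp only [MulAut.mul_apply, autInv_zero, map_inv]
    · simp only [MulAut.mul_apply, autInv_one]
  | mul _ ih =>
    obtain ⟨φ, rfl, rfl, h⟩ := ih
    refine ⟨φ * (autS * autT⁻¹ * autS⁻¹), ?_, ?_,
      mulR _ _ (mul_mem (mul_mem autS_mem (inv_mem autT_mem)) (inv_mem autS_mem)) h⟩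
    · simp only [MulAut.mul_apply, autS_symm_zero, map_inv, autT_symm_one, map_mul, autS_zero,
        autS_one, mul_inv_rev, inv_inv]
    · simp only [MulAut.mul_apply, autS_symm_one, autT_symm_zero, autS_zero]
  | conj g _ ih =>
    obtain ⟨φ, rfl, rfl, h⟩ := ih
    refine ⟨MulAut.conj g * φ, rfl, rfl, ?_⟩
    rcases h with h | h
    · exact Or.inl (mul_mem (conj_mem g) h)
    · right; rw [mul_assoc]; exact mul_mem (conj_mem g) h

theorem mem_elementarySpecialAut_or (φ : MulAut F₂) :
    φ ∈ elementarySpecialAut ∨ φ * autInv ∈ elementarySpecialAut := by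
  have hc : Subgroup.closure {φ (of 0), φ (of 1)} = ⊤ := by
    have h1 := MonoidHom.map_closure φ.toMonoidHom (Set.range (of : Fin 2 → F₂))
    rw [FreeGroup.closure_range_of, Subgroup.map_top_of_surjective _ φ.surjective] at h1
    rw [h1]
    congr 1
    ext x
    simp [eq_comm]
  obtain ⟨ψ, h0, h1, h⟩ := (nielsenPair_of_closure_eq_top hc).exists_aut
  rwa [mulAut_freeGroup_ext h0 h1] at h

/-- The outer class of an element of `elementarySpecialAut` is a function of its matrix. The
presentation supplies the map, and the identity only needs checking on generators. -/
theorem exists_modular_section : ∃ θ : SL(2, ℤ) →* MulAut F₂ ⧸ innerAut,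
    ∀ d ∈ elementarySpecialAut, ∃ A : SL(2, ℤ),
      (rhoGL 2 d : Matrix (Fin 2) (Fin 2) ℤ) = A ∧ θ A = QuotientGroup.mk d := by
  obtain ⟨θ, hS, hU⟩ := exists_modular_lift (s := (QuotientGroup.mk autS : MulAut F₂ ⧸ innerAut))
    (u := QuotientGroup.mk (autS * autT))
    (by rw [← QuotientGroup.mk_pow, autS_pow_four, QuotientGroup.mk_one])
    (by
      rw [← QuotientGroup.mk_pow, ← QuotientGroup.mk_pow, autS_mul_autT_cube, QuotientGroup.mk_mul,
        mk_conj_eq_one, one_mul])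
  refine ⟨θ, fun d hd => ?_⟩
  have hT : θ ModularGroup.T = QuotientGroup.mk autT := by
    have : θ modU = θ ModularGroup.S * θ ModularGroup.T := by rw [modU, map_mul]
    rw [hU, hS, QuotientGroup.mk_mul] at this
    exact (mul_left_cancel this).symm
  induction hd using Subgroup.closure_induction with
  | mem x hx =>
    rcases hx with (rfl | rfl) | ⟨g, rfl⟩
    · exact ⟨_, rhoGL_autS, hS⟩
    · exact ⟨_, rhoGL_autT, hT⟩
    · exact ⟨1, rhoGL_conj g, by rw [map_one, mk_conj_eq_one]⟩
  | one => exact ⟨1, by simp, by simp⟩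
  | mul x y _ _ hx hy =>
    obtain ⟨A, h1, h2⟩ := hx
    obtain ⟨B, h3, h4⟩ := hy
    exact ⟨A * B, by simp [h1, h3], by simp [h2, h4]⟩
  | inv x _ hx =>
    obtain ⟨A, h1, h2⟩ := hx
    refine ⟨A⁻¹, ?_, by simp [h2]⟩
    have : rhoGL 2 x = Matrix.SpecialLinearGroup.toGL A := Units.ext h1
    rw [map_inv, this, ← map_inv]
    rfl

/-- An automorphism of `F₂` acting trivially on the abelianization is inner. -/
theorem exists_conj_of_rhoGL_eq_one {φ : MulAut F₂}
    (h : (rhoGL 2 φ : Matrix (Fin 2) (Fin 2) ℤ) = 1) : ∃ g, MulAut.conj g = φ := by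
  obtain ⟨θ, hθ⟩ := exists_modular_section
  rcases mem_elementarySpecialAut_or φ with hφ | hφ
  · obtain ⟨A, h1, h2⟩ := hθ φ hφ
    obtain rfl : A = 1 := Subtype.ext (h1.symm.trans h)
    rw [map_one] at h2
    exact (QuotientGroup.eq_one_iff _).1 h2.symm
  -- The other coset is excluded by its determinant -1.
  · obtain ⟨A, h1, h2⟩ := hθ _ hφ
    have := congrArg Matrix.det h1
    rw [A.det_coe, map_mul, Units.val_mul, h, one_mul, det_rhoGL_autInv] at this
    norm_num at this

theorem mem_specialAut_iff {φ : MulAut F₂} :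
    φ ∈ specialAut 2 ↔ (rhoGL 2 φ : Matrix (Fin 2) (Fin 2) ℤ).det = 1 := by
  constructor
  · rintro ⟨A, hA⟩
    rw [← hA]
    exact A.det_coe
  · intro h
    exact ⟨⟨_, h⟩, Units.ext rfl⟩

/-- Every element of `SL₂(ℤ)` is induced by an automorphism of `F₂`. -/
theorem exists_rhoGL_eq (A : SL(2, ℤ)) :
    ∃ φ : MulAut F₂, (rhoGL 2 φ : Matrix (Fin 2) (Fin 2) ℤ) = A := by
  have hA : A ∈ Subgroup.closure {ModularGroup.S, ModularGroup.T} := by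
    rw [SpecialLinearGroup.SL2Z_generators]; trivial
  have key : ∃ φ : MulAut F₂, rhoGL 2 φ = Matrix.SpecialLinearGroup.toGL A := by
    induction hA using Subgroup.closure_induction with
    | mem x hx =>
      rcases hx with rfl | rfl
      · exact ⟨autS, Units.ext rhoGL_autS⟩
      · exact ⟨autT, Units.ext rhoGL_autT⟩
    | one => exact ⟨1, by simp⟩
    | mul x y _ _ hx hy =>
      obtain ⟨φ, hφ⟩ := hx
      obtain ⟨ψ, hψ⟩ := hy
      exact ⟨φ * ψ, by simp [hφ, hψ]⟩
    | inv x _ hx =>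
      obtain ⟨φ, hφ⟩ := hx
      exact ⟨φ⁻¹, by simp [hφ]⟩
  obtain ⟨φ, hφ⟩ := key
  exact ⟨φ, by rw [hφ]; rfl⟩

end InnerKernel

/-! ### A criterion for the abelianization of an extension to split. -/

section Abstract

/-- The abelianization of an extension which splits after passing to a quotient of the kernel. -/
theorem abelianization_equiv_prod {E K G Γ : Type*} [Group E] [Group K] [CommGroup G] [Group Γ]
    (f : E →* G) (q : E →* Γ) (i : K →* E) (hq : Function.Surjective q)
    (hfi : Function.Surjective (f.comp i)) (hqi : ∀ k, q (i k) = 1)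
    (hker : ∀ e, q e = 1 → ∃ k, i k = e) (hcomm : ∀ k, f (i k) = 1 → i k ∈ commutator E) :
    Nonempty (Abelianization E ≃* G × Abelianization Γ) := by
  let F : E →* G × Abelianization Γ := f.prod (Abelianization.of.comp q)
  have hF : Function.Surjective F := by
    rintro ⟨g, c⟩
    obtain ⟨γ, rfl⟩ := QuotientGroup.mk_surjective c
    obtain ⟨e, rfl⟩ := hq γ
    obtain ⟨k, hk⟩ := hfi (g * (f e)⁻¹)
    refine ⟨i k * e, Prod.ext ?_ ?_⟩
    · change f (i k * e) = g
      rw [map_mul, show f (i k) = _ from hk, inv_mul_cancel_right]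
    · change Abelianization.of (q (i k * e)) = Abelianization.of (q e)
      rw [map_mul, hqi, one_mul]
  have hFker : F.ker = commutator E := by
    refine le_antisymm ?_ (Abelianization.commutator_subset_ker F)
    intro e he
    have h1 : f e = 1 := congrArg Prod.fst (MonoidHom.mem_ker.1 he)
    have h2 : Abelianization.of (q e) = 1 := congrArg Prod.snd (MonoidHom.mem_ker.1 he)
    have h3 : q e ∈ commutator Γ := by
      rw [← Abelianization.ker_of Γ]; exact h2
    have h4 : (commutator E).map q = commutator Γ := by
      rw [commutator_def, Subgroup.map_commutator, Subgroup.map_top_of_surjective q hq,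
        ← commutator_def]
    rw [← h4] at h3
    obtain ⟨c, hc, hce⟩ := h3
    obtain ⟨k, hk⟩ := hker (e * c⁻¹) (by rw [map_mul, map_inv, hce, mul_inv_cancel])
    have hfc : f c = 1 := Abelianization.commutator_subset_ker f hc
    have h5 := hcomm k (by rw [hk, map_mul, map_inv, h1, hfc]; simp)
    rw [hk] at h5
    simpa using mul_mem h5 hc
  exact ⟨(QuotientGroup.quotientMulEquivOfEq hFker.symm).trans
    (QuotientGroup.quotientKerEquivOfSurjective F hF)⟩

end Abstract

/-! ### The Heisenberg group and the retraction of Γ⁺(G, π) onto G. -/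

/-- The integral Heisenberg group, in symplectic coordinates. -/
@[ext]
structure SymplecticHeisenberg where
  a : ℤ
  b : ℤ
  c : ℤ

namespace SymplecticHeisenberg

instance : Mul SymplecticHeisenberg :=
  ⟨fun g h => ⟨g.a + h.a, g.b + h.b, g.c + h.c + (g.a * h.b - g.b * h.a)⟩⟩

instance : One SymplecticHeisenberg := ⟨⟨0, 0, 0⟩⟩

instance : Inv SymplecticHeisenberg := ⟨fun g => ⟨-g.a, -g.b, -g.c⟩⟩

theorem mul_a (g h : SymplecticHeisenberg) : (g * h).a = g.a + h.a := rfl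
theorem mul_b (g h : SymplecticHeisenberg) : (g * h).b = g.b + h.b := rfl
theorem mul_c (g h : SymplecticHeisenberg) :
    (g * h).c = g.c + h.c + (g.a * h.b - g.b * h.a) := rfl
theorem one_a : (1 : SymplecticHeisenberg).a = 0 := rfl
theorem one_b : (1 : SymplecticHeisenberg).b = 0 := rfl
theorem one_c : (1 : SymplecticHeisenberg).c = 0 := rfl
theorem inv_a (g : SymplecticHeisenberg) : g⁻¹.a = -g.a := rfl
theorem inv_b (g : SymplecticHeisenberg) : g⁻¹.b = -g.b := rfl
theorem inv_c (g : SymplecticHeisenberg) : g⁻¹.c = -g.c := rfl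

instance : Group SymplecticHeisenberg :=
  Group.ofLeftAxioms
    (by intro g h k; ext <;> simp only [mul_a, mul_b, mul_c] <;> ring)
    (by intro g; ext <;> simp only [mul_a, mul_b, mul_c, one_a, one_b, one_c] <;> ring)
    (by
      intro g
      ext <;> simp only [mul_a, mul_b, mul_c, inv_a, inv_b, inv_c, one_a, one_b, one_c] <;> ring)

end SymplecticHeisenberg

section CrossedHom

open FreeGroup (of lift)
open MatrixGroups

local notation "F₂" => FreeGroup (Fin 2)

/-- The homomorphism from `F₂` to the Heisenberg group sending the generators to elements with
central coordinate `1`. -/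
def heisenbergHom : F₂ →* SymplecticHeisenberg := lift ![⟨1, 0, 1⟩, ⟨0, 1, 1⟩]

theorem heisenbergHom_a (g : F₂) : (heisenbergHom g).a = expSum 0 g := by
  induction g using FreeGroup.induction_on with
  | C1 => rw [expSum_one]; rfl
  | of j => fin_cases j <;> simp [heisenbergHom, expSum_of]
  | inv_of j ih => rw [map_inv, expSum_inv, ← ih]; rfl
  | mul g h hg hh => rw [map_mul, expSum_mul, ← hg, ← hh]; rfl

theorem heisenbergHom_b (g : F₂) : (heisenbergHom g).b = expSum 1 g := by
  induction g using FreeGroup.induction_on with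
  | C1 => rw [expSum_one]; rfl
  | of j => fin_cases j <;> simp [heisenbergHom, expSum_of]
  | inv_of j ih => rw [map_inv, expSum_inv, ← ih]; rfl
  | mul g h hg hh => rw [map_mul, expSum_mul, ← hg, ← hh]; rfl

/-- The central Heisenberg coordinate of an element of `F₂`. -/
def heisenbergCoord (g : F₂) : ℤ := (heisenbergHom g).c

theorem heisenbergCoord_mul (g h : F₂) : heisenbergCoord (g * h) =
    heisenbergCoord g + heisenbergCoord h +
      (expSum 0 g * expSum 1 h - expSum 1 g * expSum 0 h) := by
  rw [heisenbergCoord, map_mul, SymplecticHeisenberg.mul_c, heisenbergHom_a, heisenbergHom_a,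
    heisenbergHom_b, heisenbergHom_b]
  rfl

theorem heisenbergCoord_inv (g : F₂) : heisenbergCoord g⁻¹ = -heisenbergCoord g := by
  rw [heisenbergCoord, map_inv]
  rfl

theorem heisenbergCoord_of (i : Fin 2) : heisenbergCoord (of i) = 1 := by
  fin_cases i <;> simp [heisenbergCoord, heisenbergHom]

/-- Here the central coordinate 1 of the generators matters: modulo 2 the coordinate becomes the
quadratic form a + b + ab, which is odd exactly off the origin and so is invariant under SL₂(ℤ).
Central coordinate 0 would give ab, which is not invariant. -/
theorem even_heisenbergCoord_sub (g : F₂) :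
    Even (heisenbergCoord g - (expSum 0 g + expSum 1 g + expSum 0 g * expSum 1 g)) := by
  induction g using FreeGroup.induction_on with
  | C1 => simp [heisenbergCoord, SymplecticHeisenberg.one_c, expSum_one]
  | of j => fin_cases j <;> simp [heisenbergCoord_of, expSum_of]
  | inv_of j ih =>
    obtain ⟨k, hk⟩ := ih
    rw [heisenbergCoord_inv, expSum_inv, expSum_inv]
    exact ⟨-k - expSum 0 (of j) * expSum 1 (of j), by linear_combination (-1 : ℤ) * hk⟩
  | mul g h hg hh =>
    obtain ⟨k, hk⟩ := hg
    obtain ⟨l, hl⟩ := hh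
    rw [heisenbergCoord_mul, expSum_mul, expSum_mul]
    exact ⟨k + l - expSum 1 g * expSum 0 h, by linear_combination hk + hl⟩

theorem det_rhoGL_eq {φ : MulAut F₂} (hφ : φ ∈ specialAut 2) :
    expSum 0 (φ (of 0)) * expSum 1 (φ (of 1)) - expSum 0 (φ (of 1)) * expSum 1 (φ (of 0)) = 1 := by
  have := mem_specialAut_iff.1 hφ
  rwa [Matrix.det_fin_two, rhoGL_apply, rhoGL_apply, rhoGL_apply, rhoGL_apply] at this

theorem expSum_map' (φ : MulAut F₂) (i : Fin 2) (g : F₂) :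
    expSum i (φ g) = expSum i (φ (of 0)) * expSum 0 g + expSum i (φ (of 1)) * expSum 1 g := by
  rw [expSum_map, rhoGL_apply, rhoGL_apply]
  rfl

/-- The change of the Heisenberg coordinate under a special automorphism is a homomorphism. -/
theorem heisenbergCoord_defect_mul {φ : MulAut F₂} (hφ : φ ∈ specialAut 2) (g h : F₂) :
    heisenbergCoord (φ (g * h)) - heisenbergCoord (g * h) =
      (heisenbergCoord (φ g) - heisenbergCoord g) +
        (heisenbergCoord (φ h) - heisenbergCoord h) := by
  rw [map_mul, heisenbergCoord_mul, heisenbergCoord_mul, expSum_map' φ 0 g, expSum_map' φ 1 g,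
    expSum_map' φ 0 h, expSum_map' φ 1 h]
  linear_combination (expSum 0 g * expSum 1 h - expSum 1 g * expSum 0 h) * det_rhoGL_eq hφ

/-- On a generator the coordinate is 1, and on its image it is odd, because a column of a matrix of
determinant one is not zero modulo 2. -/
theorem even_heisenbergCoord_defect {φ : MulAut F₂} (hφ : φ ∈ specialAut 2) (g : F₂) :
    Even (heisenbergCoord (φ g) - heisenbergCoord g) := by
  have hdet := det_rhoGL_eq hφ
  have hgen : ∀ i, Even (heisenbergCoord (φ (of i)) - heisenbergCoord (of i)) := by
    intro i
    have h1 := even_heisenbergCoord_sub (φ (of i))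
    have h2 : Odd (expSum 0 (φ (of i)) + expSum 1 (φ (of i)) +
        expSum 0 (φ (of i)) * expSum 1 (φ (of i))) := by
      by_contra hcon
      rw [Int.not_odd_iff_even] at hcon
      have hp : Even (expSum 0 (φ (of i))) ∧ Even (expSum 1 (φ (of i))) := by
        by_cases h3 : Even (expSum 0 (φ (of i))) <;> by_cases h4 : Even (expSum 1 (φ (of i))) <;>
          simp [Int.even_add, Int.even_mul, h3, h4] at hcon ⊢
      have h5 := congrArg Even hdet
      fin_cases i <;> simp at hp <;> simp [Int.even_sub, hp] at h5
    rw [heisenbergCoord_of]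
    have h3 := h1.add_odd h2
    rw [sub_add_cancel] at h3
    exact h3.sub_odd odd_one
  induction g using FreeGroup.induction_on with
  | C1 => rw [map_one]; simp
  | of j => exact hgen j
  | inv_of j ih =>
    rw [map_inv, heisenbergCoord_inv, heisenbergCoord_inv, neg_sub_neg, ← neg_sub]
    exact ih.neg
  | mul g h hg hh => rw [heisenbergCoord_defect_mul hφ]; exact hg.add hh

/-- Half of the change of the Heisenberg coordinate under an automorphism. -/
def halfDefect (φ : MulAut F₂) (g : F₂) : ℤ := (heisenbergCoord (φ g) - heisenbergCoord g) / 2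

theorem two_mul_halfDefect {φ : MulAut F₂} (hφ : φ ∈ specialAut 2) (g : F₂) :
    2 * halfDefect φ g = heisenbergCoord (φ g) - heisenbergCoord g :=
  Int.two_mul_ediv_two_of_even (even_heisenbergCoord_defect hφ g)

theorem halfDefect_mul {φ : MulAut F₂} (hφ : φ ∈ specialAut 2) (g h : F₂) :
    halfDefect φ (g * h) = halfDefect φ g + halfDefect φ h := by
  have h1 := heisenbergCoord_defect_mul hφ g h
  rw [← two_mul_halfDefect hφ, ← two_mul_halfDefect hφ, ← two_mul_halfDefect hφ] at h1
  omega

theorem halfDefect_eq {φ : MulAut F₂} (hφ : φ ∈ specialAut 2) (g : F₂) :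
    halfDefect φ g = expSum 0 g * halfDefect φ (of 0) + expSum 1 g * halfDefect φ (of 1) := by
  have h1 : halfDefect φ 1 = 0 := by
    have := halfDefect_mul hφ 1 1
    rw [mul_one] at this
    omega
  have hinv : ∀ g, halfDefect φ g⁻¹ = -halfDefect φ g := by
    intro g
    have := halfDefect_mul hφ g g⁻¹
    rw [mul_inv_cancel, h1] at this
    omega
  induction g using FreeGroup.induction_on with
  | C1 => simp [expSum_one, h1]
  | of j => fin_cases j <;> simp [expSum_of]
  | inv_of j ih => rw [hinv, ih, expSum_inv, expSum_inv]; ring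
  | mul g h hg hh => rw [halfDefect_mul hφ, hg, hh, expSum_mul, expSum_mul]; ring

theorem halfDefect_comp {φ ψ : MulAut F₂} (hφ : φ ∈ specialAut 2) (hψ : ψ ∈ specialAut 2)
    (g : F₂) : halfDefect (φ * ψ) g = halfDefect φ (ψ g) + halfDefect ψ g := by
  have h1 := two_mul_halfDefect (mul_mem hφ hψ) g
  have h2 := two_mul_halfDefect hφ (ψ g)
  have h3 := two_mul_halfDefect hψ g
  rw [MulAut.mul_apply] at h1
  omega

theorem conj_mem_specialAut (g : F₂) : MulAut.conj g ∈ specialAut 2 := by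
  rw [mem_specialAut_iff, rhoGL_conj, Matrix.det_one]

/-- In the Heisenberg group, conjugation adds twice the symplectic form to the central coordinate.
Without the halving, the retraction would restrict to 2π instead of π on inner automorphisms. -/
theorem halfDefect_conj (v g : F₂) : halfDefect (MulAut.conj v) g =
    expSum 0 v * expSum 1 g - expSum 1 v * expSum 0 g := by
  have h1 := two_mul_halfDefect (conj_mem_specialAut v) g
  rw [MulAut.conj_apply, heisenbergCoord_mul, heisenbergCoord_mul, heisenbergCoord_inv,
    expSum_mul, expSum_mul, expSum_inv, expSum_inv] at h1
  linarith

variable {B : Type*} [AddCommGroup B] (π : F₂ →* Multiplicative B)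

theorem toAdd_hom_eq (g : F₂) : (π g).toAdd =
    expSum 0 g • (π (of 0)).toAdd + expSum 1 g • (π (of 1)).toAdd := by
  induction g using FreeGroup.induction_on with
  | C1 => simp [expSum_one]
  | of j => fin_cases j <;> simp [expSum_of]
  | inv_of j ih => rw [map_inv, toAdd_inv, ih, expSum_inv, expSum_inv]; module
  | mul g h hg hh => rw [map_mul, toAdd_mul, hg, hh, expSum_mul, expSum_mul]; module

theorem stdCongruencePlus_apply {φ : MulAut F₂} (hφ : φ ∈ stdCongruencePlus π) (g : F₂) :
    π (φ g) = π g := DFunLike.congr_fun hφ.1 g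

/-- The retraction of `Γ⁺(G, π)` onto `G` extending `π` on inner automorphisms. -/
def retraction : stdCongruencePlus π →* Multiplicative B where
  toFun φ := Multiplicative.ofAdd (halfDefect φ (of 1) • (π (of 0)).toAdd -
    halfDefect φ (of 0) • (π (of 1)).toAdd)
  map_one' := by simp [halfDefect]
  map_mul' φ ψ := by
    apply Multiplicative.toAdd.injective
    have e0 := congrArg Multiplicative.toAdd (stdCongruencePlus_apply π ψ.2 (of 0))
    have e1 := congrArg Multiplicative.toAdd (stdCongruencePlus_apply π ψ.2 (of 1))
    rw [toAdd_hom_eq] at e0 e1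
    have hdet := det_rhoGL_eq ψ.2.2
    have c0 := halfDefect_comp φ.2.2 ψ.2.2 (of 0)
    have c1 := halfDefect_comp φ.2.2 ψ.2.2 (of 1)
    rw [halfDefect_eq φ.2.2] at c0 c1
    rw [toAdd_mul, toAdd_ofAdd, toAdd_ofAdd, toAdd_ofAdd, Subgroup.coe_mul, c0, c1]
    generalize expSum 0 ((ψ : MulAut F₂) (of 0)) = a at *
    generalize expSum 1 ((ψ : MulAut F₂) (of 0)) = c at *
    generalize expSum 0 ((ψ : MulAut F₂) (of 1)) = b at *
    generalize expSum 1 ((ψ : MulAut F₂) (of 1)) = d at *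
    generalize (π (of 0)).toAdd = p at *
    generalize (π (of 1)).toAdd = r at *
    generalize halfDefect φ (of 0) = x
    generalize halfDefect φ (of 1) = y
    -- Cramer's rule for the system expressing that π is invariant under `ψ`.
    have f0 : d • p - c • r = p := by
      have : (a * d - b * c) • p = d • p - c • r := by
        linear_combination (norm := module) d • e0 - c • e1
      rw [← this, hdet, one_smul]
    have f1 : a • r - b • p = r := by
      have : (a * d - b * c) • r = a • r - b • p := by
        linear_combination (norm := module) a • e1 - b • e0
      rw [← this, hdet, one_smul]
    linear_combination (norm := module) y • f0 - x • f1

theorem retraction_conj (g : F₂) (h : MulAut.conj g ∈ stdCongruencePlus π) :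
    retraction π ⟨MulAut.conj g, h⟩ = π g := by
  apply Multiplicative.toAdd.injective
  rw [toAdd_hom_eq]
  change halfDefect (MulAut.conj g) (of 1) • (π (of 0)).toAdd -
    halfDefect (MulAut.conj g) (of 0) • (π (of 1)).toAdd = _
  rw [halfDefect_conj, halfDefect_conj]
  simp [expSum_of]

end CrossedHom

/-! ### The congruence group and the splitting of the abelianization. -/

section CongruencePair

open scoped commutatorElement

open FreeGroup (of lift)
open MatrixGroups

local notation "F₂" => FreeGroup (Fin 2)

/-- The matrices whose first row is `(1, 0)` modulo `m` and whose second row is `(0, 1)`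
modulo `n`. -/
def gammaPair (m n : ℕ) : Subgroup SL(2, ℤ) where
  carrier := {A | (m : ℤ) ∣ A 0 0 - 1 ∧ (m : ℤ) ∣ A 0 1 ∧ (n : ℤ) ∣ A 1 0 ∧ (n : ℤ) ∣ A 1 1 - 1}
  one_mem' := by simp
  mul_mem' {A B} hA hB := by
    obtain ⟨⟨a, ha⟩, ⟨b, hb⟩, ⟨c, hc⟩, ⟨d, hd⟩⟩ := hA
    obtain ⟨⟨a', ha'⟩, ⟨b', hb'⟩, ⟨c', hc'⟩, ⟨d', hd'⟩⟩ := hB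
    simp only [Set.mem_ofPred_eq, sl2_mul_apply]
    refine ⟨⟨a * B 0 0 + a' + b * B 1 0, ?_⟩, ⟨a * B 0 1 + b' + b * B 1 1, ?_⟩,
      ⟨c * B 0 0 + d * B 1 0 + c', ?_⟩, ⟨c * B 0 1 + d * B 1 1 + d', ?_⟩⟩
    · linear_combination B 0 0 * ha + ha' + B 1 0 * hb
    · linear_combination B 0 1 * ha + hb' + B 1 1 * hb
    · linear_combination B 0 0 * hc + B 1 0 * hd + hc'
    · linear_combination B 0 1 * hc + B 1 1 * hd + hd'
  inv_mem' {A} hA := by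
    obtain ⟨⟨a, ha⟩, ⟨b, hb⟩, ⟨c, hc⟩, ⟨d, hd⟩⟩ := hA
    have hdet := A.det_coe
    rw [Matrix.det_fin_two] at hdet
    simp only [Matrix.SpecialLinearGroup.SL2_inv_expl]
    refine ⟨⟨b * A 1 0 - a * A 1 1, ?_⟩, ⟨-b, ?_⟩, ⟨-c, ?_⟩, ⟨c * A 0 1 - d * A 0 0, ?_⟩⟩
    · change A 1 1 - 1 = _
      linear_combination hdet + A 1 0 * hb - A 1 1 * ha
    · change -A 0 1 = _
      linear_combination -hb
    · change -A 1 0 = _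
      linear_combination -hc
    · change A 0 0 - 1 = _
      linear_combination hdet + A 0 1 * hc - A 0 0 * hd

theorem mem_gammaPair {m n : ℕ} {A : SL(2, ℤ)} : A ∈ gammaPair m n ↔
    (m : ℤ) ∣ A 0 0 - 1 ∧ (m : ℤ) ∣ A 0 1 ∧ (n : ℤ) ∣ A 1 0 ∧ (n : ℤ) ∣ A 1 1 - 1 := Iff.rfl

/-- An element with vanishing exponent sums lies in the commutator subgroup. -/
theorem mem_commutator_of_expSum_eq_zero {g : F₂} (h : ∀ i, expSum i g = 0) :
    g ∈ commutator F₂ := by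
  rw [← Abelianization.ker_of F₂, MonoidHom.mem_ker]
  have : (freeGroupAbBasis 2).repr (toFreeGroupAb g) = 0 := Finsupp.ext h
  exact (freeGroupAbBasis 2).repr.map_eq_zero_iff.1 this

theorem expSum_of_zpow (i j : Fin 2) (k : ℤ) : expSum i (of j ^ k) = if i = j then k else 0 := by
  let e : F₂ →* Multiplicative ℤ :=
    { toFun := fun g => Multiplicative.ofAdd (expSum i g)
      map_one' := by rw [expSum_one]; rfl
      map_mul' := fun g h => by rw [expSum_mul]; rfl }
  have h1 : expSum i (of j ^ k) = (e (of j ^ k)).toAdd := rfl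
  have h2 : (e (of j)).toAdd = expSum i (of j) := rfl
  rw [h1, map_zpow, toAdd_zpow, h2, expSum_of]
  split_ifs <;> simp

variable {B : Type*} [AddCommGroup B] {π : F₂ →* Multiplicative B}

theorem mem_stdCongruencePlus_iff {φ : MulAut F₂} : φ ∈ stdCongruencePlus π ↔
    (∀ g, π (φ g) = π g) ∧ φ ∈ specialAut 2 := by
  refine and_congr ⟨fun h g => DFunLike.congr_fun h g, fun h => MonoidHom.ext h⟩ Iff.rfl

theorem conj_mem_stdCongruencePlus (π : F₂ →* Multiplicative B) (g : F₂) :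
    MulAut.conj g ∈ stdCongruencePlus π := by
  rw [mem_stdCongruencePlus_iff]
  refine ⟨fun h => ?_, conj_mem_specialAut g⟩
  rw [MulAut.conj_apply, map_mul, map_mul, map_inv, mul_inv_cancel_comm]

/-- Inner automorphisms, as elements of `Γ⁺(G, π)`. -/
noncomputable def conjPlus (π : F₂ →* Multiplicative B) : F₂ →* stdCongruencePlus π :=
  MulAut.conj.codRestrict _ (conj_mem_stdCongruencePlus π)

/-- The matrix of a special automorphism. -/
noncomputable def specialMatrix (π : F₂ →* Multiplicative B) : stdCongruencePlus π →* SL(2, ℤ) where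
  toFun φ := ⟨rhoGL 2 φ, mem_specialAut_iff.1 φ.2.2⟩
  map_one' := Subtype.ext (by simp)
  map_mul' φ ψ := Subtype.ext (by
    change (rhoGL 2 (φ * ψ : MulAut F₂) : Matrix (Fin 2) (Fin 2) ℤ) = _
    rw [map_mul]; rfl)

variable {m n : ℕ} (hπ : ∀ g, π g = 1 ↔ (m : ℤ) ∣ expSum 0 g ∧ (n : ℤ) ∣ expSum 1 g)
include hπ

theorem hom_apply_eq_iff (g h : F₂) : π g = π h ↔
    (m : ℤ) ∣ expSum 0 g - expSum 0 h ∧ (n : ℤ) ∣ expSum 1 g - expSum 1 h := by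
  rw [← mul_inv_eq_one, ← map_inv, ← map_mul, hπ, expSum_mul, expSum_mul, expSum_inv, expSum_inv,
    sub_eq_add_neg, sub_eq_add_neg]

theorem mem_stdCongruencePlus_of_mem_gammaPair {φ : MulAut F₂} {A : SL(2, ℤ)}
    (hA : A ∈ gammaPair m n) (h : (rhoGL 2 φ : Matrix (Fin 2) (Fin 2) ℤ) = A) :
    φ ∈ stdCongruencePlus π := by
  rw [mem_stdCongruencePlus_iff, mem_specialAut_iff, h]
  refine ⟨fun g => ?_, A.det_coe⟩
  rw [hom_apply_eq_iff hπ, expSum_map, expSum_map, h]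
  obtain ⟨⟨a, ha⟩, ⟨b, hb⟩, ⟨c, hc⟩, ⟨d, hd⟩⟩ := hA
  exact ⟨⟨a * expSum 0 g + b * expSum 1 g, by
      linear_combination expSum 0 g * ha + expSum 1 g * hb⟩,
    ⟨c * expSum 0 g + d * expSum 1 g, by
      linear_combination expSum 0 g * hc + expSum 1 g * hd⟩⟩

theorem specialMatrix_mem (φ : stdCongruencePlus π) : specialMatrix π φ ∈ gammaPair m n := by
  have h0 := (hom_apply_eq_iff hπ _ _).1 (stdCongruencePlus_apply π φ.2 (of 0))
  have h1 := (hom_apply_eq_iff hπ _ _).1 (stdCongruencePlus_apply π φ.2 (of 1))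
  rw [expSum_map, expSum_map] at h0 h1
  simp only [expSum_of] at h0 h1
  simp at h0 h1
  exact ⟨h0.1, h1.1, h0.2, h1.2⟩

/-- Modulo F₂' the kernel of π is generated by x^m and y^n, and each of these is a displacement φ(g)
g⁻¹ for a transvection φ in Γ⁺(G, π). -/
theorem conjPlus_mem_commutator {g : F₂} (hg : π g = 1) :
    conjPlus π g ∈ commutator (stdCongruencePlus π) := by
  let W : Subgroup F₂ := (commutator (stdCongruencePlus π)).comap (conjPlus π)
  have hW : commutator F₂ ≤ W := by
    rw [← Subgroup.map_le_iff_le_comap, commutator_def, Subgroup.map_commutator]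
    exact Subgroup.commutator_mono le_top le_top
  -- Conjugation by φ(g) g⁻¹ is the commutator of φ with conjugation by g.
  have hshift : ∀ φ ∈ stdCongruencePlus π, ∀ g, φ g * g⁻¹ ∈ W := by
    intro φ hφ g
    have h1 : conjPlus π (φ g * g⁻¹) = ⁅(⟨φ, hφ⟩ : stdCongruencePlus π), conjPlus π g⁆ := by
      rw [map_mul, map_inv, commutatorElement_def]
      congr 1
      exact Subtype.ext (mul_conj_mul_inv φ g).symm
    change conjPlus π (φ g * g⁻¹) ∈ commutator _
    rw [h1]
    exact Subgroup.commutator_mem_commutator (Subgroup.mem_top _) (Subgroup.mem_top _)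
  have hmod : ∀ g h : F₂, (∀ i, expSum i g = expSum i h) → h ∈ W → g ∈ W := by
    intro g h hgh hh
    have : g * h⁻¹ ∈ W := hW (mem_commutator_of_expSum_eq_zero fun i => by
      rw [expSum_mul, expSum_inv, hgh, add_neg_cancel])
    simpa using mul_mem this hh
  -- A lift of this transvection moves y by x^m modulo F₂'.
  have hx : (of 0 : F₂) ^ (m : ℤ) ∈ W := by
    obtain ⟨A, hA⟩ : ∃ A : SL(2, ℤ), (A : Matrix (Fin 2) (Fin 2) ℤ) = !![1, (m : ℤ); 0, 1] :=
      ⟨⟨_, by rw [Matrix.det_fin_two_of]; ring⟩, rfl⟩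
    obtain ⟨φ, hφ⟩ := exists_rhoGL_eq A
    have hmem := mem_stdCongruencePlus_of_mem_gammaPair hπ
      (by rw [mem_gammaPair, hA]; simp) hφ
    refine hmod _ _ (fun i => ?_) (hshift φ hmem (of 1))
    rw [expSum_of_zpow, expSum_mul, expSum_inv, expSum_map, hφ, hA]
    fin_cases i <;> simp [expSum_of]
  have hy : (of 1 : F₂) ^ (n : ℤ) ∈ W := by
    obtain ⟨A, hA⟩ : ∃ A : SL(2, ℤ), (A : Matrix (Fin 2) (Fin 2) ℤ) = !![1, 0; (n : ℤ), 1] :=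
      ⟨⟨_, by rw [Matrix.det_fin_two_of]; ring⟩, rfl⟩
    obtain ⟨φ, hφ⟩ := exists_rhoGL_eq A
    have hmem := mem_stdCongruencePlus_of_mem_gammaPair hπ
      (by rw [mem_gammaPair, hA]; simp) hφ
    refine hmod _ _ (fun i => ?_) (hshift φ hmem (of 0))
    rw [expSum_of_zpow, expSum_mul, expSum_inv, expSum_map, hφ, hA]
    fin_cases i <;> simp [expSum_of]
  obtain ⟨⟨i, hi⟩, ⟨j, hj⟩⟩ := (hπ g).1 hg
  refine hmod g _ (fun k => ?_) (mul_mem (zpow_mem hx i) (zpow_mem hy j))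
  rw [expSum_mul, ← zpow_mul, ← zpow_mul, expSum_of_zpow, expSum_of_zpow]
  fin_cases k <;> simp [hi, hj]

theorem abelianization_of_normalized (hsurj : Function.Surjective π) :
    Nonempty (Abelianization (stdCongruencePlus π) ≃*
      Multiplicative B × Abelianization (gammaPair m n)) := by
  refine abelianization_equiv_prod (retraction π)
    ((specialMatrix π).codRestrict (gammaPair m n) (specialMatrix_mem hπ)) (conjPlus π)
    ?_ ?_ ?_ ?_ ?_
  · rintro ⟨A, hA⟩
    obtain ⟨φ, hφ⟩ := exists_rhoGL_eq A
    exact ⟨⟨φ, mem_stdCongruencePlus_of_mem_gammaPair hπ hA hφ⟩, Subtype.ext (Subtype.ext hφ)⟩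
  · intro b
    obtain ⟨g, rfl⟩ := hsurj b
    exact ⟨g, retraction_conj π g _⟩
  · intro g
    exact Subtype.ext (Subtype.ext (rhoGL_conj g))
  · rintro ⟨φ, hφ⟩ h
    have h1 := congrArg (fun A : gammaPair m n => ((A : SL(2, ℤ)) : Matrix (Fin 2) (Fin 2) ℤ)) h
    obtain ⟨g, rfl⟩ := exists_conj_of_rhoGL_eq_one h1
    exact ⟨g, rfl⟩
  · intro g hg
    exact conjPlus_mem_commutator hπ ((retraction_conj π g _).symm.trans hg)

end CongruencePair

/-! ### Reduction to an epimorphism with standard kernel. -/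

section Normalization

open FreeGroup (of lift)
open MatrixGroups

local notation "F₂" => FreeGroup (Fin 2)

/-- A pair unimodular modulo m lifts to a coprime pair: a multiple of m is added to `a` so that
every prime factor of the second entry is avoided. -/
theorem exists_isCoprime_lift {m : ℕ} (hm : m ≠ 0) {a b u v : ℤ}
    (h : (m : ℤ) ∣ a * u + b * v - 1) :
    ∃ a' b' : ℤ, (m : ℤ) ∣ a' - a ∧ (m : ℤ) ∣ b' - b ∧ IsCoprime a' b' := by
  obtain ⟨b', hb', hb0⟩ : ∃ b' : ℤ, (m : ℤ) ∣ b' - b ∧ b' ≠ 0 := by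
    by_cases hb : b = 0
    · exact ⟨m, by simp [hb], by exact_mod_cast hm⟩
    · exact ⟨b, by simp, hb⟩
  -- A prime factor of `b'` divides exactly one of `a` and `k`. If it divides `a + k m`, then it
  -- divides `a` and m, which contradicts unimodularity.
  let k : ℕ := ∏ p ∈ b'.natAbs.primeFactors.filter (fun p : ℕ => ¬ (p : ℤ) ∣ a), p
  refine ⟨a + k * m, b', by simp, hb', ?_⟩
  rw [Int.isCoprime_iff_gcd_eq_one]
  by_contra hcon
  obtain ⟨q, hq, hqd⟩ := Nat.exists_prime_and_dvd hcon
  have hqa : (q : ℤ) ∣ a + k * m := (Int.natCast_dvd_natCast.2 hqd).trans (Int.gcd_dvd_left ..)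
  have hqb : (q : ℤ) ∣ b' := (Int.natCast_dvd_natCast.2 hqd).trans (Int.gcd_dvd_right ..)
  have hqmem : q ∈ b'.natAbs.primeFactors :=
    Nat.mem_primeFactors.2 ⟨hq, Int.natCast_dvd.1 hqb, by simpa using hb0⟩
  by_cases h1 : (q : ℤ) ∣ a
  · have h2 : (q : ℤ) ∣ k * m := (dvd_add_right h1).1 hqa
    rcases (Nat.prime_iff_prime_int.1 hq).dvd_or_dvd h2 with h3 | h3
    · rw [Int.natCast_dvd_natCast] at h3
      obtain ⟨p, hp, hqp⟩ := (hq.prime.dvd_finsetProd_iff _).1 h3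
      rw [Finset.mem_filter] at hp
      rw [(Nat.prime_dvd_prime_iff_eq hq (Nat.prime_of_mem_primeFactors hp.1)).1 hqp] at h1
      exact hp.2 h1
    · have h4 : (q : ℤ) ∣ b := by
        have := h3.trans hb'
        rwa [dvd_sub_right hqb] at this
      have h5 : (q : ℤ) ∣ 1 := by
        have := h3.trans h
        rwa [dvd_sub_right (dvd_add (h1.mul_right u) (h4.mul_right v))] at this
      exact (Nat.prime_iff_prime_int.1 hq).not_dvd_one h5
  · have h2 : (q : ℤ) ∣ k := by
      rw [Int.natCast_dvd_natCast]
      exact Finset.dvd_prod_of_mem _ (Finset.mem_filter.2 ⟨hqmem, h1⟩)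
    exact h1 ((dvd_add_left (h2.mul_right _)).1 hqa)

variable {m n : ℕ}

/-- Up to a special automorphism, an epimorphism onto `ℤ/m × ℤ/n` has the standard kernel. -/
theorem exists_normalizing_aut (hm : m ≠ 0) (hnm : n ∣ m)
    (π : F₂ →* Multiplicative (ZMod m × ZMod n)) (hsurj : Function.Surjective π) :
    ∃ ψ ∈ specialAut 2, ∀ g,
      π (ψ g) = 1 ↔ (m : ℤ) ∣ expSum 0 g ∧ (n : ℤ) ∣ expSum 1 g := by
  obtain ⟨a, ha⟩ := ZMod.intCast_surjective (π (of 0)).toAdd.1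
  obtain ⟨b, hb⟩ := ZMod.intCast_surjective (π (of 1)).toAdd.1
  have hfst : ∀ g, (π g).toAdd.1 = expSum 0 g * (a : ZMod m) + expSum 1 g * (b : ZMod m) := by
    intro g
    rw [toAdd_hom_eq, ha, hb]
    simp
  obtain ⟨g₁, hg₁⟩ := hsurj (Multiplicative.ofAdd (1, 0))
  have h1 : (m : ℤ) ∣ a * expSum 0 g₁ + b * expSum 1 g₁ - 1 := by
    have := hfst g₁
    rw [hg₁, toAdd_ofAdd] at this
    rw [← ZMod.intCast_zmod_eq_zero_iff_dvd]
    push_cast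
    linear_combination -this
  obtain ⟨a', b', ha', hb', hab⟩ := exists_isCoprime_lift hm h1
  have ea : (a : ZMod m) = a' := (ZMod.intCast_eq_intCast_iff_dvd_sub _ _ _).2 ha'
  have eb : (b : ZMod m) = b' := (ZMod.intCast_eq_intCast_iff_dvd_sub _ _ _).2 hb'
  -- The first row of `M` lists the first coordinates of π on the generators modulo m, so
  -- precomposing with a lift of `M⁻¹` makes the first coordinate equal to `expSum 0`.
  obtain ⟨M, hM⟩ := hab.exists_SL2_row 0
  obtain ⟨ψ, hψ⟩ := exists_rhoGL_eq M⁻¹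
  have hψs : ψ ∈ specialAut 2 := by rw [mem_specialAut_iff, hψ]; exact (M⁻¹).det_coe
  have hdet := M.det_coe
  have e0 : ∀ g, expSum 0 (ψ g) = M 1 1 * expSum 0 g - M 0 1 * expSum 1 g := by
    intro g
    rw [expSum_map, hψ, Matrix.SpecialLinearGroup.SL2_inv_expl]
    change M 1 1 * _ + -M 0 1 * _ = _
    ring
  have e1 : ∀ g, expSum 1 (ψ g) = -M 1 0 * expSum 0 g + M 0 0 * expSum 1 g := by
    intro g
    rw [expSum_map, hψ, Matrix.SpecialLinearGroup.SL2_inv_expl]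
    rfl
  have hM0 : M 0 0 = a' := hM.1
  have hM1 : M 0 1 = b' := hM.2
  rw [Matrix.det_fin_two, hM0, hM1] at hdet
  rw [hM1] at e0
  rw [hM0] at e1
  have hfst' : ∀ g, (π (ψ g)).toAdd.1 = expSum 0 g := by
    intro g
    have hdet' := congrArg (Int.cast : ℤ → ZMod m) hdet
    rw [hfst, e0, e1, ea, eb]
    push_cast at hdet' ⊢
    linear_combination expSum 0 g * hdet'
  have hsnd : ∀ g, (π (ψ g)).toAdd.2 = expSum 0 g * (π (ψ (of 0))).toAdd.2 +
      expSum 1 g * (π (ψ (of 1))).toAdd.2 := by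
    intro g
    have := toAdd_hom_eq (π.comp ψ.toMonoidHom) g
    have h2 := congrArg Prod.snd this
    simpa using h2
  obtain ⟨g₂, hg₂⟩ := hsurj (Multiplicative.ofAdd (0, 1))
  obtain ⟨g₂, rfl⟩ := ψ.surjective g₂
  have hdvd : ∀ g, (π (ψ g)).toAdd.1 = 0 → ((expSum 0 g : ℤ) : ZMod n) = 0 := by
    intro g hg
    rw [hfst', ZMod.intCast_zmod_eq_zero_iff_dvd] at hg
    rw [ZMod.intCast_zmod_eq_zero_iff_dvd]
    exact (Int.natCast_dvd_natCast.2 hnm).trans hg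
  -- An element over (0, 1) has `expSum 0` divisible by m, hence by n, so its second coordinate
  -- comes from `of 1` alone and the image of `of 1` is a unit there.
  have hunit : (expSum 1 g₂ : ZMod n) * (π (ψ (of 1))).toAdd.2 = 1 := by
    have h3 := hsnd g₂
    rw [hdvd g₂ (by rw [hg₂]; rfl), zero_mul, zero_add, hg₂] at h3
    exact h3.symm
  refine ⟨ψ, hψs, fun g => ?_⟩
  have h4 : π (ψ g) = 1 ↔ (π (ψ g)).toAdd.1 = 0 ∧ (π (ψ g)).toAdd.2 = 0 := by
    rw [← Prod.mk_eq_zero]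
    exact Iff.rfl
  rw [h4, ← ZMod.intCast_zmod_eq_zero_iff_dvd (expSum 0 g), hfst']
  refine and_congr_right fun h5 => ?_
  rw [hsnd, hdvd g (by rw [hfst', h5]), zero_mul, zero_add, ← ZMod.intCast_zmod_eq_zero_iff_dvd]
  constructor
  · intro h6
    linear_combination (expSum 1 g₂ : ZMod n) * h6 - (expSum 1 g : ZMod n) * hunit
  · intro h6
    rw [h6, zero_mul]

/-- Conjugation by `ψ` identifies the congruence subgroups of `π ∘ ψ` and `π`. -/
theorem stdCongruencePlus_comp_equiv {B : Type*} [AddCommGroup B] (π : F₂ →* Multiplicative B)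
    {ψ : MulAut F₂} (hψ : ψ ∈ specialAut 2) :
    Nonempty (stdCongruencePlus π ≃* stdCongruencePlus (π.comp ψ.toMonoidHom)) := by
  have h : (stdCongruencePlus π).map (MulAut.conj ψ⁻¹).toMonoidHom =
      stdCongruencePlus (π.comp ψ.toMonoidHom) := by
    ext φ
    rw [Subgroup.mem_map]
    constructor
    · rintro ⟨χ, hχ, rfl⟩
      rw [mem_stdCongruencePlus_iff] at hχ ⊢
      refine ⟨fun g => ?_, ?_⟩
      · have := hχ.1 (ψ g)
        simpa [MulAut.conj_apply] using this
      · exact mul_mem (mul_mem (inv_mem hψ) hχ.2) (inv_mem (inv_mem hψ))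
    · intro hφ
      rw [mem_stdCongruencePlus_iff] at hφ
      refine ⟨ψ * φ * ψ⁻¹, ?_, by simp [mul_assoc]⟩
      rw [mem_stdCongruencePlus_iff]
      refine ⟨fun g => ?_, mul_mem (mul_mem hψ hφ.2) (inv_mem hψ)⟩
      have := hφ.1 (ψ⁻¹ g)
      simpa using this
  exact ⟨((MulAut.conj ψ⁻¹).subgroupMap _).trans (MulEquiv.subgroupCongr h)⟩

theorem abelianization_stdCongruencePlus (hm : m ≠ 0) (hnm : n ∣ m)
    (π : F₂ →* Multiplicative (ZMod m × ZMod n)) (hsurj : Function.Surjective π) :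
    Nonempty (Abelianization (stdCongruencePlus π) ≃*
      Multiplicative (ZMod m × ZMod n) × Abelianization (gammaPair m n)) := by
  obtain ⟨ψ, hψ, hker⟩ := exists_normalizing_aut hm hnm π hsurj
  obtain ⟨e⟩ := stdCongruencePlus_comp_equiv π hψ
  obtain ⟨e'⟩ := abelianization_of_normalized (π := π.comp ψ.toMonoidHom) hker
    (hsurj.comp ψ.surjective)
  exact ⟨e.abelianizationCongr.trans e'⟩

end Normalization

/-! ### Homomorphisms on a stabilizer as cocycles on the orbit. -/

section Shapiro

variable {G Y A : Type*} [Group G] [MulAction G Y] [AddCommGroup A]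

/-- A one-cocycle of the action groupoid of `G` on `Y` with values in `A`. -/
def IsActionCocycle (c : G → Y → A) : Prop :=
  ∀ g h y, c (g * h) y = c g (h • y) + c h y

theorem IsActionCocycle.one {c : G → Y → A} (hc : IsActionCocycle c) (y : Y) : c 1 y = 0 := by
  have := hc 1 1 y
  rw [mul_one, one_smul] at this
  simpa using this

theorem IsActionCocycle.inv {c : G → Y → A} (hc : IsActionCocycle c) (g : G) (y : Y) :
    c g⁻¹ (g • y) = -c g y := by
  have := hc g⁻¹ g y
  rw [inv_mul_cancel, hc.one] at this
  exact eq_neg_of_add_eq_zero_left this.symm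

/-- The homomorphism on a stabilizer obtained by restricting a cocycle. -/
def IsActionCocycle.restrict {c : G → Y → A} (hc : IsActionCocycle c) (y₀ : Y) :
    MulAction.stabilizer G y₀ →* Multiplicative A where
  toFun g := Multiplicative.ofAdd (c g y₀)
  map_one' := by
    change Multiplicative.ofAdd (c 1 y₀) = 1
    rw [hc.one]; rfl
  map_mul' g h := by
    change Multiplicative.ofAdd (c (g * h) y₀) = _
    rw [hc, show (h : G) • y₀ = y₀ from h.2]; rfl

open scoped Classical in
/-- Cocycles on a transitive action groupoid are determined by their restriction to a stabilizer
and a gauge. -/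
theorem actionCocycle_equiv [MulAction.IsPretransitive G Y] (y₀ : Y)
    (z : MulAction.stabilizer G y₀) (e : A) :
    Nonempty ({c : G → Y → A // IsActionCocycle c ∧ c z y₀ = e} ≃
      {b : MulAction.stabilizer G y₀ →* Multiplicative A // b z = Multiplicative.ofAdd e} ×
        ({y : Y // y ≠ y₀} → A)) := by
  obtain ⟨t, ht, ht₀⟩ : ∃ t : Y → G, (∀ y, t y • y₀ = y) ∧ t y₀ = 1 := by
    choose t ht using fun y => MulAction.exists_smul_eq G y₀ y
    refine ⟨Function.update t y₀ 1, fun y => ?_, by simp⟩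
    by_cases hy : y = y₀
    · subst hy; simp
    · rw [Function.update_of_ne hy]; exact ht y
  -- The Schreier cocycle of the transversal `t`. The normalization `t y₀ = 1` makes it the identity
  -- on the stabilizer.
  let k : G → Y → MulAction.stabilizer G y₀ := fun g y => ⟨(t (g • y))⁻¹ * g * t y, by
    rw [MulAction.mem_stabilizer_iff, mul_smul, mul_smul, ht, inv_smul_eq_iff, ht]⟩
  let f' : ({y : Y // y ≠ y₀} → A) → Y → A := fun f y => if h : y = y₀ then 0 else f ⟨y, h⟩
  have hk : ∀ g h y, k (g * h) y = k g (h • y) * k h y := by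
    intro g h y
    apply Subtype.ext
    change (t ((g * h) • y))⁻¹ * (g * h) * t y =
      ((t (g • h • y))⁻¹ * g * t (h • y)) * ((t (h • y))⁻¹ * h * t y)
    rw [mul_smul]
    group
  have hk₀ : ∀ g : MulAction.stabilizer G y₀, k g y₀ = g := by
    intro g
    apply Subtype.ext
    change (t ((g : G) • y₀))⁻¹ * g * t y₀ = g
    rw [show (g : G) • y₀ = y₀ from g.2, ht₀]
    simp
  -- The pullback of `b` along `k`, changed by the coboundary of `f`. The gauge `f` is normalized to
  -- vanish at `y₀`, which removes the constants.
  let C : (MulAction.stabilizer G y₀ →* Multiplicative A) → ({y : Y // y ≠ y₀} → A) → G → Y → A :=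
    fun b f g y => (b (k g y)).toAdd + f' f (g • y) - f' f y
  have hC : ∀ b f, IsActionCocycle (C b f) := by
    intro b f g h y
    simp only [C, hk, map_mul, toAdd_mul, mul_smul]
    abel
  have hC₀ : ∀ b f (g : MulAction.stabilizer G y₀), C b f g y₀ = (b g).toAdd := by
    intro b f g
    simp only [C, hk₀]
    rw [show (g : G) • y₀ = y₀ from g.2]
    abel
  refine ⟨⟨fun c => ⟨⟨c.2.1.restrict y₀, congrArg Multiplicative.ofAdd c.2.2⟩,
      fun y => c.1 (t y) y₀⟩,
    fun p => ⟨C p.1.1 p.2, hC _ _, by rw [hC₀, p.1.2]; rfl⟩, ?_, ?_⟩⟩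
  · rintro ⟨c, hc, hz⟩
    apply Subtype.ext
    funext g y
    change c (k g y) y₀ + f' (fun y => c (t y) y₀) (g • y) - f' (fun y => c (t y) y₀) y = c g y
    have hf' : ∀ y, f' (fun y => c (t y) y₀) y = c (t y) y₀ := by
      intro y
      by_cases hy : y = y₀
      · subst hy; simp [f', ht₀, hc.one]
      · simp [f', hy]
    have h1 : c (k g y) y₀ = -c (t (g • y)) y₀ + c g y + c (t y) y₀ := by
      change c ((t (g • y))⁻¹ * g * t y) y₀ = _
      rw [hc, hc, ht]
      have := hc.inv (t (g • y)) y₀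
      rw [ht] at this
      rw [this]
    rw [hf', hf', h1]
    abel
  · rintro ⟨⟨b, hb⟩, f⟩
    refine Prod.ext (Subtype.ext (MonoidHom.ext fun g => ?_)) (funext fun y => ?_)
    · exact congrArg Multiplicative.ofAdd (hC₀ b f g)
    · change C b f (t y) y₀ = f y
      have h1 : k (t y) y₀ = 1 := by
        apply Subtype.ext
        change (t (t y • y₀))⁻¹ * t y * t y₀ = 1
        rw [ht, ht₀]; simp
      simp [C, h1, ht, f', y.2]

end Shapiro

/-! ### Cocycles of SL₂(ℤ) given by their values on S and U. -/

section ModularCocycle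

open MatrixGroups

variable {Y A : Type*} [MulAction SL(2, ℤ) Y] [AddCommGroup A]

/-- The permutation of `Y × A` over the action of `g` with translation part `s`. -/
def shiftPerm (g : SL(2, ℤ)) (s : Y → A) : Equiv.Perm (Y × A) where
  toFun p := (g • p.1, p.2 + s p.1)
  invFun p := (g⁻¹ • p.1, p.2 - s (g⁻¹ • p.1))
  left_inv p := by simp
  right_inv p := by simp

/-- A cocycle is a lift of the action to Y × A commuting with translations of A. Under the two sum
conditions, S² and U³ both lift to translation by `e`, an involution or the identity, so the
defining relations hold. -/
theorem exists_modular_cocycle (hneg : ∀ y : Y, (-1 : SL(2, ℤ)) • y = y) {e : A} (he : 2 • e = 0)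
    {s u : Y → A} (hs : ∀ y, s (ModularGroup.S • y) + s y = e)
    (hu : ∀ y, u (modU ^ 2 • y) + u (modU • y) + u y = e) :
    ∃ c : SL(2, ℤ) → Y → A, IsActionCocycle c ∧ c ModularGroup.S = s ∧ c modU = u := by
  have hs2 : ∀ p : Y × A, (shiftPerm ModularGroup.S s ^ 2) p = (p.1, p.2 + e) := by
    intro p
    change ((ModularGroup.S • ModularGroup.S • p.1, p.2 + s p.1 + s (ModularGroup.S • p.1))) = _
    rw [smul_smul, ← pow_two, modS_sq, hneg, ← hs p.1]
    congr 1
    abel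
  obtain ⟨f, hfS, hfU⟩ := exists_modular_lift (s := shiftPerm ModularGroup.S s)
    (u := shiftPerm modU u)
    (by
      ext1 p
      rw [show 4 = 2 * 2 from rfl, pow_mul, pow_two (_ ^ 2), Equiv.Perm.mul_apply, hs2, hs2]
      change (p.1, p.2 + e + e) = p
      rw [add_assoc, ← two_smul ℕ, he, add_zero])
    (by
      ext1 p
      rw [hs2]
      change (modU • modU • modU • p.1, p.2 + u p.1 + u (modU • p.1) + u (modU • modU • p.1)) = _
      have h3 : modU • modU • modU • p.1 = p.1 := by
        rw [smul_smul, smul_smul, ← pow_two, ← pow_succ, modU_cube, hneg]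
      rw [h3, ← hu p.1, smul_smul modU modU, ← pow_two]
      congr 1
      abel)
  have key : ∀ g : SL(2, ℤ), ∀ y a, f g (y, a) = (g • y, a + (f g (y, 0)).2) := by
    intro g
    have hg : g ∈ Subgroup.closure {ModularGroup.S, modU} := by
      rw [closure_modS_modU]; trivial
    induction hg using Subgroup.closure_induction with
    | mem x hx =>
      rcases hx with rfl | rfl
      · intro y a; rw [hfS]; simp [shiftPerm]
      · intro y a; rw [hfU]; simp [shiftPerm]
    | one => intro y a; simp
    | mul x z _ _ hx hz =>
      intro y a
      rw [map_mul, Equiv.Perm.mul_apply, Equiv.Perm.mul_apply, hz, hx, hz y 0, hx _ (0 + _),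
        mul_smul]
      congr 1
      simp only [zero_add]
      abel
    | inv x _ hx =>
      intro y a
      have h1 : ∀ y a, f x⁻¹ (y, a) = (x⁻¹ • y, a - (f x (x⁻¹ • y, 0)).2) := by
        intro y a
        rw [map_inv, Equiv.Perm.inv_eq_iff_eq, hx]
        simp
      rw [h1 y a, h1 y 0]
      congr 1
      rw [zero_sub, sub_eq_add_neg]
  refine ⟨fun g y => (f g (y, 0)).2, ?_, ?_, ?_⟩
  · intro g h y
    change (f (g * h) (y, 0)).2 = _
    rw [map_mul, Equiv.Perm.mul_apply, key h y 0, key g]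
    simp [add_comm]
  · funext y; change (f _ (y, 0)).2 = _; rw [hfS]; simp [shiftPerm]
  · funext y; change (f _ (y, 0)).2 = _; rw [hfU]; simp [shiftPerm]

theorem modular_cocycle_ext {c c' : SL(2, ℤ) → Y → A} (hc : IsActionCocycle c)
    (hc' : IsActionCocycle c') (hS : c ModularGroup.S = c' ModularGroup.S) (hU : c modU = c' modU) :
    c = c' := by
  funext g
  have hg : g ∈ Subgroup.closure {ModularGroup.S, modU} := by
    rw [closure_modS_modU]; trivial
  induction hg using Subgroup.closure_induction with
  | mem x hx =>
    rcases hx with rfl | rfl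
    · exact hS
    · exact hU
  | one => funext y; rw [hc.one, hc'.one]
  | mul x z _ _ hx hz => funext y; rw [hc, hc', hx, hz]
  | inv x _ hx =>
    funext y
    have h1 := hc.inv x (x⁻¹ • y)
    have h2 := hc'.inv x (x⁻¹ • y)
    rw [smul_inv_smul] at h1 h2
    rw [h1, h2, hx]

/-- Since -1 is central and acts trivially, the two ways of expanding the cocycle at `-g` show that
its value at -1 is invariant along orbits. -/
theorem modular_cocycle_neg_one [MulAction.IsPretransitive SL(2, ℤ) Y]
    (hneg : ∀ y : Y, (-1 : SL(2, ℤ)) • y = y) {c : SL(2, ℤ) → Y → A} (hc : IsActionCocycle c)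
    (y y' : Y) : c (-1) y = c (-1) y' := by
  obtain ⟨g, rfl⟩ := MulAction.exists_smul_eq SL(2, ℤ) y y'
  have h1 := hc (-1) g y
  have h2 := hc g (-1) y
  rw [show (-1 : SL(2, ℤ)) * g = g * -1 by rw [neg_one_mul, mul_neg_one], h2, hneg, add_comm] at h1
  exact add_right_cancel h1

/-- Counting the homomorphisms from the stabilizer of a point under a transitive action of
`SL₂(ℤ)` on which `-1` acts trivially. -/
theorem card_stabilizer_hom_mul [Finite Y] [Finite A] [MulAction.IsPretransitive SL(2, ℤ) Y]
    (hneg : ∀ y : Y, (-1 : SL(2, ℤ)) • y = y) (y₀ : Y) {e : A} (he : 2 • e = 0) :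
    Nat.card {b : MulAction.stabilizer SL(2, ℤ) y₀ →* Multiplicative A //
        b ⟨-1, hneg y₀⟩ = Multiplicative.ofAdd e} * Nat.card A ^ (Nat.card Y - 1) =
      Nat.card {s : Y → A // ∀ y, s (ModularGroup.S • y) + s y = e} *
        Nat.card {u : Y → A // ∀ y, u (modU ^ 2 • y) + u (modU • y) + u y = e} := by
  classical
  obtain ⟨E⟩ := actionCocycle_equiv (A := A) y₀ ⟨-1, hneg y₀⟩ e
  have h1 := Nat.card_congr E
  rw [Nat.card_prod] at h1
  have h2 : Nat.card ({y : Y // y ≠ y₀} → A) = Nat.card A ^ (Nat.card Y - 1) := by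
    cases nonempty_fintype Y
    have h3 : Nat.card {y : Y // y ≠ y₀} = Nat.card Y - 1 := by
      rw [Nat.card_eq_fintype_card, Nat.card_eq_fintype_card, Fintype.card_subtype_compl,
        Fintype.card_subtype_eq]
    rw [Nat.card_fun, h3]
  rw [h2] at h1
  rw [← h1, ← Nat.card_prod]
  have hS : ∀ c : SL(2, ℤ) → Y → A, IsActionCocycle c → c (-1) y₀ = e →
      ∀ y, c ModularGroup.S (ModularGroup.S • y) + c ModularGroup.S y = e := by
    intro c hc h y
    rw [← hc, ← pow_two, modS_sq, modular_cocycle_neg_one hneg hc y y₀, h]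
  have hU : ∀ c : SL(2, ℤ) → Y → A, IsActionCocycle c → c (-1) y₀ = e →
      ∀ y, c modU (modU ^ 2 • y) + c modU (modU • y) + c modU y = e := by
    intro c hc h y
    rw [← h, ← modular_cocycle_neg_one hneg hc y y₀, ← modU_cube,
      show modU ^ 3 = modU * (modU * modU) by rw [pow_succ', pow_two], hc, hc, pow_two]
    abel
  refine Nat.card_congr (Equiv.ofBijective
    (fun c => (⟨c.1 ModularGroup.S, hS _ c.2.1 c.2.2⟩, ⟨c.1 modU, hU _ c.2.1 c.2.2⟩)) ⟨?_, ?_⟩)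
  · rintro ⟨c, hc⟩ ⟨c', hc'⟩ h
    rw [Prod.mk.injEq, Subtype.mk.injEq, Subtype.mk.injEq] at h
    exact Subtype.ext (modular_cocycle_ext hc.1 hc'.1 h.1 h.2)
  · rintro ⟨⟨s, hs⟩, ⟨u, hu⟩⟩
    obtain ⟨c, hc, rfl, rfl⟩ := exists_modular_cocycle hneg he hs hu
    refine ⟨⟨c, hc, ?_⟩, rfl⟩
    change c (-1) y₀ = e
    rw [← modS_sq, pow_two]
    exact (hc _ _ _).trans (hs y₀)

end ModularCocycle

/-! ### Counting functions with prescribed orbit sums. -/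

section OrbitCounting

universe v

variable {Y : Type v} {A : Type*} [AddCommGroup A]

theorem cyclicSum_smul {σ : Equiv.Perm Y} {p : ℕ} (hσ : σ ^ p = 1) (u : Y → A) (i : ℕ) (y : Y) :
    ∑ j ∈ Finset.range p, u ((σ ^ j) ((σ ^ i) y)) = ∑ j ∈ Finset.range p, u ((σ ^ j) y) := by
  induction i with
  | zero => rfl
  | succ i ih =>
    rw [← ih]
    set z := (σ ^ i) y
    have h1 : ∀ j, (σ ^ j) ((σ ^ (i + 1)) y) = (σ ^ (j + 1)) z := by
      intro j
      rw [← Equiv.Perm.mul_apply, ← Equiv.Perm.mul_apply, ← pow_add, ← pow_add]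
      congr 2
      ring
    simp_rw [h1]
    have h2 := Finset.sum_range_succ (fun j => u ((σ ^ j) z)) p
    have h3 := Finset.sum_range_succ' (fun j => u ((σ ^ j) z)) p
    rw [h3] at h2
    simp only [hσ, pow_zero] at h2
    exact add_right_cancel h2

/-- All entries but the first are free. -/
theorem card_sum_eq [Finite A] (p : ℕ) (e : A) :
    Nat.card {x : Fin (p + 1) → A // ∑ i, x i = e} = Nat.card A ^ p := by
  rw [← Nat.card_fin p, ← Nat.card_fun, Nat.card_fin p]
  refine Nat.card_congr ⟨fun x i => x.1 i.succ,
    fun y => ⟨Fin.cons (e - ∑ i, y i) y, by simp [Fin.sum_univ_succ]⟩, ?_, ?_⟩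
  · rintro ⟨x, hx⟩
    apply Subtype.ext
    rw [Fin.sum_univ_succ] at hx
    funext i
    refine Fin.cases ?_ (fun i => ?_) i
    · simp [← hx]
    · simp
  · intro y; simp

/-- The points of a permutation of prime order are fixed points or lie in free orbits. -/
theorem exists_orbit_equiv {σ : Equiv.Perm Y} {p : ℕ} (hp : p.Prime) (hσ : σ ^ p = 1) :
    ∃ (Q : Type v) (r : Q → Y) (φ : {y : Y // σ y = y} ⊕ (Q × Fin p) ≃ Y),
      (∀ y, φ (Sum.inl y) = y) ∧ ∀ q i, φ (Sum.inr (q, i)) = (σ ^ (i : ℕ)) (r q) := by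
  classical
  let Q₀ := Quotient (Equiv.Perm.SameCycle.setoid σ)
  have hpow : ∀ y, (σ ^ p) y = y := fun y => by rw [hσ]; rfl
  have hper : ∀ y, Function.IsPeriodicPt σ p y := fun y => by
    rw [Function.IsPeriodicPt, Function.IsFixedPt, ← Equiv.Perm.coe_pow]
    exact hpow y
  have hmin : ∀ y, σ y ≠ y → Function.minimalPeriod σ y = p := fun y hy =>
    ((Nat.dvd_prime hp).1 (hper y).minimalPeriod_dvd).resolve_left
      fun h => hy (Function.minimalPeriod_eq_one_iff_isFixedPt.1 h)
  have hfix : ∀ (i : ℕ) y, σ ((σ ^ i) y) = (σ ^ i) y ↔ σ y = y := fun i y => by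
    rw [← Equiv.Perm.mul_apply, ← pow_succ', pow_succ, Equiv.Perm.mul_apply,
      EmbeddingLike.apply_eq_iff_eq]
  have hout : ∀ y, ∃ i : Fin p, (σ ^ (i : ℕ)) (Quotient.out (Quotient.mk'' y : Q₀)) = y := by
    intro y
    have h1 : σ.SameCycle (Quotient.out (Quotient.mk'' y : Q₀)) y :=
      Quotient.exact (s := Equiv.Perm.SameCycle.setoid σ) (Quotient.out_eq (Quotient.mk'' y))
    obtain ⟨i, hi⟩ := h1
    have hp0 : (p : ℤ) ≠ 0 := by exact_mod_cast hp.ne_zero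
    refine ⟨⟨(i % p).toNat, ?_⟩, ?_⟩
    · have := Int.emod_lt_of_pos i (by positivity : (0 : ℤ) < p) |>.trans_le le_rfl
      have := Int.emod_nonneg i hp0
      omega
    · have h2 : σ ^ i = σ ^ (i % p) := by
        conv_lhs => rw [← Int.emod_add_mul_ediv i p, zpow_add, zpow_mul, zpow_natCast, hσ,
          one_zpow, mul_one]
      conv_rhs => rw [← hi, h2]
      rw [← zpow_natCast, Int.toNat_of_nonneg (Int.emod_nonneg i hp0)]
  let Q := {q : Q₀ // σ q.out ≠ q.out}
  let φ : {y : Y // σ y = y} ⊕ (Q × Fin p) → Y :=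
    Sum.elim Subtype.val fun x => (σ ^ (x.2 : ℕ)) x.1.1.out
  have hinj : Function.Injective φ := by
    rintro (⟨y, hy⟩ | ⟨⟨q, hq⟩, i⟩) (⟨y', hy'⟩ | ⟨⟨q', hq'⟩, i'⟩) h
    · exact congrArg Sum.inl (Subtype.ext h)
    · change y = (σ ^ (i' : ℕ)) q'.out at h
      rw [h, hfix] at hy
      exact absurd hy hq'
    · change (σ ^ (i : ℕ)) q.out = y' at h
      rw [← h, hfix] at hy'
      exact absurd hy' hq
    · change (σ ^ (i : ℕ)) q.out = (σ ^ (i' : ℕ)) q'.out at h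
      have hqq : q = q' := by
        rw [← Quotient.out_eq q, ← Quotient.out_eq q']
        refine Quotient.sound (?_ : σ.SameCycle _ _)
        refine ⟨(i : ℤ) - i', ?_⟩
        rw [sub_eq_neg_add, zpow_add, Equiv.Perm.mul_apply, zpow_natCast, h, zpow_neg, zpow_natCast,
          ← Equiv.Perm.mul_apply, inv_mul_cancel, Equiv.Perm.one_apply]
      subst hqq
      have h3 := Function.iterate_injOn_Iio_minimalPeriod (f := σ) (x := q.out)
        (show (i : ℕ) ∈ Set.Iio _ by rw [hmin _ hq]; exact i.2)
        (show (i' : ℕ) ∈ Set.Iio _ by rw [hmin _ hq]; exact i'.2)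
        (by simpa only [Equiv.Perm.coe_pow] using h)
      rw [Fin.ext h3]
  have hsurj : Function.Surjective φ := by
    intro y
    by_cases hy : σ y = y
    · exact ⟨Sum.inl ⟨y, hy⟩, rfl⟩
    · obtain ⟨i, hi⟩ := hout y
      refine ⟨Sum.inr (⟨Quotient.mk'' y, fun h => hy ?_⟩, i), hi⟩
      rw [← hi, hfix]
      exact h
  exact ⟨Q, fun q => q.1.out, Equiv.ofBijective φ ⟨hinj, hsurj⟩, fun _ => rfl, fun _ _ => rfl⟩

/-- The number of functions whose sums over the orbits of a permutation of prime order, counted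
with multiplicity, are all equal to `e`. -/
theorem card_cyclicSum_eq [Finite Y] [Finite A] {σ : Equiv.Perm Y} {p : ℕ} (hp : p.Prime)
    (hσ : σ ^ p = 1) (e : A) :
    ∃ o : ℕ, Nat.card Y = Nat.card {y // σ y = y} + p * o ∧
      Nat.card {u : Y → A // ∀ y, ∑ j ∈ Finset.range p, u ((σ ^ j) y) = e} =
        Nat.card A ^ ((p - 1) * o) * Nat.card {a : A // p • a = e} ^ Nat.card {y // σ y = y} := by
  classical
  obtain ⟨Q, r, φ, hφ₁, hφ₂⟩ := exists_orbit_equiv hp hσ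
  have : Finite ({y : Y // σ y = y} ⊕ (Q × Fin p)) := Finite.of_equiv _ φ.symm
  have : Finite (Q × Fin p) := Finite.of_injective
    (Sum.inr : _ → {y : Y // σ y = y} ⊕ (Q × Fin p)) Sum.inr_injective
  have : Finite Q := Finite.of_injective (fun q : Q => (q, (⟨0, hp.pos⟩ : Fin p)))
    fun _ _ h => congrArg Prod.fst h
  refine ⟨Nat.card Q, ?_, ?_⟩
  · rw [← Nat.card_congr φ, Nat.card_sum, Nat.card_prod, Nat.card_fin, mul_comm p]
  · obtain ⟨p', rfl⟩ := Nat.exists_eq_succ_of_ne_zero hp.ne_zero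
    have hfixpow : ∀ y, σ y = y → ∀ j : ℕ, (σ ^ j) y = y := fun y hy j => by
      rw [Equiv.Perm.coe_pow]; exact Function.iterate_fixed hy j
    -- The cyclic sum is constant on orbits: a free orbit gives one equation on its values, while at
    -- a fixed point the sum is a multiple of a single value.
    have hcond : ∀ u : Y → A, (∀ y, ∑ j ∈ Finset.range (p' + 1), u ((σ ^ j) y) = e) ↔
        (∀ y : {y // σ y = y}, (p' + 1) • u y = e) ∧
          ∀ q, ∑ i : Fin (p' + 1), u (φ (Sum.inr (q, i))) = e := by
      intro u
      constructor
      · refine fun h => ⟨fun y => ?_, fun q => ?_⟩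
        · rw [← h y]
          simp [hfixpow _ y.2]
        · rw [← h (r q), Finset.sum_range]
          simp [hφ₂]
      · rintro ⟨h1, h2⟩ y
        obtain ⟨(z | ⟨q, i⟩), rfl⟩ := φ.surjective y
        · rw [hφ₁, ← h1 z]
          simp [hfixpow _ z.2]
        · rw [hφ₂, cyclicSum_smul hσ, ← h2 q, Finset.sum_range]
          simp [hφ₂]
    have hφφ : ∀ y : {y // σ y = y}, φ.symm y = Sum.inl y := fun y => by
      rw [← hφ₁ y, φ.symm_apply_apply]
    have E : {u : Y → A // ∀ y, ∑ j ∈ Finset.range (p' + 1), u ((σ ^ j) y) = e} ≃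
        ({y : Y // σ y = y} → {a : A // (p' + 1) • a = e}) ×
          (Q → {x : Fin (p' + 1) → A // ∑ i, x i = e}) :=
      { toFun := fun u => (fun y => ⟨u.1 y, ((hcond u.1).1 u.2).1 y⟩,
          fun q => ⟨fun i => u.1 (φ (Sum.inr (q, i))), ((hcond u.1).1 u.2).2 q⟩)
        invFun := fun w => ⟨fun y => Sum.elim (fun z => (w.1 z).1) (fun x => (w.2 x.1).1 x.2)
          (φ.symm y), (hcond fun y => Sum.elim (fun z => (w.1 z).1) (fun x => (w.2 x.1).1 x.2)
          (φ.symm y)).2 ⟨fun y => by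
            rw [hφφ]; exact (w.1 y).2, fun q => by
            simpa using (w.2 q).2⟩⟩
        left_inv := by
          rintro ⟨u, hu⟩
          apply Subtype.ext
          funext y
          obtain ⟨(z | ⟨q, i⟩), rfl⟩ := φ.surjective y
          · simp [hφ₁, hφφ]
          · simp
        right_inv := by
          rintro ⟨f, g⟩
          refine Prod.ext (funext fun y => Subtype.ext ?_)
            (funext fun q => Subtype.ext (funext fun i => ?_))
          · change Sum.elim _ _ (φ.symm y) = _
            rw [hφφ]; rfl
          · simp }
    rw [Nat.card_congr E, Nat.card_prod, Nat.card_fun, Nat.card_fun, card_sum_eq, ← pow_mul,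
      mul_comm]
    rfl

theorem ZMod.card_nsmul_eq_zero (j k : ℕ) [NeZero k] :
    Nat.card {a : ZMod k // j • a = 0} = Nat.gcd k j := by
  have h := IsAddCyclic.card_nsmulAddMonoidHom_ker (G := ZMod k) j
  rwa [Nat.card_zmod] at h

end OrbitCounting

/-! ### The number of unimodular pairs modulo m. -/

section UnimodularCount

/-- The number of unimodular pairs over `ℤ/m`. -/
noncomputable def unimodularCount (m : ℕ) : ℕ :=
  Nat.card {v : ZMod m × ZMod m // IsCoprime v.1 v.2}

theorem card_isCoprime_congr {R R' : Type*} [CommRing R] [CommRing R'] (f : R ≃+* R') :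
    Nat.card {v : R × R // IsCoprime v.1 v.2} = Nat.card {v : R' × R' // IsCoprime v.1 v.2} :=
  Nat.card_congr <| (f.toEquiv.prodCongr f.toEquiv).subtypeEquiv fun v =>
    ⟨fun h => h.map f.toRingHom, fun h => by simpa using h.map f.symm.toRingHom⟩

theorem card_isCoprime_prod (R R' : Type*) [CommRing R] [CommRing R'] :
    Nat.card {v : (R × R') × (R × R') // IsCoprime v.1 v.2} =
      Nat.card {v : R × R // IsCoprime v.1 v.2} * Nat.card {v : R' × R' // IsCoprime v.1 v.2} := by
  rw [← Nat.card_prod]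
  refine Nat.card_congr (((Equiv.prodProdProdComm R R' R R').subtypeEquiv
    (q := fun w => IsCoprime w.1.1 w.1.2 ∧ IsCoprime w.2.1 w.2.2) ?_).trans
    (Equiv.subtypeProdEquivProd (p := fun v : R × R => IsCoprime v.1 v.2)
      (q := fun v : R' × R' => IsCoprime v.1 v.2)))
  rintro ⟨⟨a, a'⟩, ⟨b, b'⟩⟩
  constructor
  · exact fun h => ⟨h.map (RingHom.fst R R'), h.map (RingHom.snd R R')⟩
  · rintro ⟨⟨u, v, h⟩, ⟨u', v', h'⟩⟩
    exact ⟨(u, u'), (v, v'), Prod.ext h h'⟩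

theorem unimodularCount_mul {a b : ℕ} (h : a.Coprime b) :
    unimodularCount (a * b) = unimodularCount a * unimodularCount b := by
  rw [unimodularCount, card_isCoprime_congr (ZMod.chineseRemainder h), card_isCoprime_prod]
  rfl

/-- The ring is local: all non-units are multiples of p. -/
theorem isCoprime_zmod_prime_pow {p k : ℕ} (hp : p.Prime) (hk : 0 < k) (a b : ZMod (p ^ k)) :
    IsCoprime a b ↔ ¬(¬IsUnit a ∧ ¬IsUnit b) := by
  have : NeZero (p ^ k) := ⟨pow_ne_zero _ hp.ne_zero⟩
  have hdvd : ∀ a : ZMod (p ^ k), ¬IsUnit a → (p : ZMod (p ^ k)) ∣ a := by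
    intro a ha
    rw [← ZMod.natCast_zmod_val a, ZMod.isUnit_iff_coprime, Nat.coprime_pow_right_iff hk,
      Nat.coprime_comm, hp.coprime_iff_not_dvd, not_not] at ha
    obtain ⟨c, hc⟩ := ha
    exact ⟨c, by rw [← ZMod.natCast_zmod_val a, hc]; push_cast; rfl⟩
  constructor
  · rintro ⟨u, v, h⟩ ⟨ha, hb⟩
    have h1 : (p : ZMod (p ^ k)) ∣ 1 := by
      rw [← h]
      exact dvd_add ((hdvd a ha).mul_left _) ((hdvd b hb).mul_left _)
    exact (ZMod.isUnit_prime_iff_not_dvd hp).1 (isUnit_of_dvd_one h1) (dvd_pow_self p hk.ne')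
  · intro h
    by_cases ha : IsUnit a
    · obtain ⟨u, hu⟩ := ha.exists_left_inv
      exact ⟨u, 0, by rw [hu, zero_mul, add_zero]⟩
    · obtain ⟨u, hu⟩ := (by_contra fun hb => h ⟨ha, hb⟩ : IsUnit b).exists_left_inv
      exact ⟨0, u, by rw [hu, zero_mul, zero_add]⟩

/-- The pairs to be excluded consist of two non-units, of which there are p^(k-1). -/
theorem unimodularCount_prime_pow {p k : ℕ} (hp : p.Prime) (hk : 0 < k) :
    (unimodularCount (p ^ k) : ℚ) = ((p ^ k : ℕ) : ℚ) ^ 2 * (1 - 1 / (p : ℚ) ^ 2) := by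
  classical
  have : NeZero (p ^ k) := ⟨pow_ne_zero _ hp.ne_zero⟩
  have h1 : Fintype.card {a : ZMod (p ^ k) // ¬IsUnit a} = p ^ (k - 1) := by
    have h2 : Fintype.card {a : ZMod (p ^ k) // IsUnit a} = Nat.totient (p ^ k) := by
      rw [← ZMod.card_units_eq_totient]
      exact (Fintype.card_congr (Equiv.ofBijective
        (fun u : (ZMod (p ^ k))ˣ => (⟨u, u.isUnit⟩ : {a : ZMod (p ^ k) // IsUnit a}))
        ⟨fun u v h => Units.ext (congrArg Subtype.val h), fun ⟨_, u, hu⟩ =>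
          ⟨u, Subtype.ext hu⟩⟩)).symm
    rw [Fintype.card_subtype_compl, h2, ZMod.card, Nat.totient_prime_pow hp hk]
    obtain ⟨k, rfl⟩ := Nat.exists_eq_succ_of_ne_zero hk.ne'
    obtain ⟨q, hq⟩ := Nat.exists_eq_succ_of_ne_zero hp.ne_zero
    rw [hq]
    simp only [Nat.succ_eq_add_one, Nat.add_sub_cancel, pow_succ]
    rw [Nat.mul_add, Nat.add_sub_cancel_left, mul_one]
  have h2 : unimodularCount (p ^ k) = (p ^ k) ^ 2 - (p ^ (k - 1)) ^ 2 := by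
    rw [unimodularCount, Nat.card_congr (Equiv.subtypeEquivRight
      fun v : ZMod (p ^ k) × ZMod (p ^ k) => isCoprime_zmod_prime_pow hp hk v.1 v.2),
      Nat.card_eq_fintype_card,
      Fintype.card_subtype_compl, Fintype.card_prod, ZMod.card, ← pow_two]
    congr 1
    rw [← h1, pow_two, ← Fintype.card_prod]
    exact Fintype.card_congr (Equiv.subtypeProdEquivProd (p := fun a : ZMod (p ^ k) => ¬IsUnit a)
      (q := fun a : ZMod (p ^ k) => ¬IsUnit a))
  rw [h2, Nat.cast_sub (Nat.pow_le_pow_left (Nat.pow_le_pow_right hp.pos (Nat.sub_le _ _)) _)]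
  obtain ⟨k, rfl⟩ := Nat.exists_eq_succ_of_ne_zero hk.ne'
  have : (p : ℚ) ≠ 0 := by exact_mod_cast hp.ne_zero
  push_cast
  simp only [Nat.succ_eq_add_one, pow_succ]
  field_simp

theorem unimodularCount_eq {m : ℕ} (hm : m ≠ 0) :
    (unimodularCount m : ℚ) = (m : ℚ) ^ 2 * ∏ p ∈ m.primeFactors, (1 - 1 / (p : ℚ) ^ 2) := by
  induction m using Nat.recOnPosPrimePosCoprime with
  | prime_pow p k hp hk =>
    rw [unimodularCount_prime_pow hp hk, Nat.primeFactors_prime_pow hk.ne' hp,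
      Finset.prod_singleton]
  | zero => exact absurd rfl hm
  | one =>
    have : unimodularCount 1 = 1 := by
      rw [unimodularCount, Nat.card_eq_one_iff_unique]
      exact ⟨inferInstance, ⟨⟨0, 0⟩, 0, 0, Subsingleton.elim _ _⟩⟩
    simp [this]
  | coprime a b ha hb hab iha ihb =>
    rw [unimodularCount_mul hab, Nat.cast_mul, iha (by omega), ihb (by omega),
      hab.primeFactors_mul, Finset.prod_union hab.disjoint_primeFactors]
    push_cast
    ring

end UnimodularCount

/-! ### The index of the congruence group. -/

section GammaPairIndex

open MatrixGroups

theorem index_eq_card_range {G X : Type*} [Group G] {H : Subgroup G} {f : G → X}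
    (hf : ∀ a b, f a = f b ↔ a⁻¹ * b ∈ H) : H.index = Nat.card (Set.range f) := by
  refine Nat.card_congr (Equiv.ofBijective
    (Quotient.lift (fun g => (⟨f g, g, rfl⟩ : Set.range f)) fun a b h =>
      Subtype.ext ((hf a b).2 (QuotientGroup.leftRel_apply.1 h))) ⟨?_, ?_⟩)
  · rintro ⟨a⟩ ⟨b⟩ h
    exact QuotientGroup.eq.2 ((hf a b).1 (congrArg Subtype.val h))
  · rintro ⟨_, g, rfl⟩
    exact ⟨QuotientGroup.mk g, rfl⟩

/-- For n = 1 only the first row modulo m is constrained. Left cosets correspond to the first row of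
the inverse, and every unimodular pair occurs by lifting it to a coprime pair and completing the
matrix. -/
theorem index_gammaPair_one {m : ℕ} (hm : m ≠ 0) :
    (gammaPair m 1).index = unimodularCount m := by
  let f : SL(2, ℤ) → ZMod m × ZMod m := fun A => ((A⁻¹ 0 0 : ℤ), (A⁻¹ 0 1 : ℤ))
  have hf : ∀ a b, f a = f b ↔ a⁻¹ * b ∈ gammaPair m 1 := by
    intro a b
    obtain ⟨x, rfl⟩ : ∃ x, x⁻¹ = a := ⟨a⁻¹, inv_inv a⟩
    obtain ⟨y, rfl⟩ : ∃ y, y⁻¹ = b := ⟨b⁻¹, inv_inv b⟩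
    obtain ⟨z, rfl⟩ : ∃ z, z * y = x := ⟨x * y⁻¹, by simp⟩
    simp only [f, inv_inv, Prod.mk.injEq, mul_inv_cancel_right]
    rw [ZMod.intCast_eq_intCast_iff_dvd_sub, ZMod.intCast_eq_intCast_iff_dvd_sub, mem_gammaPair,
      sl2_mul_apply, sl2_mul_apply]
    have hdet := y.det_coe
    rw [Matrix.det_fin_two] at hdet
    constructor
    · rintro ⟨⟨s, hs⟩, ⟨t, ht⟩⟩
      refine ⟨⟨-(s * y 1 1 - t * y 1 0), ?_⟩, ⟨-(t * y 0 0 - s * y 0 1), ?_⟩, by simp, by simp⟩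
      · linear_combination (-y 1 1) * hs + y 1 0 * ht + (1 - z 0 0) * hdet
      · linear_combination (-y 0 0) * ht + y 0 1 * hs - z 0 1 * hdet
    · rintro ⟨⟨s, hs⟩, ⟨t, ht⟩, -, -⟩
      exact ⟨⟨-(s * y 0 0 + t * y 1 0), by linear_combination (-y 0 0) * hs - y 1 0 * ht⟩,
        ⟨-(s * y 0 1 + t * y 1 1), by linear_combination (-y 0 1) * hs - y 1 1 * ht⟩⟩
  rw [index_eq_card_range hf, unimodularCount]
  congr 1
  suffices Set.range f = {v | IsCoprime v.1 v.2} by rw [this]; rfl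
  ext ⟨a, b⟩
  constructor
  · rintro ⟨A, hA⟩
    rw [← hA]
    have hdet := (A⁻¹).det_coe
    rw [Matrix.det_fin_two] at hdet
    refine ⟨(A⁻¹ 1 1 : ℤ), (-A⁻¹ 1 0 : ℤ), ?_⟩
    change ((A⁻¹ 1 1 : ℤ) : ZMod m) * (A⁻¹ 0 0 : ℤ) + ((-A⁻¹ 1 0 : ℤ) : ZMod m) * (A⁻¹ 0 1 : ℤ) = 1
    have h1 := congrArg (Int.cast (R := ZMod m)) hdet
    push_cast at h1 ⊢
    linear_combination h1
  · rintro ⟨u, v, h⟩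
    obtain ⟨a, rfl⟩ := ZMod.intCast_surjective a
    obtain ⟨b, rfl⟩ := ZMod.intCast_surjective b
    obtain ⟨u, rfl⟩ := ZMod.intCast_surjective u
    obtain ⟨v, rfl⟩ := ZMod.intCast_surjective v
    have h1 : (m : ℤ) ∣ a * u + b * v - 1 := by
      rw [← ZMod.intCast_eq_intCast_iff_dvd_sub]
      push_cast
      linear_combination -h
    obtain ⟨a', b', ha', hb', hab⟩ := exists_isCoprime_lift hm h1
    obtain ⟨M, hM⟩ := hab.exists_SL2_row 0
    refine ⟨M⁻¹, ?_⟩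
    simp only [f, inv_inv]
    rw [hM.1, hM.2, (ZMod.intCast_eq_intCast_iff_dvd_sub _ _ _).2 ha',
      (ZMod.intCast_eq_intCast_iff_dvd_sub _ _ _).2 hb']

/-- Elements of `gammaPair m 1` are lower unitriangular modulo n, so their lower left entry is a
homomorphism onto ℤ/n, with kernel `gammaPair m n`. -/
theorem index_gammaPair {m n : ℕ} (hm : m ≠ 0) (hnm : n ∣ m) :
    (gammaPair m n).index = n * unimodularCount m := by
  have hle : gammaPair m n ≤ gammaPair m 1 := fun A hA => ⟨hA.1, hA.2.1, by simp, by simp⟩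
  rw [← Subgroup.relIndex_mul_index hle, index_gammaPair_one hm]
  congr 1
  have hnm' : (n : ℤ) ∣ m := by exact_mod_cast hnm
  have hd : ∀ A ∈ gammaPair m 1, (m : ℤ) ∣ A 1 1 - 1 := by
    rintro A ⟨⟨a, ha⟩, ⟨b, hb⟩, -, -⟩
    have hdet := A.det_coe
    rw [Matrix.det_fin_two] at hdet
    exact ⟨b * A 1 0 - a * A 1 1, by linear_combination hdet + A 1 0 * hb - A 1 1 * ha⟩
  let f : gammaPair m 1 →* Multiplicative (ZMod n) := MonoidHom.mk'
    (fun A => Multiplicative.ofAdd ((A.1 1 0 : ℤ) : ZMod n)) (by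
      rintro ⟨A, hA⟩ ⟨B, hB⟩
      apply congrArg Multiplicative.ofAdd
      change (((A * B : SL(2, ℤ)) 1 0 : ℤ) : ZMod n) = (A 1 0 : ℤ) + (B 1 0 : ℤ)
      rw [sl2_mul_apply, ← Int.cast_add, ZMod.intCast_eq_intCast_iff_dvd_sub]
      obtain ⟨s, hs⟩ := hnm'.trans hB.1
      obtain ⟨t, ht⟩ := hnm'.trans (hd A hA)
      exact ⟨-(A 1 0 * s + B 1 0 * t), by linear_combination (-A 1 0) * hs - B 1 0 * ht⟩)
  have hker : (gammaPair m n).subgroupOf (gammaPair m 1) = f.ker := by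
    ext ⟨A, hA⟩
    rw [Subgroup.mem_subgroupOf, MonoidHom.mem_ker]
    have h1 : f ⟨A, hA⟩ = 1 ↔ (n : ℤ) ∣ A 1 0 := (ZMod.intCast_zmod_eq_zero_iff_dvd _ _)
    rw [h1]
    exact ⟨fun h => h.2.2.1, fun h => ⟨hA.1, hA.2.1, h, hnm'.trans (hd A hA)⟩⟩
  have hsurj : Function.Surjective f := by
    intro x
    obtain ⟨c, hc⟩ := ZMod.intCast_surjective x.toAdd
    obtain ⟨A, hA⟩ : ∃ A : SL(2, ℤ), (A : Matrix (Fin 2) (Fin 2) ℤ) = !![1, 0; c, 1] :=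
      ⟨⟨_, by rw [Matrix.det_fin_two_of]; ring⟩, rfl⟩
    refine ⟨⟨A, ?_⟩, ?_⟩
    · rw [mem_gammaPair, hA]; simp
    · change Multiplicative.ofAdd ((A 1 0 : ℤ) : ZMod n) = x
      rw [hA]
      exact congrArg Multiplicative.ofAdd hc
  rw [Subgroup.relIndex, hker, Subgroup.index_ker, MonoidHom.range_eq_top.2 hsurj]
  have := Nat.card_congr (Subgroup.topEquiv (G := Multiplicative (ZMod n))).toEquiv
  rw [this, Nat.card_congr Multiplicative.toAdd, Nat.card_zmod]

theorem unimodularCount_ne_zero {m : ℕ} (hm : m ≠ 0) : unimodularCount m ≠ 0 := by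
  have : NeZero m := ⟨hm⟩
  rw [unimodularCount]
  exact (Nat.card_pos_iff.2 ⟨⟨⟨(1, 0), isCoprime_one_left⟩⟩, inferInstance⟩).ne'

end GammaPairIndex

/-! ### Adjoining -1, and fixed points on the quotient. -/

section SignedSubgroup

open MatrixGroups

/-- The subgroup generated by `Γ` and `-1`. -/
def signedSubgroup (Γ : Subgroup SL(2, ℤ)) : Subgroup SL(2, ℤ) where
  carrier := {A | A ∈ Γ ∨ -A ∈ Γ}
  one_mem' := Or.inl Γ.one_mem
  mul_mem' {A B} hA hB := by
    rcases hA with hA | hA <;> rcases hB with hB | hB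
    · exact Or.inl (Γ.mul_mem hA hB)
    · exact Or.inr (by rw [← mul_neg]; exact Γ.mul_mem hA hB)
    · exact Or.inr (by rw [← neg_mul]; exact Γ.mul_mem hA hB)
    · exact Or.inl (by rw [← neg_mul_neg]; exact Γ.mul_mem hA hB)
  inv_mem' {A} hA := by
    rcases hA with hA | hA
    · exact Or.inl (Γ.inv_mem hA)
    · exact Or.inr (by rw [← inv_neg]; exact Γ.inv_mem hA)

variable {Γ : Subgroup SL(2, ℤ)}

theorem mem_signedSubgroup {A : SL(2, ℤ)} : A ∈ signedSubgroup Γ ↔ A ∈ Γ ∨ -A ∈ Γ := Iff.rfl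

theorem neg_mem_signedSubgroup {A : SL(2, ℤ)} : -A ∈ signedSubgroup Γ ↔ A ∈ signedSubgroup Γ := by
  rw [mem_signedSubgroup, mem_signedSubgroup, neg_neg, or_comm]

theorem neg_mem_of_neg_one_mem (h : -1 ∈ Γ) {A : SL(2, ℤ)} (hA : A ∈ Γ) : -A ∈ Γ := by
  rw [← neg_one_mul]
  exact Γ.mul_mem h hA

theorem signedSubgroup_eq_self (h : -1 ∈ Γ) : signedSubgroup Γ = Γ := by
  ext A
  refine ⟨fun hA => hA.elim id fun hA => ?_, Or.inl⟩
  rw [← neg_neg A]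
  exact neg_mem_of_neg_one_mem h hA

theorem not_mem_of_neg_mem (h : -1 ∉ Γ) {A : SL(2, ℤ)} (hA : -A ∈ Γ) : A ∉ Γ := fun hA' => h <| by
  have := Γ.mul_mem hA (Γ.inv_mem hA')
  rwa [neg_mul, mul_inv_cancel] at this

theorem index_eq_two_mul_index_signedSubgroup (h : -1 ∉ Γ) :
    Γ.index = 2 * (signedSubgroup Γ).index := by
  have hle : Γ ≤ signedSubgroup Γ := fun A hA => Or.inl hA
  rw [← Subgroup.relIndex_mul_index hle]
  congr 1
  rw [Subgroup.relIndex, Subgroup.index_eq_two_iff]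
  refine ⟨⟨-1, Or.inr (by rw [neg_neg]; exact Γ.one_mem)⟩, ?_⟩
  rintro ⟨A, hA⟩
  rw [Subgroup.mem_subgroupOf, Subgroup.mem_subgroupOf]
  change Xor (A * -1 ∈ Γ) (A ∈ Γ)
  rw [mul_neg_one]
  rcases hA with hA | hA
  · exact Or.inr ⟨hA, fun h' => not_mem_of_neg_mem h h' hA⟩
  · exact Or.inl ⟨hA, not_mem_of_neg_mem h hA⟩

open scoped Classical in
/-- If `-1 ∉ Γ`, the homomorphisms on `Γ` are the homomorphisms on `±Γ` that vanish at `-1`. -/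
theorem card_hom_signedSubgroup {B : Type*} [CommGroup B] (h : -1 ∉ Γ)
    (z : signedSubgroup Γ) (hz : (z : SL(2, ℤ)) = -1) :
    Nat.card {b : signedSubgroup Γ →* B // b z = 1} = Nat.card (Γ →* B) := by
  have hle : Γ ≤ signedSubgroup Γ := fun A hA => Or.inl hA
  let r : signedSubgroup Γ →* Γ := MonoidHom.mk'
    (fun A => if hA : (A : SL(2, ℤ)) ∈ Γ then ⟨A, hA⟩ else ⟨-A, A.2.resolve_left hA⟩) (by
      rintro ⟨A, hA⟩ ⟨B, hB⟩
      apply Subtype.ext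
      rcases hA with hA | hA <;> rcases hB with hB | hB
      · simp [hA, hB, Γ.mul_mem hA hB]
      · have : -(A * B) ∈ Γ := by rw [← mul_neg]; exact Γ.mul_mem hA hB
        simp [hA, not_mem_of_neg_mem h hB, not_mem_of_neg_mem h this]
      · have : -(A * B) ∈ Γ := by rw [← neg_mul]; exact Γ.mul_mem hA hB
        simp [hB, not_mem_of_neg_mem h hA, not_mem_of_neg_mem h this]
      · have : A * B ∈ Γ := by rw [← neg_mul_neg]; exact Γ.mul_mem hA hB
        simp [not_mem_of_neg_mem h hA, not_mem_of_neg_mem h hB, this])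
  have hr : ∀ A : Γ, r (Subgroup.inclusion hle A) = A := by
    intro A
    change dite _ _ _ = _
    exact dif_pos A.2
  refine Nat.card_congr ⟨fun b => b.1.comp (Subgroup.inclusion hle),
    fun a => ⟨a.comp r, ?_⟩, ?_, fun a => MonoidHom.ext fun A => congrArg a (hr A)⟩
  · have : r z = 1 := by
      apply Subtype.ext
      change ((dite _ _ _ : Γ) : SL(2, ℤ)) = 1
      rw [dif_neg (by rw [hz]; exact h)]
      change -(z : SL(2, ℤ)) = 1
      rw [hz, neg_neg]
    rw [MonoidHom.comp_apply, this, map_one]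
  · rintro ⟨b, hb⟩
    apply Subtype.ext
    ext A
    change b (Subgroup.inclusion hle (r A)) = b A
    by_cases hA : (A : SL(2, ℤ)) ∈ Γ
    · congr 1
      apply Subtype.ext
      change ((dite _ _ _ : Γ) : SL(2, ℤ)) = A
      rw [dif_pos hA]
    · have : Subgroup.inclusion hle (r A) = z * A := by
        apply Subtype.ext
        change ((dite _ _ _ : Γ) : SL(2, ℤ)) = z * A
        rw [dif_neg hA, hz, neg_one_mul]
      rw [this, map_mul, hb, one_mul]

variable (Γ) in
/-- The quotient of `SL₂(ℤ)` by `±Γ`. -/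
abbrev SignedQuotient : Type := SL(2, ℤ) ⧸ signedSubgroup Γ

theorem neg_one_smul_signedQuotient (y : SignedQuotient Γ) : (-1 : SL(2, ℤ)) • y = y := by
  obtain ⟨g, rfl⟩ := QuotientGroup.mk_surjective y
  change QuotientGroup.mk (-1 * g) = _
  rw [QuotientGroup.eq, neg_one_mul, inv_neg, neg_mul, inv_mul_cancel, neg_mem_signedSubgroup]
  exact one_mem _

theorem smul_mk_eq_iff {H : Subgroup SL(2, ℤ)} (g x : SL(2, ℤ)) :
    g • (QuotientGroup.mk x : SL(2, ℤ) ⧸ H) = QuotientGroup.mk x ↔ x⁻¹ * g * x ∈ H := by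
  change QuotientGroup.mk (g * x) = _ ↔ _
  rw [eq_comm, QuotientGroup.eq, mul_assoc]

theorem trace_conj (g x : SL(2, ℤ)) :
    (x⁻¹ * g * x) 0 0 + (x⁻¹ * g * x) 1 1 = g 0 0 + g 1 1 := by
  have h : Matrix.trace ((x⁻¹ * g * x : SL(2, ℤ)) : Matrix (Fin 2) (Fin 2) ℤ) =
      Matrix.trace (g : Matrix (Fin 2) (Fin 2) ℤ) := by
    rw [show x⁻¹ * g * x = x⁻¹ * (g * x) from mul_assoc _ _ _, Matrix.SpecialLinearGroup.coe_mul,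
      Matrix.trace_mul_comm, ← Matrix.SpecialLinearGroup.coe_mul, mul_assoc, mul_inv_cancel,
      mul_one]
  simpa [Matrix.trace_fin_two] using h

/-- With diagonal entries 1 + ma and 1 + nd and off-diagonal entries mb and nc, the determinant
equation reads ma + nd = mn(bc - ad). -/
theorem dvd_trace_of_mem_gammaPair {m n : ℕ} {A : SL(2, ℤ)} (hA : A ∈ gammaPair m n) :
    (m * n : ℤ) ∣ A 0 0 + A 1 1 - 2 := by
  obtain ⟨⟨a, ha⟩, ⟨b, hb⟩, ⟨c, hc⟩, ⟨d, hd⟩⟩ := hA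
  have hdet := A.det_coe
  rw [Matrix.det_fin_two] at hdet
  refine ⟨b * c - a * d, ?_⟩
  linear_combination hdet + A 1 0 * hb + m * b * hc - (A 1 1 - 1) * ha - m * a * hd

/-- An element whose trace is not `±2` modulo `mn` acts freely on the quotient. -/
theorem smul_ne_of_trace {m n : ℕ} {g : SL(2, ℤ)}
    (h1 : ¬(m * n : ℤ) ∣ g 0 0 + g 1 1 - 2) (h2 : ¬(m * n : ℤ) ∣ g 0 0 + g 1 1 + 2)
    (y : SignedQuotient (gammaPair m n)) : g • y ≠ y := by
  obtain ⟨x, rfl⟩ := QuotientGroup.mk_surjective y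
  rw [Ne, smul_mk_eq_iff]
  rintro (h | h)
  · have := dvd_trace_of_mem_gammaPair h
    rw [trace_conj] at this
    exact h1 this
  · obtain ⟨t, ht⟩ := dvd_trace_of_mem_gammaPair h
    have h3 := trace_conj g x
    change -((x⁻¹ * g * x) 0 0) + -((x⁻¹ * g * x) 1 1) - 2 = _ at ht
    exact h2 ⟨-t, by linear_combination -ht - h3⟩

end SignedSubgroup

/-! ### Counting homomorphisms from the congruence groups to ℤ/k. -/

section HomCounting

open MatrixGroups

variable {Γ : Subgroup SL(2, ℤ)}

theorem neg_one_mem_signedSubgroup (Γ : Subgroup SL(2, ℤ)) : -1 ∈ signedSubgroup Γ :=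
  neg_mem_signedSubgroup.2 (one_mem _)

/-- The number of homomorphisms on `±Γ` with prescribed value at `-1`, in terms of the fixed points
of the two elliptic generators. -/
theorem card_signedSubgroup_hom [Finite (SignedQuotient Γ)] {A : Type*} [AddCommGroup A] [Finite A]
    {e : A} (he : 2 • e = 0) :
    ∃ o₂ o₃ : ℕ,
      Nat.card (SignedQuotient Γ) =
        Nat.card {y : SignedQuotient Γ // ModularGroup.S • y = y} + 2 * o₂ ∧
      Nat.card (SignedQuotient Γ) = Nat.card {y : SignedQuotient Γ // modU • y = y} + 3 * o₃ ∧
      Nat.card {b : signedSubgroup Γ →* Multiplicative A //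
          b ⟨-1, neg_one_mem_signedSubgroup Γ⟩ = Multiplicative.ofAdd e} *
          Nat.card A ^ (Nat.card (SignedQuotient Γ) - 1) =
        (Nat.card A ^ o₂ * Nat.card {a : A // 2 • a = e} ^
          Nat.card {y : SignedQuotient Γ // ModularGroup.S • y = y}) *
        (Nat.card A ^ (2 * o₃) * Nat.card {a : A // 3 • a = e} ^
          Nat.card {y : SignedQuotient Γ // modU • y = y}) := by
  have hneg := neg_one_smul_signedQuotient (Γ := Γ)
  have hS : (MulAction.toPerm ModularGroup.S : Equiv.Perm (SignedQuotient Γ)) ^ 2 = 1 := by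
    ext1 y
    change ModularGroup.S • ModularGroup.S • y = y
    rw [smul_smul, ← pow_two, modS_sq, hneg]
  have hU : (MulAction.toPerm modU : Equiv.Perm (SignedQuotient Γ)) ^ 3 = 1 := by
    ext1 y
    change modU • modU • modU • y = y
    rw [smul_smul, smul_smul, ← pow_two, ← pow_succ, modU_cube, hneg]
  obtain ⟨o₂, h₂, c₂⟩ := card_cyclicSum_eq (A := A) Nat.prime_two hS e
  obtain ⟨o₃, h₃, c₃⟩ := card_cyclicSum_eq (A := A) Nat.prime_three hU e
  refine ⟨o₂, o₃, h₂, h₃, ?_⟩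
  have h := card_stabilizer_hom_mul hneg (QuotientGroup.mk 1) he
  have key : ∀ (H K : Subgroup SL(2, ℤ)) (hH : -1 ∈ H) (hK : -1 ∈ K), H = K →
      Nat.card {b : H →* Multiplicative A // b ⟨-1, hH⟩ = Multiplicative.ofAdd e} =
        Nat.card {b : K →* Multiplicative A // b ⟨-1, hK⟩ = Multiplicative.ofAdd e} := by
    rintro H _ hH hK rfl
    rfl
  have hst := key (MulAction.stabilizer SL(2, ℤ) (QuotientGroup.mk 1 : SignedQuotient Γ)) _ (hneg _)
    (neg_one_mem_signedSubgroup Γ) (MulAction.stabilizer_quotient _)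
  rw [hst] at h
  rw [h]
  have d₂ : Nat.card {s : SignedQuotient Γ → A // ∀ y, s (ModularGroup.S • y) + s y = e} = _ :=
    (Nat.card_congr (Equiv.subtypeEquivRight fun s => forall_congr' fun y => by
      rw [Finset.sum_range_succ, Finset.sum_range_one, add_comm]; rfl)).trans c₂
  have d₃ : Nat.card {u : SignedQuotient Γ → A //
      ∀ y, u (modU ^ 2 • y) + u (modU • y) + u y = e} = _ :=
    (Nat.card_congr (Equiv.subtypeEquivRight fun s => forall_congr' fun y => by
      rw [Finset.sum_range_succ, Finset.sum_range_succ, Finset.sum_range_one, pow_two, mul_smul,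
        add_comm, add_comm (s (modU • modU • y)), ← add_assoc]
      rfl)).trans c₃
  rw [d₂, d₃, show (2 - 1) * o₂ = o₂ from one_mul _]
  rfl

theorem finite_signedQuotient {m n : ℕ} (hm : m ≠ 0) (hn : n ≠ 0) (hnm : n ∣ m) :
    Finite (SignedQuotient (gammaPair m n)) := by
  have h1 : (gammaPair m n).index ≠ 0 := by
    rw [index_gammaPair hm hnm]
    exact mul_ne_zero hn (unimodularCount_ne_zero hm)
  have : (signedSubgroup (gammaPair m n)).index ≠ 0 := fun h =>
    h1 (Nat.eq_zero_of_zero_dvd (h ▸ Subgroup.index_dvd_of_le fun A hA => Or.inl hA))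
  have : (signedSubgroup (gammaPair m n)).FiniteIndex := ⟨this⟩
  exact Subgroup.finite_quotient_of_finiteIndex

theorem modU_apply_zero_zero : modU 0 0 = 0 := by decide

theorem modU_trace : modU 0 0 + modU 1 1 = 1 := by decide

theorem modS_trace : ModularGroup.S 0 0 + ModularGroup.S 1 1 = 0 := by decide

theorem modS_smul_ne {m n : ℕ} (h : 2 < m * n) (y : SignedQuotient (gammaPair m n)) :
    ModularGroup.S • y ≠ y := by
  refine smul_ne_of_trace ?_ ?_ y <;> rw [modS_trace] <;> intro hd <;>
    have h2 := Nat.le_of_dvd (by norm_num) (Int.natAbs_dvd_natAbs.2 hd) <;>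
    norm_num [Int.natAbs_mul] at h2 <;> omega

theorem modU_smul_ne {m n : ℕ} (h : 1 < m * n) (h3 : m * n ≠ 3)
    (y : SignedQuotient (gammaPair m n)) : modU • y ≠ y := by
  have hnat : ∀ z : ℤ, (m * n : ℤ) ∣ z → m * n ∣ z.natAbs := fun z hz => by
    rw [← Int.natCast_dvd_natCast, Int.dvd_natAbs]
    exact_mod_cast hz
  refine smul_ne_of_trace ?_ ?_ y <;> rw [modU_trace] <;> intro hd
  · have := Nat.dvd_one.1 (hnat _ hd)
    omega
  · rcases (Nat.dvd_prime Nat.prime_three).1 (hnat _ hd) with h | h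
    · omega
    · exact h3 h

/-- Fixing the base coset means lying in ±`gammaPair m n`, whose upper left entries are ±1 modulo m.
In the small cases this fact and the orbit sizes determine the number of fixed points. -/
theorem smul_base_ne {m n : ℕ} (h : 1 < m) {g : SL(2, ℤ)} (hg : g 0 0 = 0) :
    g • (QuotientGroup.mk 1 : SignedQuotient (gammaPair m n)) ≠ QuotientGroup.mk 1 := by
  rw [Ne, smul_mk_eq_iff, inv_one, one_mul, mul_one]
  have h1 : ∀ A : SL(2, ℤ), A 0 0 = 0 → A ∉ gammaPair m n := by
    rintro A hA ⟨h1, -⟩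
    rw [hA, zero_sub, dvd_neg] at h1
    have := Int.le_of_dvd one_pos h1
    omega
  rintro (h | h)
  · exact h1 _ hg h
  · exact h1 (-g) (neg_eq_zero.2 hg) h

theorem neg_one_notMem_gammaPair {m n : ℕ} (hm : 3 ≤ m) : -1 ∉ gammaPair m n := by
  rintro ⟨h, -⟩
  change (m : ℤ) ∣ -1 - 1 at h
  rw [← dvd_neg] at h
  have := Int.le_of_dvd (by norm_num) h
  omega

theorem neg_one_mem_gammaPair {n : ℕ} (hn : n ∣ 2) : -1 ∈ gammaPair 2 n := by
  have : (n : ℤ) ∣ 2 := by exact_mod_cast hn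
  refine ⟨?_, ?_, ?_, ?_⟩
  · change ((2 : ℕ) : ℤ) ∣ -1 - 1; norm_num
  · change ((2 : ℕ) : ℤ) ∣ -0; norm_num
  · change (n : ℤ) ∣ -0; norm_num
  · change (n : ℤ) ∣ -1 - 1; norm_num; exact this

theorem unimodularCount_two : unimodularCount 2 = 3 := by
  have := unimodularCount_eq two_ne_zero
  rw [Nat.Prime.primeFactors Nat.prime_two] at this
  norm_num at this
  exact_mod_cast this

theorem unimodularCount_three : unimodularCount 3 = 8 := by
  have := unimodularCount_eq three_ne_zero
  rw [Nat.Prime.primeFactors Nat.prime_three] at this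
  norm_num at this
  exact_mod_cast this

/-- The generic count of homomorphisms. -/
theorem card_hom_gammaPair {m n k : ℕ} (hk : k ≠ 0) (hm : 3 ≤ m) (hn : n ≠ 0) (hnm : n ∣ m)
    (h31 : (m, n) ≠ (3, 1)) :
    ∃ j : ℕ, n * unimodularCount m = 12 * j ∧
      Nat.card (gammaPair m n →* Multiplicative (ZMod k)) = k ^ (1 + j) := by
  have : NeZero k := ⟨hk⟩
  have hfin := finite_signedQuotient (by omega : m ≠ 0) hn hnm
  have hneg := neg_one_notMem_gammaPair (n := n) hm
  obtain ⟨o₂, o₃, h₂, h₃, h⟩ := card_signedSubgroup_hom (Γ := gammaPair m n)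
    (smul_zero 2 : 2 • (0 : ZMod k) = 0)
  have hmn : 3 ≤ m * n := le_trans hm (Nat.le_mul_of_pos_right _ (Nat.pos_of_ne_zero hn))
  have hmn3 : m * n ≠ 3 := by
    intro h
    have : m = 3 := by
      have := (Nat.dvd_prime Nat.prime_three).1 (h ▸ dvd_mul_right m n)
      omega
    subst this
    exact h31 (by rw [show n = 1 by omega])
  have e₂ : Nat.card {y : SignedQuotient (gammaPair m n) // ModularGroup.S • y = y} = 0 :=
    Nat.card_eq_zero.2 <| Or.inl ⟨fun y => modS_smul_ne (by omega) y.1 y.2⟩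
  have e₃ : Nat.card {y : SignedQuotient (gammaPair m n) // modU • y = y} = 0 :=
    Nat.card_eq_zero.2 <| Or.inl ⟨fun y => modU_smul_ne (by omega) hmn3 y.1 y.2⟩
  rw [e₂, zero_add] at h₂
  rw [e₃, zero_add] at h₃
  rw [e₂, e₃, pow_zero, pow_zero, mul_one, mul_one,
    Nat.card_zmod, h₂] at h
  have hi := index_eq_two_mul_index_signedSubgroup hneg
  rw [index_gammaPair (by omega) hnm] at hi
  change _ = 2 * Nat.card (SignedQuotient (gammaPair m n)) at hi
  have hpos : n * unimodularCount m ≠ 0 :=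
    mul_ne_zero hn (unimodularCount_ne_zero (by omega))
  -- The quotient has 2 `o₂` = 3 `o₃` points, so 3 divides `o₂`, and the index of Γ is 4 `o₂`.
  refine ⟨o₂ / 3, by omega, ?_⟩
  rw [← card_hom_signedSubgroup hneg ⟨-1, neg_one_mem_signedSubgroup _⟩ rfl]
  have hkpos : 0 < k ^ (2 * o₂ - 1) := pow_pos (Nat.pos_of_ne_zero hk) _
  refine Nat.eq_of_mul_eq_mul_right hkpos (h.trans ?_)
  rw [← pow_add, ← pow_add]
  congr 1
  omega

/-- The quotient has four points. S acts freely, and U moves the base point, so it has exactly one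
fixed point, which contributes the solutions of 3a = 0. -/
theorem card_hom_gammaPair_three {k : ℕ} (hk : k ≠ 0) :
    Nat.card (gammaPair 3 1 →* Multiplicative (ZMod k)) = k * Nat.gcd k 3 := by
  have : NeZero k := ⟨hk⟩
  have hfin := finite_signedQuotient three_ne_zero one_ne_zero (one_dvd 3)
  have hneg := neg_one_notMem_gammaPair (n := 1) le_rfl
  obtain ⟨o₂, o₃, h₂, h₃, h⟩ := card_signedSubgroup_hom (Γ := gammaPair 3 1)
    (smul_zero 2 : 2 • (0 : ZMod k) = 0)
  have e₂ : Nat.card {y : SignedQuotient (gammaPair 3 1) // ModularGroup.S • y = y} = 0 :=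
    Nat.card_eq_zero.2 <| Or.inl ⟨fun y => modS_smul_ne (by omega) y.1 y.2⟩
  have hlt := Finite.card_subtype_lt
    (p := fun y : SignedQuotient (gammaPair 3 1) => modU • y = y)
    (smul_base_ne (m := 3) (n := 1) (by omega) modU_apply_zero_zero)
  rw [e₂, zero_add] at h₂
  have hi := index_eq_two_mul_index_signedSubgroup hneg
  rw [index_gammaPair (by omega) (one_dvd 3), unimodularCount_three] at hi
  change _ = 2 * Nat.card (SignedQuotient (gammaPair 3 1)) at hi
  rw [e₂, pow_zero, mul_one, Nat.card_zmod, ZMod.card_nsmul_eq_zero,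
    show Nat.card (SignedQuotient (gammaPair 3 1)) - 1 = 3 by omega, show o₂ = 2 by omega,
    show o₃ = 1 by omega, show Nat.card {y : SignedQuotient (gammaPair 3 1) // modU • y = y} = 1
      by omega, pow_one] at h
  rw [← card_hom_signedSubgroup hneg ⟨-1, neg_one_mem_signedSubgroup _⟩ rfl]
  have hkpos : 0 < k ^ 3 := pow_pos (Nat.pos_of_ne_zero hk) _
  refine Nat.eq_of_mul_eq_mul_right hkpos (h.trans ?_)
  ring

/-- If `-1 ∈ Γ`, the homomorphisms on `Γ` are sorted by their values at `-1`. -/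
theorem card_hom_eq_sum_of_neg_one_mem (h : -1 ∈ Γ) {A : Type*} [AddCommGroup A] :
    Nat.card (Γ →* Multiplicative A) =
      Nat.card (Σ e : {e : A // 2 • e = 0}, {b : signedSubgroup Γ →* Multiplicative A //
          b ⟨-1, neg_one_mem_signedSubgroup Γ⟩ = Multiplicative.ofAdd e.1}) := by
  have key : ∀ H : Subgroup SL(2, ℤ), H = Γ →
      Nat.card (H →* Multiplicative A) = Nat.card (Γ →* Multiplicative A) := by
    rintro _ rfl; rfl
  rw [← key _ (signedSubgroup_eq_self h)]
  let z : signedSubgroup Γ := ⟨-1, neg_one_mem_signedSubgroup Γ⟩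
  have hz : z * z = 1 := Subtype.ext (neg_one_mul (-1 : SL(2, ℤ)) |>.trans (neg_neg 1))
  have hb : ∀ b : signedSubgroup Γ →* Multiplicative A, 2 • (b z).toAdd = 0 := by
    intro b
    rw [two_nsmul, ← toAdd_mul, ← map_mul, hz, map_one]
    rfl
  refine Nat.card_congr ⟨fun b => ⟨⟨(b z).toAdd, hb b⟩, b, rfl⟩, fun x => x.2.1, fun _ => rfl, ?_⟩
  rintro ⟨⟨e, he⟩, b, hbe⟩
  obtain rfl : (b z).toAdd = e := congrArg Multiplicative.toAdd hbe
  rfl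

/-- On the six points of the quotient both S and U act freely, so each admissible value at -1 is
taken by k² homomorphisms. The choice of that value gives the factor gcd(k, 2). -/
theorem card_hom_gammaPair_two_two {k : ℕ} (hk : k ≠ 0) :
    Nat.card (gammaPair 2 2 →* Multiplicative (ZMod k)) = k ^ 2 * Nat.gcd k 2 := by
  have : NeZero k := ⟨hk⟩
  have hfin := finite_signedQuotient two_ne_zero two_ne_zero (dvd_refl 2)
  have hneg := neg_one_mem_gammaPair (dvd_refl 2)
  have e₂ : Nat.card {y : SignedQuotient (gammaPair 2 2) // ModularGroup.S • y = y} = 0 :=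
    Nat.card_eq_zero.2 <| Or.inl ⟨fun y => modS_smul_ne (by omega) y.1 y.2⟩
  have e₃ : Nat.card {y : SignedQuotient (gammaPair 2 2) // modU • y = y} = 0 :=
    Nat.card_eq_zero.2 <| Or.inl ⟨fun y => modU_smul_ne (by omega) (by omega) y.1 y.2⟩
  have hi := index_gammaPair two_ne_zero (dvd_refl 2)
  rw [← signedSubgroup_eq_self hneg, unimodularCount_two] at hi
  change Nat.card (SignedQuotient (gammaPair 2 2)) = 6 at hi
  have hcard : ∀ e : {e : ZMod k // 2 • e = 0},
      Nat.card {b : signedSubgroup (gammaPair 2 2) →* Multiplicative (ZMod k) //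
          b ⟨-1, neg_one_mem_signedSubgroup _⟩ = Multiplicative.ofAdd e.1} = k ^ 2 := by
    rintro ⟨e, he⟩
    obtain ⟨o₂, o₃, h₂, h₃, h⟩ := card_signedSubgroup_hom (Γ := gammaPair 2 2) he
    rw [e₂, zero_add, hi] at h₂
    rw [e₃, zero_add, hi] at h₃
    rw [e₂, e₃, pow_zero, pow_zero, mul_one, mul_one,
      Nat.card_zmod, hi, show o₂ = 3 by omega, show o₃ = 2 by omega] at h
    have hkpos : 0 < k ^ (6 - 1) := pow_pos (Nat.pos_of_ne_zero hk) _
    refine Nat.eq_of_mul_eq_mul_right hkpos (h.trans ?_)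
    ring
  have : ∀ e : {e : ZMod k // 2 • e = 0},
      Finite {b : signedSubgroup (gammaPair 2 2) →* Multiplicative (ZMod k) //
          b ⟨-1, neg_one_mem_signedSubgroup _⟩ = Multiplicative.ofAdd e.1} := fun e =>
    Nat.finite_of_card_ne_zero (by rw [hcard]; positivity)
  rw [card_hom_eq_sum_of_neg_one_mem hneg, Nat.card_sigma, Finset.sum_congr rfl fun e _ => hcard e,
    Finset.sum_const, Finset.card_univ, ← Nat.card_eq_fintype_card, ZMod.card_nsmul_eq_zero,
    smul_eq_mul, mul_comm]

theorem finite_hom_of_fg {G B : Type*} [Group G] [Group.FG G] [Group B] [Finite B] :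
    Finite (G →* B) := by
  obtain ⟨T, hT⟩ := (Group.fg_def (G := G)).1 inferInstance
  refine Finite.of_injective (fun (f : G →* B) (t : T) => f t) fun f g h => ?_
  exact MonoidHom.eq_of_eqOn_dense hT fun t ht => congrFun h ⟨t, ht⟩

theorem fg_of_finite_quotient (H : Subgroup SL(2, ℤ)) [H.FiniteIndex] : Group.FG H := by
  have : Group.FG SL(2, ℤ) := Group.fg_iff.2 ⟨_, closure_modS_modU, Set.toFinite _⟩
  infer_instance

/-- On the three points S has one fixed point, contributing the solutions of 2a = e with e the value
at -1. Summed over all e with 2e = 0, these are the solutions of 4a = 0, whence the factor ℤ/4. -/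
theorem card_hom_gammaPair_two_one {k : ℕ} (hk : k ≠ 0) :
    Nat.card (gammaPair 2 1 →* Multiplicative (ZMod k)) = k * Nat.gcd k 4 := by
  have : NeZero k := ⟨hk⟩
  have hfin := finite_signedQuotient two_ne_zero one_ne_zero (one_dvd 2)
  have hneg := neg_one_mem_gammaPair (one_dvd 2)
  have e₃ : Nat.card {y : SignedQuotient (gammaPair 2 1) // modU • y = y} = 0 :=
    Nat.card_eq_zero.2 <| Or.inl ⟨fun y => modU_smul_ne (by omega) (by omega) y.1 y.2⟩
  have hi := index_gammaPair two_ne_zero (one_dvd 2)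
  rw [← signedSubgroup_eq_self hneg, unimodularCount_two] at hi
  change Nat.card (SignedQuotient (gammaPair 2 1)) = 3 at hi
  have hlt := Finite.card_subtype_lt
    (p := fun y : SignedQuotient (gammaPair 2 1) => ModularGroup.S • y = y)
    (smul_base_ne (m := 2) (n := 1) (by omega) (show ModularGroup.S 0 0 = 0 by decide))
  have hcard : ∀ e : {e : ZMod k // 2 • e = 0},
      Nat.card {b : signedSubgroup (gammaPair 2 1) →* Multiplicative (ZMod k) //
          b ⟨-1, neg_one_mem_signedSubgroup _⟩ = Multiplicative.ofAdd e.1} =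
        k * Nat.card {a : ZMod k // 2 • a = e.1} := by
    rintro ⟨e, he⟩
    obtain ⟨o₂, o₃, h₂, h₃, h⟩ := card_signedSubgroup_hom (Γ := gammaPair 2 1) he
    rw [e₃, zero_add, hi] at h₃
    rw [e₃, pow_zero, mul_one,
      Nat.card_zmod, hi, show o₂ = 1 by omega, show o₃ = 1 by omega,
      show Nat.card {y : SignedQuotient (gammaPair 2 1) // ModularGroup.S • y = y} = 1 by omega,
      pow_one] at h
    have hkpos : 0 < k ^ (3 - 1) := pow_pos (Nat.pos_of_ne_zero hk) _
    refine Nat.eq_of_mul_eq_mul_right hkpos (h.trans ?_)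
    ring
  have : ∀ e : {e : ZMod k // 2 • e = 0},
      Finite {b : signedSubgroup (gammaPair 2 1) →* Multiplicative (ZMod k) //
          b ⟨-1, neg_one_mem_signedSubgroup _⟩ = Multiplicative.ofAdd e.1} := by
    have : (signedSubgroup (gammaPair 2 1)).FiniteIndex := ⟨fun h => by
      change Nat.card (SignedQuotient (gammaPair 2 1)) = 0 at h
      omega⟩
    have := fg_of_finite_quotient (signedSubgroup (gammaPair 2 1))
    have := finite_hom_of_fg (G := signedSubgroup (gammaPair 2 1)) (B := Multiplicative (ZMod k))
    infer_instance
  rw [card_hom_eq_sum_of_neg_one_mem hneg, Nat.card_sigma, Finset.sum_congr rfl fun e _ => hcard e,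
    ← Finset.mul_sum, ← Nat.card_sigma, ← ZMod.card_nsmul_eq_zero]
  congr 1
  have h4 : ∀ a : ZMod k, 4 • a = 2 • 2 • a := fun a => by rw [smul_smul]; norm_num
  refine Nat.card_congr ⟨fun x => ⟨x.2.1, by rw [h4, x.2.2, x.1.2]⟩,
    fun a => ⟨⟨2 • a.1, by rw [← h4, a.2]⟩, a.1, rfl⟩, ?_, fun _ => rfl⟩
  rintro ⟨⟨e, he⟩, ⟨a, ha⟩⟩
  change 2 • a = e at ha
  subst ha
  rfl

end HomCounting

/-! ### Recognising an abelian group by its homomorphisms to ℤ/k. -/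

section HomDetection

open scoped DirectSum

theorem card_addMonoidHom_prod (A B C : Type*) [AddCommGroup A] [AddCommGroup B] [AddCommGroup C] :
    Nat.card (A × B →+ C) = Nat.card (A →+ C) * Nat.card (B →+ C) := by
  rw [← Nat.card_prod]
  exact Nat.card_congr ⟨fun f => (f.comp (AddMonoidHom.inl A B), f.comp (AddMonoidHom.inr A B)),
    fun p => p.1.coprod p.2, fun f => f.coprod_unique, fun p => by
      simp [AddMonoidHom.coprod_comp_inl, AddMonoidHom.coprod_comp_inr]⟩

theorem card_addMonoidHom_zmod (c k : ℕ) [NeZero k] :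
    Nat.card (ZMod c →+ ZMod k) = Nat.gcd k c := by
  rw [← ZMod.card_nsmul_eq_zero c k, ← Nat.card_congr (ZMod.lift c)]
  refine Nat.card_congr ((zmultiplesHom (ZMod k)).subtypeEquiv fun a => ?_).symm
  simp

/-- A finitely generated abelian group is determined by its numbers of homomorphisms to finite
cyclic groups; here in the case of a cyclic torsion subgroup. -/
theorem addEquiv_of_card_hom (M : Type*) [AddCommGroup M] [AddGroup.FG M] {r t : ℕ} (ht : t ≠ 0)
    (h : ∀ k : ℕ, k ≠ 0 → Nat.card (M →+ ZMod k) = k ^ r * Nat.gcd k t) :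
    Nonempty (M ≃+ ZMod t × (Fin r → ℤ)) := by
  classical
  obtain ⟨n, ι, _, p, hp, e, ⟨f⟩⟩ := AddCommGroup.equiv_free_prod_directSum_zmod M
  let c : ι → ℕ := fun i => p i ^ e i
  have hc : ∀ i, c i ≠ 0 := fun i => pow_ne_zero _ (hp i).ne_zero
  have hne : ∀ i, NeZero (c i) := fun i => ⟨hc i⟩
  have hcount : ∀ k : ℕ, k ≠ 0 → k ^ n * ∏ i, Nat.gcd k (c i) = k ^ r * Nat.gcd k t := by
    intro k hk
    have : NeZero k := ⟨hk⟩
    rw [← h k hk, Nat.card_congr (AddEquiv.addMonoidHomCongrLeftEquiv (N := ZMod k) f),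
      card_addMonoidHom_prod]
    congr 1
    · rw [← Nat.card_congr (Finsupp.liftAddHom (α := Fin n) (M := ℤ) (N := ZMod k)).toEquiv,
        Nat.card_fun, ← Nat.card_congr (zmultiplesHom (ZMod k)), Nat.card_zmod, Nat.card_fin]
    · change _ = Nat.card ((Π₀ i, ZMod (c i)) →+ ZMod k)
      rw [← Nat.card_congr (DFinsupp.liftAddHom (β := fun i => ZMod (c i)) (γ := ZMod k)).toEquiv,
        Nat.card_pi]
      exact Finset.prod_congr rfl fun i _ => (card_addMonoidHom_zmod (c i) k).symm
  have hnr : n = r := by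
    -- A prime larger than `t` and every `c i` does not see the torsion, so the count isolates the
    -- rank.
    obtain ⟨q, hq, hqp⟩ := Nat.exists_infinite_primes (t + ∑ i, c i + 1)
    have h1 : ∀ d, d ≠ 0 → d < q → Nat.gcd q d = 1 := fun d hd hdq =>
      (hqp.coprime_iff_not_dvd).2 fun hdvd => by
        have := Nat.le_of_dvd (Nat.pos_of_ne_zero hd) hdvd
        omega
    have h2 := hcount q hqp.ne_zero
    rw [h1 t ht (by omega), Finset.prod_congr rfl fun i _ => h1 (c i) (hc i) (by
      have := Finset.single_le_sum (fun i _ => Nat.zero_le (c i)) (Finset.mem_univ i)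
      omega), Finset.prod_const_one, mul_one, mul_one] at h2
    exact Nat.pow_right_injective hqp.two_le h2
  subst hnr
  have hgcd : ∀ k : ℕ, k ≠ 0 → ∏ i, Nat.gcd k (c i) = Nat.gcd k t := fun k hk =>
    Nat.eq_of_mul_eq_mul_left (pow_pos (Nat.pos_of_ne_zero hk) n) (hcount k hk)
  let T := (i : ι) → ZMod (c i)
  have hT : Nat.card T = t := by
    rw [Nat.card_pi]
    -- Taking k to be this common multiple turns every gcd into its second argument and gives the
    -- order of the torsion group.
    have h1 : t * ∏ i, c i ≠ 0 := mul_ne_zero ht (Finset.prod_ne_zero_iff.2 fun i _ => hc i)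
    have h2 := hgcd _ h1
    rw [Nat.gcd_eq_right (dvd_mul_right _ _)] at h2
    rw [← h2]
    refine Finset.prod_congr rfl fun i _ => ?_
    rw [Nat.card_zmod,
      Nat.gcd_eq_right (Dvd.dvd.mul_left (Finset.dvd_prod_of_mem c (Finset.mem_univ i)) _)]
  have hcyc : IsAddCyclic T := by
    have : Fintype T := Fintype.ofFinite T
    -- There are gcd(k, t) ≤ k solutions of kx = 0, which forces a finite abelian group to be
    -- cyclic.
    refine isAddCyclic_of_card_nsmul_eq_zero_le fun k hk => ?_
    have h1 : Nat.card {x : T // k • x = 0} = Nat.gcd k t := by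
      rw [← hgcd k hk.ne']
      have E : {x : T // k • x = 0} ≃ ((i : ι) → {a : ZMod (c i) // k • a = 0}) :=
        { toFun := fun x i => ⟨x.1 i, congrFun x.2 i⟩
          invFun := fun y => ⟨fun i => y i, funext fun i => (y i).2⟩
          left_inv := fun _ => rfl
          right_inv := fun _ => rfl }
      rw [Nat.card_congr E, Nat.card_pi]
      exact Finset.prod_congr rfl fun i _ => by rw [ZMod.card_nsmul_eq_zero, Nat.gcd_comm]
    rw [Nat.card_eq_fintype_card, Fintype.card_subtype] at h1
    rw [h1]
    exact Nat.gcd_le_left _ hk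
  have g : T ≃+ ZMod t := by
    rw [← hT]
    exact (zmodAddCyclicAddEquiv hcyc).symm
  exact ⟨f.trans (AddEquiv.prodComm.trans
    (((DirectSum.addEquivProd fun i => ZMod (c i)).trans g).prodCongr
      Finsupp.addEquivFunOnFinite))⟩

open MatrixGroups

/-- A subgroup of finite index in `SL₂(ℤ)` has the abelianization detected by its numbers of
homomorphisms to finite cyclic groups. -/
theorem abelianization_of_card_hom (Γ : Subgroup SL(2, ℤ)) [Γ.FiniteIndex] {r t : ℕ} (ht : t ≠ 0)
    (h : ∀ k : ℕ, k ≠ 0 → Nat.card (Γ →* Multiplicative (ZMod k)) = k ^ r * Nat.gcd k t) :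
    Nonempty (Abelianization Γ ≃* Multiplicative (ZMod t × (Fin r → ℤ))) := by
  have := fg_of_finite_quotient Γ
  have : Group.FG (Abelianization Γ) := Group.fg_of_surjective (f := Abelianization.of)
    (QuotientGroup.mk_surjective)
  obtain ⟨f⟩ := addEquiv_of_card_hom (Additive (Abelianization Γ)) ht fun k hk => by
    rw [← h k hk]
    exact (Nat.card_congr (Abelianization.lift.trans MonoidHom.toAdditiveLeft)).symm
  exact ⟨AddEquiv.toMultiplicativeRight f⟩

end HomDetection

/-! ### Assembling the theorem. -/

section MainTheorem

theorem stdCongruencePlus_comp_of_injective {n : ℕ} {G H : Type*} [Group G] [Group H]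
    (π : FreeGroup (Fin n) →* G) {f : G →* H} (hf : Function.Injective f) :
    stdCongruencePlus (f.comp π) = stdCongruencePlus π := by
  have : stdCongruence (f.comp π) = stdCongruence π := by
    ext φ
    change (f.comp π).comp φ.toMonoidHom = f.comp π ↔ π.comp φ.toMonoidHom = π
    rw [MonoidHom.comp_assoc, MonoidHom.cancel_left hf]
  rw [stdCongruencePlus, this, stdCongruencePlus]

theorem finiteIndex_gammaPair {m n : ℕ} (hm : m ≠ 0) (hnm : n ∣ m) :
    (gammaPair m n).FiniteIndex := ⟨by
  rw [index_gammaPair hm hnm]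
  exact mul_ne_zero (fun h => hm (Nat.eq_zero_of_zero_dvd (h ▸ hnm))) (unimodularCount_ne_zero hm)⟩

theorem abelianization_stdCongruencePlus_of_card_hom {m n r t : ℕ} (hm : m ≠ 0) (hnm : n ∣ m)
    (ht : t ≠ 0)
    (h : ∀ k : ℕ, k ≠ 0 →
      Nat.card (gammaPair m n →* Multiplicative (ZMod k)) = k ^ r * Nat.gcd k t)
    (π : FreeGroup (Fin 2) →* Multiplicative (ZMod m × ZMod n)) (hπ : Function.Surjective π) :
    Nonempty (Abelianization (stdCongruencePlus π) ≃*
      Multiplicative ((ZMod m × ZMod n) × (ZMod t × (Fin r → ℤ)))) := by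
  have := finiteIndex_gammaPair hm hnm
  obtain ⟨f⟩ := abelianization_stdCongruencePlus hm hnm π hπ
  obtain ⟨g⟩ := abelianization_of_card_hom (gammaPair m n) ht h
  exact ⟨f.trans (((MulEquiv.refl _).prodCongr g).trans (MulEquiv.prodMultiplicative _ _).symm)⟩

theorem abelianization_stdCongruencePlus_cyclic_of_card_hom {m r t : ℕ} (hm : m ≠ 0) (ht : t ≠ 0)
    (h : ∀ k : ℕ, k ≠ 0 →
      Nat.card (gammaPair m 1 →* Multiplicative (ZMod k)) = k ^ r * Nat.gcd k t)
    (π : FreeGroup (Fin 2) →* Multiplicative (ZMod m)) (hπ : Function.Surjective π) :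
    Nonempty (Abelianization (stdCongruencePlus π) ≃*
      Multiplicative (ZMod m × (ZMod t × (Fin r → ℤ)))) := by
  -- The cyclic case is n = 1; composing π with an injection does not change Γ⁺.
  have e : ZMod m × ZMod 1 ≃+ ZMod m := AddEquiv.prodUnique
  let f := AddEquiv.toMultiplicative e.symm
  rw [← stdCongruencePlus_comp_of_injective π (f := f.toMonoidHom) f.injective]
  obtain ⟨g⟩ := abelianization_stdCongruencePlus_of_card_hom hm (one_dvd m) ht h
    (f.toMonoidHom.comp π) (f.surjective.comp hπ)
  exact ⟨g.trans (AddEquiv.toMultiplicative (e.prodCongr (AddEquiv.refl _)))⟩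

theorem theorem1p1 :
    (∀ m n : ℕ, 3 ≤ m → n ∣ m → (m, n) ≠ (3, 1) →
      ∀ π : FreeGroup (Fin 2) →* Multiplicative (ZMod m × ZMod n), Function.Surjective π →
        ∃ r : ℕ,
          (r : ℚ) = 1 + (n : ℚ) * (m : ℚ) ^ 2 / 12 * ∏ p ∈ m.primeFactors, (1 - 1 / (p : ℚ) ^ 2) ∧
          Nonempty (Abelianization (stdCongruencePlus π) ≃*
            Multiplicative ((ZMod m × ZMod n) × (Fin r → ℤ)))) ∧
    (∀ π : FreeGroup (Fin 2) →* Multiplicative (ZMod 2), Function.Surjective π →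
      Nonempty (Abelianization (stdCongruencePlus π) ≃*
        Multiplicative (ZMod 2 × ZMod 4 × ℤ))) ∧
    (∀ π : FreeGroup (Fin 2) →* Multiplicative (ZMod 3), Function.Surjective π →
      Nonempty (Abelianization (stdCongruencePlus π) ≃*
        Multiplicative (ZMod 3 × ZMod 3 × ℤ))) ∧
    (∀ π : FreeGroup (Fin 2) →* Multiplicative (ZMod 2 × ZMod 2), Function.Surjective π →
      Nonempty (Abelianization (stdCongruencePlus π) ≃*
        Multiplicative (ZMod 2 × ZMod 2 × ZMod 2 × (Fin 2 → ℤ)))) := by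
  have e₁ : (Fin 1 → ℤ) ≃+ ℤ := AddEquiv.piUnique fun _ => ℤ
  refine ⟨fun m n hm hnm h31 π hπ => ?_, fun π hπ => ?_, fun π hπ => ?_, fun π hπ => ?_⟩
  · have hm0 : m ≠ 0 := by omega
    have hn0 : n ≠ 0 := fun h => hm0 (Nat.eq_zero_of_zero_dvd (h ▸ hnm))
    -- The choice k = 1 only serves to extract `j`, which the index determines independently of k.
    obtain ⟨j, hj, -⟩ := card_hom_gammaPair one_ne_zero hm hn0 hnm h31
    refine ⟨1 + j, ?_, ?_⟩
    · have hj' : (n : ℚ) * unimodularCount m = 12 * j := by exact_mod_cast hj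
      rw [unimodularCount_eq hm0] at hj'
      push_cast
      linear_combination -hj' / 12
    · obtain ⟨g⟩ := abelianization_stdCongruencePlus_of_card_hom (r := 1 + j) hm0 hnm one_ne_zero
        (fun k hk => by
          obtain ⟨j', hj', h⟩ := card_hom_gammaPair hk hm hn0 hnm h31
          obtain rfl : j' = j := by omega
          rw [h, Nat.gcd_one_right, mul_one]) π hπ
      have e : ZMod 1 × (Fin (1 + j) → ℤ) ≃+ (Fin (1 + j) → ℤ) := AddEquiv.uniqueProd
      exact ⟨g.trans (AddEquiv.toMultiplicative ((AddEquiv.refl _).prodCongr e))⟩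
  · obtain ⟨g⟩ := abelianization_stdCongruencePlus_cyclic_of_card_hom (r := 1) two_ne_zero
      four_ne_zero (fun k hk => by rw [card_hom_gammaPair_two_one hk, pow_one]) π hπ
    exact ⟨g.trans (AddEquiv.toMultiplicative
      ((AddEquiv.refl _).prodCongr ((AddEquiv.refl _).prodCongr e₁)))⟩
  · obtain ⟨g⟩ := abelianization_stdCongruencePlus_cyclic_of_card_hom (r := 1) three_ne_zero
      three_ne_zero (fun k hk => by rw [card_hom_gammaPair_three hk, pow_one]) π hπ
    exact ⟨g.trans (AddEquiv.toMultiplicative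
      ((AddEquiv.refl _).prodCongr ((AddEquiv.refl _).prodCongr e₁)))⟩
  · obtain ⟨g⟩ := abelianization_stdCongruencePlus_of_card_hom two_ne_zero (dvd_refl 2)
      two_ne_zero (fun k hk => card_hom_gammaPair_two_two hk) π hπ
    exact ⟨g.trans (AddEquiv.toMultiplicative AddEquiv.prodAssoc)⟩

end MainTheorem
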